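/- There is a tally oracle $O \subseteq \{0\}^*$ such that the following two statements hold. 1. Every nonempty set $L \in \mathrm{PSPACE}^O$ has a p-optimal proof system relative to $O$. 2. There are arbitrarily complex sets with p-optimal proof systems relative to $O$: for every time-constructible function $t \colon \mathbb{N} \to \mathbb{N}$ there is a set $L \subseteq \{0,1\}^*$ that is decidable relative to $O$, satisfies $L \notin \mathrm{DTIME}^O(t)$, and has a p-optimal proof system relative to $O$. Here all machines are deterministic oracle Turing machines with a write-only oracle tape; for $\mathrm{PSPACE}^O$ the oracle tape is subject to the polynomial space bound as well; and $L \in \mathrm{DTIME}^O(t)$ means that $L$ is decided with oracle $O$ in time $O(t)$. A function $f$ on $\{0,1\}^*$ is a proof system for $L$ relative to $O$ if $f \in \mathrm{FP}^O$ and $\operatorname{ran}(f) = L$. It is p-optimal if for every proof system $g$ for $L$ relative to $O$ there are $\pi \in \mathrm{FP}^O$ and a polynomial $p$ with $|\pi(x)| \le p(|x|)$ and $f(\pi(x)) = g(x)$ for all $x \in \{0,1\}^*$. A function $t$ is time-constructible if $t(n) \ge n$ for all $n$ and the map $x \mapsto t(|x|)$ (in binary) is computable in time $O(t(|x|))$ by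 a Turing machine without oracle. -/

import Mathlib

/-! Deterministic multi-tape oracle Turing machines over the binary alphabet, the relativized
notions of polynomial-time function, polynomial space and time class, and proof systems. -/

namespace OracleTuring

/-- Finite words over the alphabet with the letters 0 (`false`) and 1 (`true`). -/
abbrev Word : Type := List Bool

/-- Head movements. -/
inductive Move : Type
  | left
  | stay
  | right

/-- A two-way infinite work tape. A cell holds a bit or the blank `none`. The fields hold the
scanned cell and the cells to its left and to its right that belong to the input or have been
visited, the nearest cell first in each list; all other cells are blank. -/
structure Tape : Type where
  left : List (Option Bool)
  head : Option Bool
  right : List (Option Bool)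

namespace Tape

/-- The tape containing the word `w`, with the head on its first letter. -/
def ofWord : Word → Tape
  | [] => ⟨[], none, []⟩
  | b :: w => ⟨[], some b, w.map some⟩

/-- Overwrite the scanned cell. -/
def write (T : Tape) (a : Option Bool) : Tape := ⟨T.left, a, T.right⟩

/-- Move the head by at most one cell. -/
def move : Tape → Move → Tape
  | ⟨[], a, r⟩, .left => ⟨[], none, a :: r⟩
  | ⟨b :: l, a, r⟩, .left => ⟨l, b, a :: r⟩
  | T, .stay => T
  | ⟨l, a, []⟩, .right => ⟨a :: l, none, []⟩
  | ⟨l, a, b :: r⟩, .right => ⟨a :: l, b, r⟩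

/-- The number of cells in use. -/
def size (T : Tape) : ℕ := T.left.length + 1 + T.right.length

end Tape

/-- What a machine with states `Q` and work tapes `ι` may do in one situation.

* `act next write move ask out`: go to state `next`; on each work tape, overwrite the scanned cell
  and then move the head; append the letters `ask` and `out` (if any) to the word on the write-only
  oracle tape and on the write-only output tape, respectively.
* `query yes no`: ask whether the word on the oracle tape belongs to the oracle, go to the state
  `yes` or `no` accordingly, and erase the oracle tape.
* `halt accept`: stop, accepting or rejecting. -/
inductive Instr (Q ι : Type) : Type
  | act (next : Q) (write : ι → Option Bool) (move : ι → Move) (ask out : Option Bool)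
  | query (yes no : Q)
  | halt (accept : Bool)

/-- A deterministic oracle Turing machine (or transducer): finitely many states, finitely many
work tapes, one of which initially carries the input, a write-only oracle tape and a write-only
output tape. The tape alphabet is fixed; as the number of tapes is arbitrary, a larger alphabet
is obtained by using several tapes in parallel. -/
structure OTM : Type 1 where
  State : Type
  TapeIdx : Type
  [finState : Fintype State]
  [finTapes : Fintype TapeIdx]
  [decTapes : DecidableEq TapeIdx]
  start : State
  inputTape : TapeIdx
  program : State → (TapeIdx → Option Bool) → Instr State TapeIdx

attribute [instance] OTM.finState OTM.finTapes OTM.decTapes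

namespace OTM

/-- A configuration of a machine. -/
structure Config (M : OTM) : Type where
  state : M.State
  tapes : M.TapeIdx → Tape
  oracleTape : Word
  output : Word

/-- The initial configuration on input `x`. -/
def init (M : OTM) (x : Word) : M.Config where
  state := M.start
  tapes := fun i => if i = M.inputTape then Tape.ofWord x else Tape.ofWord []
  oracleTape := []
  output := []

/-- The instruction that applies to a configuration. -/
def instr (M : OTM) (c : M.Config) : Instr M.State M.TapeIdx :=
  M.program c.state (fun i => (c.tapes i).head)

open Classical in
/-- One step of the machine with oracle `O`. A halted machine stays as it is. -/
noncomputable def step (M : OTM) (O : Set Word) (c : M.Config) : M.Config :=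
  match M.instr c with
  | .act q wr mv ask out =>
      { state := q
        tapes := fun i => ((c.tapes i).write (wr i)).move (mv i)
        oracleTape := c.oracleTape ++ ask.toList
        output := c.output ++ out.toList }
  | .query yes no =>
      { c with
        state := if c.oracleTape ∈ O then yes else no
        oracleTape := [] }
  | .halt _ => c

/-- The verdict of a halted configuration; `none` if the configuration is not halted. -/
def verdict (M : OTM) (c : M.Config) : Option Bool :=
  match M.instr c with
  | .halt a => some a
  | _ => none

/-- The configuration after `n` steps (or after halting, if that happens earlier) of the
computation on input `x` with oracle `O`. -/
noncomputable def run (M : OTM) (O : Set Word) (x : Word) (n : ℕ) : M.Config :=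
  (M.step O)^[n] (M.init x)

/-- The space used by a configuration: the cells in use on all work tapes (including the tape
that carries the input) and on the oracle tape. -/
def space (M : OTM) (c : M.Config) : ℕ :=
  (∑ i, (c.tapes i).size) + c.oracleTape.length

/-- On input `x` with oracle `O`, the machine halts within `n` steps with output `y`. -/
def OutputsWithin (M : OTM) (O : Set Word) (x : Word) (n : ℕ) (y : Word) : Prop :=
  (M.verdict (M.run O x n)).isSome ∧ (M.run O x n).output = y

/-- On input `x` with oracle `O`, the machine halts within `n` steps, accepting if `x ∈ L` and
rejecting if `x ∉ L`. -/
def DecidesWithin (M : OTM) (O : Set Word) (L : Set Word) (x : Word) (n : ℕ) : Prop :=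
  (x ∈ L ∧ M.verdict (M.run O x n) = some true) ∨
    (x ∉ L ∧ M.verdict (M.run O x n) = some false)

end OTM

/-- `f ∈ FP^O`. -/
def InFP (O : Set Word) (f : Word → Word) : Prop :=
  ∃ (M : OTM) (p : Polynomial ℕ), ∀ x : Word, M.OutputsWithin O x (p.eval x.length) (f x)

/-- `L` is decidable relative to `O`. -/
def DecidableIn (O : Set Word) (L : Set Word) : Prop :=
  ∃ M : OTM, ∀ x : Word, ∃ n : ℕ, M.DecidesWithin O L x n

/-- `L ∈ DTIME^O(t)`: decided in time `O(t)` with oracle `O`. -/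
def InDTIME (O : Set Word) (t : ℕ → ℕ) (L : Set Word) : Prop :=
  ∃ (M : OTM) (c : ℕ), ∀ x : Word, M.DecidesWithin O L x (c * t x.length + c)

/-- `L ∈ PSPACE^O`, where the oracle tape is subject to the space bound as well. -/
def InPSPACE (O : Set Word) (L : Set Word) : Prop :=
  ∃ (M : OTM) (p : Polynomial ℕ), ∀ x : Word,
    (∃ n : ℕ, M.DecidesWithin O L x n) ∧ ∀ n : ℕ, M.space (M.run O x n) ≤ p.eval x.length

/-- The binary representation of a number, most significant bit first. -/
def binary (n : ℕ) : Word := n.bits.reverse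

/-- `t` is time-constructible: `t n ≥ n`, and `x ↦ t |x|` (in binary) is computable in time
`O(t |x|)` without an oracle, that is, with the empty oracle. -/
def TimeConstructible (t : ℕ → ℕ) : Prop :=
  (∀ n, n ≤ t n) ∧
    ∃ (M : OTM) (c : ℕ), ∀ x : Word,
      M.OutputsWithin ∅ x (c * t x.length + c) (binary (t x.length))

/-- `f` is a proof system for `L` relative to `O`. -/
def IsProofSystem (O : Set Word) (f : Word → Word) (L : Set Word) : Prop :=
  InFP O f ∧ Set.range f = L

/-- `g` is p-simulated by `f` relative to `O`. -/
def PSimulated (O : Set Word) (g f : Word → Word) : Prop :=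
  ∃ (π : Word → Word) (p : Polynomial ℕ), InFP O π ∧
    ∀ x : Word, (π x).length ≤ p.eval x.length ∧ f (π x) = g x

/-- `L` has a p-optimal proof system relative to `O`. -/
def HasPOptimalProofSystem (O : Set Word) (L : Set Word) : Prop :=
  ∃ f : Word → Word, IsProofSystem O f L ∧
    ∀ g : Word → Word, IsProofSystem O g L → PSimulated O g f

/-- `T ⊆ 0*`. -/
def IsTally (T : Set Word) : Prop :=
  ∀ w ∈ T, ∃ n : ℕ, w = List.replicate n false

end OracleTuring

/-!
The oracle answers questions about machines that use the same oracle. This is not circular, because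
the questions are coded by words `0ᵖ` that are longer than all queries of the computations in
question, and so the oracle can be defined by recursion on the length of the words (`oracle`).

*Optimality.* A proof for the set `L` is a word `x 1 0ᵃ`, where `a` determines a machine and a number
of steps, by way of its exponent of 2 and its odd part. Before the machine is simulated on `x`, the
oracle is asked whether within that number of steps the machine outputs only elements of `L`, on all
inputs of any length (`Sound`); if this is denied, then the proof counts as a proof of a fixed
element of `L`. As the padding pays for the simulation, this is a polynomial-time proof system. Every
proof system for `L` is computed by a machine that passes the test, so it is simulated by way of the
padding `x ↦ x 1 0ᵃ` for suitable numbers `a`, polynomial in the length of `x`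
(`hasPOptimalProofSystem_of_sound`). It remains to see that the part of the oracle for words shorter
than the question suffices to find out whether an output `w` within `r` steps is in `L`. Here `w` has
length at most `r`, and the question may be made longer than any given polynomial in `r`.

*Polynomial space.* If `L` is decided in polynomial space, then the queries made in deciding `w` have
length at most polynomial in `r`, however long the computation is. A padding of a sufficiently high
degree exceeds this (`hasPOptimalProofSystem_of_inPSPACE`).

*Complex sets.* Given `t`, a tally set is defined by a diagonalization against the machines with time
bound `O(t)`, with priorities: a word `0ⁿ` is used for the diagonalization unless one of the first
`√n` transducers outputs it within the time that the diagonalization takes; in this case, `0ⁿ`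
is left out of the set, so that this transducer computes no proof system for it and need not be
observed any more. Each transducer leaves out at most one word (`Kills.unique`), so by counting
there remain enough words (`exists_not_kills`, `not_inDTIME_complex`). A transducer that only outputs
elements of the set needs, up to finitely many exceptions, at least the time of the diagonalization
to output `0ⁿ` (`diagTime_le_of_hits`). Within this time, the oracle can verify the membership
(`hasPOptimalProofSystem_complex`). The oracle also lists the set together with the times, which
makes the set decidable.

*Simulation.* There has to be one machine that simulates all machines, with polynomial slowdown.
The oracle provides the tables of the simulated machines. They are brought into the form of sweeping
machines (`Table`), which keep their tapes, folded at the heads, in two stacks, and rebuild these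
stacks in each step (`simulates_run`). The simulating machine is a program for stacks of bits
(`Cmd`), which is compiled to a Turing machine with one tape for each stack (`Cmd.run_toOTM`). All
loops in it have an explicit bound on their running time (`Run`, `exists_universal`).
-/

namespace OracleTuring

/-! ### A structured stack language and its compilation to Turing machines -/

/-- The registers of the stack language. Each of them is a stack of bits and lives on a work tape
of its own; `inp` initially carries the reversed input. -/
inductive Reg : Type
  | inp | z | y | p | q | g | u | v | ask | out | clk | res
  deriving DecidableEq

instance : Fintype Reg where
  elems := {.inp, .z, .y, .p, .q, .g, .u, .v, .ask, .out, .clk, .res}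
  complete r := by cases r <;> decide

/-- A state of the stack language: the contents of the registers, the top of a stack being the
head of the list, and the words on the oracle tape and on the output tape. -/
structure Store : Type where
  inp : Word := []
  z : Word := []
  y : Word := []
  p : Word := []
  q : Word := []
  g : Word := []
  u : Word := []
  v : Word := []
  ask : Word := []
  out : Word := []
  clk : Word := []
  res : Word := []
  oracleTape : Word := []
  output : Word := []

namespace Store

/-- The contents of a register. -/
def reg (s : Store) : Reg → Word
  | .inp => s.inp | .z => s.z | .y => s.y | .p => s.p | .q => s.q | .g => s.g
  | .u => s.u | .v => s.v | .ask => s.ask | .out => s.out | .clk => s.clk | .res => s.res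

/-- Overwrite a register. -/
def set (s : Store) (r : Reg) (w : Word) : Store :=
  match r with
  | .inp => { s with inp := w } | .z => { s with z := w } | .y => { s with y := w }
  | .p => { s with p := w } | .q => { s with q := w } | .g => { s with g := w }
  | .u => { s with u := w } | .v => { s with v := w } | .ask => { s with ask := w }
  | .out => { s with out := w } | .clk => { s with clk := w } | .res => { s with res := w }

theorem reg_set (s : Store) (r r' : Reg) (w : Word) :
    (s.set r w).reg r' = Function.update s.reg r w r' := by
  cases r <;> cases r' <;> rfl

@[simp] theorem reg_set_self (s : Store) (r : Reg) (w : Word) : (s.set r w).reg r = w := by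
  cases r <;> rfl

@[simp] theorem set_reg_self (s : Store) (r : Reg) : s.set r (s.reg r) = s := by
  cases r <;> rfl

@[simp] theorem oracleTape_set (s : Store) (r : Reg) (w : Word) :
    (s.set r w).oracleTape = s.oracleTape := by
  cases r <;> rfl

@[simp] theorem output_set (s : Store) (r : Reg) (w : Word) :
    (s.set r w).output = s.output := by
  cases r <;> rfl

end Store

/-- Programs of the stack language. `pop r e c d` pops the register `r` and continues with `e`, `c`
or `d` if the stack was empty, or if the letter was `false` or `true`, respectively; `loop r c d`
pops `r` until it is empty and runs `c` or `d` for each letter found. -/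
inductive Cmd : Type
  | skip
  | push (r : Reg) (b : Bool)
  | ask (b : Bool)
  | out (b : Bool)
  | query (c d : Cmd)
  | pop (r : Reg) (e c d : Cmd)
  | seq (c d : Cmd)
  | loop (r : Reg) (c d : Cmd)

/-- `Exec O c s s' t`: with oracle `O`, the program `c` leads from `s` to `s'` in `t` steps of the
compiled machine. -/
inductive Exec (O : Set Word) : Cmd → Store → Store → ℕ → Prop
  | skip (s) : Exec O .skip s s 1
  | push (r b s) : Exec O (.push r b) s (s.set r (b :: s.reg r)) 1
  | ask (b s) : Exec O (.ask b) s { s with oracleTape := s.oracleTape ++ [b] } 1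
  | out (b s) : Exec O (.out b) s { s with output := s.output ++ [b] } 1
  | query_yes {c d s s' t} : s.oracleTape ∈ O → Exec O c { s with oracleTape := [] } s' t →
      Exec O (.query c d) s s' (1 + t)
  | query_no {c d s s' t} : s.oracleTape ∉ O → Exec O d { s with oracleTape := [] } s' t →
      Exec O (.query c d) s s' (1 + t)
  | pop_nil {r e c d s s' t} : s.reg r = [] → Exec O e s s' t →
      Exec O (.pop r e c d) s s' (2 + t)
  | pop_false {r e c d s s' t w} : s.reg r = false :: w → Exec O c (s.set r w) s' t →
      Exec O (.pop r e c d) s s' (2 + t)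
  | pop_true {r e c d s s' t w} : s.reg r = true :: w → Exec O d (s.set r w) s' t →
      Exec O (.pop r e c d) s s' (2 + t)
  | seq {c d s s' s'' t t'} : Exec O c s s' t → Exec O d s' s'' t' →
      Exec O (.seq c d) s s'' (t + t')
  | loop_nil {r c d s} : s.reg r = [] → Exec O (.loop r c d) s s 2
  | loop_false {r c d s s' s'' t t' w} : s.reg r = false :: w → Exec O c (s.set r w) s' t →
      Exec O (.loop r c d) s' s'' t' → Exec O (.loop r c d) s s'' (2 + t + t')
  | loop_true {r c d s s' s'' t t' w} : s.reg r = true :: w → Exec O d (s.set r w) s' t →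
      Exec O (.loop r c d) s' s'' t' → Exec O (.loop r c d) s s'' (2 + t + t')

namespace Cmd

/-- The control states of the compiled program. A pop takes two states, as the head has to move
before it can read. -/
def Loc : Cmd → Type
  | skip | push _ _ | ask _ | out _ => Unit
  | query c d => Unit ⊕ (c.Loc ⊕ d.Loc)
  | pop _ e c d => Bool ⊕ (e.Loc ⊕ (c.Loc ⊕ d.Loc))
  | seq c d => c.Loc ⊕ d.Loc
  | loop _ c d => Bool ⊕ (c.Loc ⊕ d.Loc)

/-- The control state in which a program starts. -/
def entry : (c : Cmd) → c.Loc
  | skip | push _ _ | ask _ | out _ => ()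
  | query _ _ => .inl ()
  | pop _ _ _ _ => .inl false
  | seq c _ => .inl c.entry
  | loop _ _ _ => .inl false

/-- There are finitely many control states. -/
instance instFintypeLoc : (c : Cmd) → Fintype c.Loc
  | skip | push _ _ | ask _ | out _ => inferInstanceAs (Fintype Unit)
  | query c d =>
      have := instFintypeLoc c; have := instFintypeLoc d
      inferInstanceAs (Fintype (Unit ⊕ (c.Loc ⊕ d.Loc)))
  | pop _ e c d =>
      have := instFintypeLoc c; have := instFintypeLoc d; have := instFintypeLoc e
      inferInstanceAs (Fintype (Bool ⊕ (e.Loc ⊕ (c.Loc ⊕ d.Loc))))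
  | seq c d =>
      have := instFintypeLoc c; have := instFintypeLoc d
      inferInstanceAs (Fintype (c.Loc ⊕ d.Loc))
  | loop _ c d =>
      have := instFintypeLoc c; have := instFintypeLoc d
      inferInstanceAs (Fintype (Bool ⊕ (c.Loc ⊕ d.Loc)))

/-- Change to another control state. -/
def goto {Q : Type} (h : Reg → Option Bool) (q : Q) : Instr Q Reg :=
  .act q h (fun _ => .stay) none none

/-- Step left on the tape of `r`, to the topmost letter of the stack. -/
def back {Q : Type} (h : Reg → Option Bool) (r : Reg) (q : Q) : Instr Q Reg :=
  .act q h (fun i => if i = r then .left else .stay) none none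

/-- Erase the scanned cell of the tape of `r`. -/
def erase {Q : Type} (h : Reg → Option Bool) (r : Reg) (q : Q) : Instr Q Reg :=
  .act q (Function.update h r none) (fun _ => .stay) none none

/-- Select by a scanned symbol. -/
def select {α : Type} (e c d : α) : Option Bool → α
  | none => e
  | some false => c
  | some true => d

/-- The machine code of a program. Between two instructions, the heads are on the blank cells above
the stacks, so a program that does not pop scans only blanks. Its control states are embedded by `emb` into the states of a
machine, and it passes control to the state `ex` upon completion. -/
def code {Q : Type} : (c : Cmd) → (c.Loc → Q) → Q → c.Loc → (Reg → Option Bool) → Instr Q Reg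
  | skip, _, ex, _, h => goto h ex
  | push r b, _, ex, _, h =>
      .act ex (Function.update h r (some b)) (fun i => if i = r then .right else .stay) none none
  | ask b, _, ex, _, h => .act ex h (fun _ => .stay) (some b) none
  | out b, _, ex, _, h => .act ex h (fun _ => .stay) none (some b)
  | query c d, emb, _, .inl _, _ =>
      .query (emb (.inr (.inl c.entry))) (emb (.inr (.inr d.entry)))
  | query c _, emb, ex, .inr (.inl l), h => c.code (fun l => emb (.inr (.inl l))) ex l h
  | query _ d, emb, ex, .inr (.inr l), h => d.code (fun l => emb (.inr (.inr l))) ex l h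
  | pop r _ _ _, emb, _, .inl false, h => back h r (emb (.inl true))
  | pop r e c d, emb, _, .inl true, h =>
      erase h r (select (emb (.inr (.inl e.entry))) (emb (.inr (.inr (.inl c.entry))))
        (emb (.inr (.inr (.inr d.entry)))) (h r))
  | pop _ e _ _, emb, ex, .inr (.inl l), h => e.code (fun l => emb (.inr (.inl l))) ex l h
  | pop _ _ c _, emb, ex, .inr (.inr (.inl l)), h =>
      c.code (fun l => emb (.inr (.inr (.inl l)))) ex l h
  | pop _ _ _ d, emb, ex, .inr (.inr (.inr l)), h =>
      d.code (fun l => emb (.inr (.inr (.inr l)))) ex l h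
  | seq c d, emb, _, .inl l, h => c.code (fun l => emb (.inl l)) (emb (.inr d.entry)) l h
  | seq _ d, emb, ex, .inr l, h => d.code (fun l => emb (.inr l)) ex l h
  | loop r _ _, emb, _, .inl false, h => back h r (emb (.inl true))
  | loop r c d, emb, ex, .inl true, h =>
      erase h r (select ex (emb (.inr (.inl c.entry))) (emb (.inr (.inr d.entry))) (h r))
  | loop _ c _, emb, _, .inr (.inl l), h =>
      c.code (fun l => emb (.inr (.inl l))) (emb (.inl false)) l h
  | loop _ _ d, emb, _, .inr (.inr l), h =>
      d.code (fun l => emb (.inr (.inr l))) (emb (.inl false)) l h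

end Cmd

/-- The tape carries the stack `w`: the head is on the first blank after the stack, and all other
cells are blank. -/
def Tape.IsStack (T : Tape) (w : Word) : Prop :=
  ∃ j k, T = ⟨w.map some ++ List.replicate j none, none, List.replicate k none⟩

namespace Tape

theorem isStack_nil_ofWord : (ofWord []).IsStack [] := ⟨0, 0, rfl⟩

theorem IsStack.head {T : Tape} {w : Word} (h : T.IsStack w) : T.head = none := by
  obtain ⟨j, k, rfl⟩ := h; rfl

theorem IsStack.push {T : Tape} {w : Word} (h : T.IsStack w) (b : Bool) :
    ((T.write (some b)).move .right).IsStack (b :: w) := by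
  obtain ⟨j, k, rfl⟩ := h
  cases k with
  | zero => refine ⟨j, 0, ?_⟩; cases w <;> cases j <;> rfl
  | succ k => refine ⟨j, k, ?_⟩; cases w <;> cases j <;> rfl

theorem IsStack.back {T : Tape} {w : Word} (h : T.IsStack w) :
    ∃ T', T.move .left = T' ∧ T'.head = w.head? ∧ (T'.write none).IsStack w.tail := by
  obtain ⟨j, k, rfl⟩ := h
  refine ⟨_, rfl, ?_⟩
  cases w with
  | cons b w => exact ⟨rfl, j, k + 1, rfl⟩
  | nil =>
    cases j with
    | zero => exact ⟨rfl, 0, k + 1, rfl⟩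
    | succ j => exact ⟨rfl, j, k + 1, rfl⟩

@[simp] theorem write_head (T : Tape) : T.write T.head = T := rfl

@[simp] theorem move_stay (T : Tape) : T.move .stay = T := by
  rcases T with ⟨_ | _, _, _ | _⟩ <;> rfl

end Tape

namespace Cmd

variable {Q : Type} [Fintype Q] {start : Q} {prog : Q → (Reg → Option Bool) → Instr Q Reg}

/-- The machine over the tapes `Reg` with a given program. -/
abbrev machine (start : Q) (prog : Q → (Reg → Option Bool) → Instr Q Reg) : OTM where
  State := Q
  TapeIdx := Reg
  start := start
  inputTape := .inp
  program := prog

/-- The configuration `cf` is in state `q` and represents the store `s`. -/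
structure Represents (cf : (machine start prog).Config) (q : Q) (s : Store) : Prop where
  state : cf.state = q
  tapes : ∀ r, (cf.tapes r).IsStack (s.reg r)
  oracleTape : cf.oracleTape = s.oracleTape
  output : cf.output = s.output

theorem Represents.heads {cf : (machine start prog).Config} {q : Q} {s : Store}
    (h : Represents cf q s) : (fun i => (cf.tapes i).head) = fun _ => none :=
  funext fun r => (h.tapes r).head

variable {O : Set Word}

theorem Represents.step_goto {cf : (machine start prog).Config} {q q' : Q} {s : Store}
    (h : Represents cf q s) (hp : prog q (fun _ => none) = goto (fun _ => none) q') :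
    Represents ((machine start prog).step O cf) q' s := by
  have hi : (machine start prog).instr cf = goto (fun _ => none) q' := by
    rw [OTM.instr, h.heads, h.state]; exact hp
  unfold OTM.step
  rw [hi]
  refine ⟨rfl, fun r => ?_, by simp [goto, h.oracleTape], by simp [goto, h.output]⟩
  have := (h.tapes r).head
  simp only [goto, Tape.move_stay]
  rw [← this, Tape.write_head]
  exact h.tapes r

/-- The two machine steps that pop the register `r`. -/
theorem Represents.step_pop {cf : (machine start prog).Config} {q q₁ : Q}
    {q₂ : Option Bool → Q} {s : Store} {r : Reg} (h : Represents cf q s)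
    (hp : ∀ f, prog q f = back f r q₁)
    (hp₁ : ∀ f, prog q₁ f = erase f r (q₂ (f r))) :
    Represents (((machine start prog).step O)^[2] cf) (q₂ (s.reg r).head?)
      (s.set r (s.reg r).tail) := by
  obtain ⟨T, hT, hh, hs⟩ := (h.tapes r).back
  have hi : (machine start prog).instr cf = back (fun i => (cf.tapes i).head) r q₁ := by
    rw [OTM.instr, h.state]; exact hp _
  have h1 : (machine start prog).step O cf = { cf with
      state := q₁, tapes := fun i => if i = r then T else cf.tapes i } := by
    unfold OTM.step
    rw [hi]
    simp only [back, Option.toList_none, List.append_nil, Tape.write_head]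
    congr 1
    funext i
    split_ifs with hir
    · subst hir; exact hT
    · simp
  have hi2 : (machine start prog).instr ((machine start prog).step O cf) =
      erase (fun i => (if i = r then T else cf.tapes i).head) r (q₂ (s.reg r).head?) := by
    rw [h1, OTM.instr]
    refine (hp₁ _).trans ?_
    simp [hh]
  rw [Function.iterate_succ_apply, Function.iterate_one, OTM.step, hi2, h1]
  refine ⟨rfl, fun i => ?_, by simp [erase, h.oracleTape],
    by simp [erase, h.output]⟩
  simp only [erase, Tape.move_stay, Store.reg_set]
  by_cases hir : i = r
  · subst hir; simpa using hs
  · simpa [hir] using h.tapes i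

/-- Compiled programs do what the semantics of the stack language says. -/
theorem exec_iterate {c : Cmd} {s s' : Store} {t : ℕ} (hx : Exec O c s s' t) :
    ∀ (emb : c.Loc → Q) (ex : Q), (∀ l h, prog (emb l) h = c.code emb ex l h) →
      ∀ cf : (machine start prog).Config, Represents cf (emb c.entry) s →
        Represents (((machine start prog).step O)^[t] cf) ex s' := by
  induction hx with
  | skip s =>
    intro emb ex hc cf h
    exact h.step_goto (by rw [hc]; rfl)
  | push r b s =>
    intro emb ex hc cf h
    have hi : (machine start prog).instr cf = code (.push r b) emb ex () (fun _ => none) := by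
      rw [OTM.instr, h.heads, h.state]; exact hc _ _
    rw [Function.iterate_one, OTM.step, hi]
    refine ⟨rfl, fun i => ?_, by simp [code, h.oracleTape],
      by simp [code, h.output]⟩
    simp only [code, Store.reg_set]
    by_cases hir : i = r
    · subst hir; simpa using (h.tapes i).push b
    · have := (h.tapes i).head
      simp only [ne_eq, hir, not_false_eq_true, Function.update_of_ne, if_false, Tape.move_stay]
      rw [← this, Tape.write_head]
      exact h.tapes i
  | ask b s =>
    intro emb ex hc cf h
    have hi : (machine start prog).instr cf = code (.ask b) emb ex () (fun _ => none) := by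
      rw [OTM.instr, h.heads, h.state]; exact hc _ _
    rw [Function.iterate_one, OTM.step, hi]
    refine ⟨rfl, fun i => ?_, by simp [code, h.oracleTape], by simp [code, h.output]⟩
    have := (h.tapes i).head
    simp only [code, Tape.move_stay]
    rw [← this, Tape.write_head]
    exact h.tapes i
  | out b s =>
    intro emb ex hc cf h
    have hi : (machine start prog).instr cf = code (.out b) emb ex () (fun _ => none) := by
      rw [OTM.instr, h.heads, h.state]; exact hc _ _
    rw [Function.iterate_one, OTM.step, hi]
    refine ⟨rfl, fun i => ?_, by simp [code, h.oracleTape], by simp [code, h.output]⟩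
    have := (h.tapes i).head
    simp only [code, Tape.move_stay]
    rw [← this, Tape.write_head]
    exact h.tapes i
  | @query_yes c d s s' t hO _ ih =>
    intro emb ex hc cf h
    have hi : (machine start prog).instr cf =
        .query (emb (.inr (.inl c.entry))) (emb (.inr (.inr d.entry))) := by
      rw [OTM.instr, h.state]; exact hc _ _
    rw [Function.iterate_add_apply, ← Function.iterate_add_apply, Nat.add_comm,
      Function.iterate_add_apply, Function.iterate_one]
    refine ih (fun l => emb (.inr (.inl l))) ex (fun l h => hc _ _) _ ?_
    rw [OTM.step, hi]
    refine ⟨?_, h.tapes, rfl, h.output⟩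
    rw [← h.oracleTape] at hO
    simp [hO]
  | @query_no c d s s' t hO _ ih =>
    intro emb ex hc cf h
    have hi : (machine start prog).instr cf =
        .query (emb (.inr (.inl c.entry))) (emb (.inr (.inr d.entry))) := by
      rw [OTM.instr, h.state]; exact hc _ _
    rw [Nat.add_comm, Function.iterate_add_apply, Function.iterate_one]
    refine ih (fun l => emb (.inr (.inr l))) ex (fun l h => hc _ _) _ ?_
    rw [OTM.step, hi]
    refine ⟨?_, h.tapes, rfl, h.output⟩
    rw [← h.oracleTape] at hO
    simp [hO]
  | @pop_nil r e c d s s' t hr _ ih =>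
    intro emb ex hc cf h
    rw [Nat.add_comm, Function.iterate_add_apply]
    refine ih (fun l => emb (.inr (.inl l))) ex (fun l h => hc _ _) _ ?_
    have := h.step_pop (O := O) (r := r) (fun f => hc (.inl false) f)
      (q₂ := select (emb (.inr (.inl e.entry))) (emb (.inr (.inr (.inl c.entry))))
        (emb (.inr (.inr (.inr d.entry))))) (fun f => hc (.inl true) f)
    rw [hr] at this
    have hs : s.set r [] = s := by rw [← hr]; simp
    rw [List.tail_nil, hs] at this
    exact this
  | @pop_false r e c d s s' t w hr _ ih =>
    intro emb ex hc cf h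
    rw [Nat.add_comm, Function.iterate_add_apply]
    refine ih (fun l => emb (.inr (.inr (.inl l)))) ex (fun l h => hc _ _) _ ?_
    have := h.step_pop (O := O) (r := r) (fun f => hc (.inl false) f)
      (q₂ := select (emb (.inr (.inl e.entry))) (emb (.inr (.inr (.inl c.entry))))
        (emb (.inr (.inr (.inr d.entry))))) (fun f => hc (.inl true) f)
    rw [hr] at this
    exact this
  | @pop_true r e c d s s' t w hr _ ih =>
    intro emb ex hc cf h
    rw [Nat.add_comm, Function.iterate_add_apply]
    refine ih (fun l => emb (.inr (.inr (.inr l)))) ex (fun l h => hc _ _) _ ?_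
    have := h.step_pop (O := O) (r := r) (fun f => hc (.inl false) f)
      (q₂ := select (emb (.inr (.inl e.entry))) (emb (.inr (.inr (.inl c.entry))))
        (emb (.inr (.inr (.inr d.entry))))) (fun f => hc (.inl true) f)
    rw [hr] at this
    exact this
  | seq _ _ ih₁ ih₂ =>
    intro emb ex hc cf h
    rw [Nat.add_comm, Function.iterate_add_apply]
    refine ih₂ (fun l => emb (.inr l)) ex (fun l h => hc _ _) _ ?_
    exact ih₁ (fun l => emb (.inl l)) _ (fun l h => hc _ _) _ h
  | @loop_nil r c d s hr =>
    intro emb ex hc cf h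
    have := h.step_pop (O := O) (r := r) (fun f => hc (.inl false) f)
      (q₂ := select ex (emb (.inr (.inl c.entry))) (emb (.inr (.inr d.entry)))) (fun f => hc (.inl true) f)
    rw [hr] at this
    have hs : s.set r [] = s := by rw [← hr]; simp
    rw [List.tail_nil, hs] at this
    exact this
  | @loop_false r c d s s' s'' t t' w hr _ _ ih₁ ih₂ =>
    intro emb ex hc cf h
    rw [Nat.add_comm, Function.iterate_add_apply]
    refine ih₂ emb ex hc _ ?_
    rw [Nat.add_comm, Function.iterate_add_apply]
    refine ih₁ (fun l => emb (.inr (.inl l))) _ (fun l h => hc _ _) _ ?_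
    have := h.step_pop (O := O) (r := r) (fun f => hc (.inl false) f)
      (q₂ := select ex (emb (.inr (.inl c.entry))) (emb (.inr (.inr d.entry)))) (fun f => hc (.inl true) f)
    rw [hr] at this
    exact this
  | @loop_true r c d s s' s'' t t' w hr _ _ ih₁ ih₂ =>
    intro emb ex hc cf h
    rw [Nat.add_comm, Function.iterate_add_apply]
    refine ih₂ emb ex hc _ ?_
    rw [Nat.add_comm, Function.iterate_add_apply]
    refine ih₁ (fun l => emb (.inr (.inr l))) _ (fun l h => hc _ _) _ ?_
    have := h.step_pop (O := O) (r := r) (fun f => hc (.inl false) f)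
      (q₂ := select ex (emb (.inr (.inl c.entry))) (emb (.inr (.inr d.entry)))) (fun f => hc (.inl true) f)
    rw [hr] at this
    exact this

end Cmd

/-! ### Stack programs as transducers and deciders -/

namespace OTM

theorem step_of_verdict {M : OTM} {O : Set Word} {c : M.Config} (h : (M.verdict c).isSome) :
    M.step O c = c := by
  unfold verdict at h
  unfold step
  split at h
  · rename_i a ha; rw [ha]
  · simp at h

theorem run_succ (M : OTM) (O : Set Word) (x : Word) (n : ℕ) :
    M.run O x (n + 1) = M.step O (M.run O x n) :=
  Function.iterate_succ_apply' _ _ _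

theorem run_of_verdict {M : OTM} {O : Set Word} {x : Word} {n m : ℕ}
    (h : (M.verdict (M.run O x n)).isSome) (hnm : n ≤ m) : M.run O x m = M.run O x n := by
  induction m, hnm using Nat.le_induction with
  | base => rfl
  | succ m _ ih => rw [run_succ, ih, step_of_verdict h]

theorem run_eq_of_verdict {M : OTM} {O : Set Word} {x : Word} {n m : ℕ}
    (h : (M.verdict (M.run O x n)).isSome) (h' : (M.verdict (M.run O x m)).isSome) :
    M.run O x m = M.run O x n := by
  rcases le_total n m with hnm | hnm
  · exact run_of_verdict h hnm
  · exact (run_of_verdict h' hnm).symm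

theorem OutputsWithin.mono {M : OTM} {O : Set Word} {x y : Word} {n m : ℕ}
    (h : M.OutputsWithin O x n y) (hnm : n ≤ m) : M.OutputsWithin O x m y := by
  unfold OutputsWithin at *
  rwa [run_of_verdict h.1 hnm]

theorem DecidesWithin.mono {M : OTM} {O L : Set Word} {x : Word} {n m : ℕ}
    (h : M.DecidesWithin O L x n) (hnm : n ≤ m) : M.DecidesWithin O L x m := by
  have hs : (M.verdict (M.run O x n)).isSome := by
    rcases h with ⟨-, h⟩ | ⟨-, h⟩ <;> simp [h]
  unfold DecidesWithin at *
  rwa [run_of_verdict hs hnm]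

end OTM

namespace Cmd

/-- The states of the machine that executes a program: `scan` moves the head behind the input,
`body` executes the program, `back` and `halt` test whether the register `res` is empty. -/
inductive Ctrl (c : Cmd) : Type
  | scan
  | body (l : c.Loc)
  | back
  | halt

instance (c : Cmd) : Fintype c.Ctrl :=
  Fintype.ofEquiv (Option (c.Loc ⊕ Bool))
    { toFun := fun
        | none => .scan
        | some (.inl l) => .body l
        | some (.inr false) => .back
        | some (.inr true) => .halt
      invFun := fun
        | .scan => none
        | .body l => some (.inl l)
        | .back => some (.inr false)
        | .halt => some (.inr true)
      left_inv := by rintro (_ | l | _ | _) <;> rfl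
      right_inv := by rintro (_ | _ | _ | _) <;> rfl }

/-- The program of the machine that executes `c`. -/
def ctrlProgram (c : Cmd) : c.Ctrl → (Reg → Option Bool) → Instr c.Ctrl Reg
  | .scan, h =>
      if (h .inp).isSome then .act .scan h (fun i => if i = .inp then .right else .stay) none none
      else goto h (.body c.entry)
  | .body l, h => c.code .body .back l h
  | .back, h => Cmd.back h .res .halt
  | .halt, h => .halt (h .res).isSome

/-- The machine that executes `c` and accepts if the register `res` is nonempty at the end. -/
abbrev toOTM (c : Cmd) : OTM := machine (Ctrl.scan (c := c)) c.ctrlProgram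

/-- The input is scanned letter by letter; `l` is the reversed part already scanned, which lies on the
tape of `inp` as a stack, and `b :: r` is the part `x` ahead. -/
theorem scan_iterate (c : Cmd) (O : Set Word) (x l : Word) (r : List (Option Bool))
    (b : Option Bool)
    (hx : (b :: r) = x.map some ∨ (b = none ∧ r = [] ∧ x = []))
    (cf : c.toOTM.Config) (hs : cf.state = .scan)
    (ht : cf.tapes = fun i => if i = .inp then ⟨l.map some, b, r⟩ else Tape.ofWord [])
    (ho : cf.oracleTape = []) (hout : cf.output = []) :
    Represents ((c.toOTM.step O)^[x.length + 1] cf) (.body c.entry)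
      { inp := x.reverse ++ l } := by
  induction x generalizing l r b cf with
  | nil =>
    obtain ⟨rfl, rfl⟩ : b = none ∧ r = [] := by simpa using hx
    have hR : Represents cf .scan { inp := l } := by
      refine ⟨hs, fun i => ?_, ho, hout⟩
      rw [ht]
      cases i
      case inp => exact ⟨0, 0, by simp [Store.reg]⟩
      all_goals exact Tape.isStack_nil_ofWord
    exact hR.step_goto (by simp [ctrlProgram])
  | cons a x ih =>
    obtain ⟨rfl, rfl⟩ : b = some a ∧ r = x.map some := by simpa using hx
    have hi : c.toOTM.instr cf = .act .scan (fun i => (cf.tapes i).head)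
        (fun i => if i = .inp then .right else .stay) none none := by
      rw [OTM.instr, hs]
      simp [ctrlProgram, ht]
    rw [List.length_cons, Function.iterate_succ_apply]
    have h1 : c.toOTM.step O cf = ⟨.scan,
        fun i => if i = .inp then Tape.move ⟨l.map some, some a, x.map some⟩ .right
          else Tape.ofWord [], [], []⟩ := by
      unfold OTM.step
      rw [hi]
      simp only [Option.toList_none, List.append_nil, Tape.write_head, ho, hout]
      congr 1
      funext i
      rw [ht]
      by_cases hi : i = .inp <;> simp [hi]
    rw [h1]
    have := ih (a :: l) (x.map some).tail (x.map some).head?.join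
      (by cases x <;> simp) (c.toOTM.step O cf) (by rw [h1])
      (by
        rw [h1]
        funext i
        by_cases hi : i = .inp <;> cases x <;> simp [hi, Tape.move]) (by rw [h1]) (by rw [h1])
    rw [h1] at this
    simpa using this

theorem represents_run_scan (c : Cmd) (O : Set Word) (x : Word) :
    Represents (c.toOTM.run O x (x.length + 1)) (.body c.entry) { inp := x.reverse } := by
  have := scan_iterate c O x [] (x.map some).tail (x.map some).head?.join
      (by cases x <;> simp) (c.toOTM.init x) rfl
      (by funext i; cases x <;> rfl) rfl rfl
  rw [List.append_nil] at this
  exact this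

/-- The computation of the machine that executes a program. -/
theorem run_toOTM {c : Cmd} {O : Set Word} {x : Word} {s : Store} {t : ℕ}
    (h : Exec O c { inp := x.reverse } s t) :
    c.toOTM.verdict (c.toOTM.run O x (x.length + t + 2)) = some !s.res.isEmpty ∧
      (c.toOTM.run O x (x.length + t + 2)).output = s.output := by
  have h1 := exec_iterate (prog := c.ctrlProgram) (start := .scan) h .body .back
    (fun l h => rfl) _ (represents_run_scan c O x)
  rw [OTM.run, ← Function.iterate_add_apply] at h1
  have e : x.length + t + 2 = (t + (x.length + 1)) + 1 := by ring
  rw [e, OTM.run_succ]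
  set cf := c.toOTM.run O x (t + (x.length + 1)) with hcf
  change Represents cf _ _ at h1
  have hi : c.toOTM.instr cf = Cmd.back (fun i => (cf.tapes i).head) .res .halt := by
    rw [OTM.instr, h1.state]; rfl
  obtain ⟨T, hT, hh, -⟩ := (h1.tapes .res).back
  have h2 : c.toOTM.step O cf = { cf with
      state := .halt, tapes := fun i => if i = .res then T else cf.tapes i } := by
    unfold OTM.step
    rw [hi]
    simp only [Cmd.back, Option.toList_none, List.append_nil, Tape.write_head]
    congr 1
    funext i
    split_ifs with hir
    · subst hir; exact hT
    · simp
  rw [h2]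
  refine ⟨?_, h1.output⟩
  have : c.toOTM.instr { cf with
      state := .halt, tapes := fun i => if i = .res then T else cf.tapes i } =
      .halt (T.head).isSome := rfl
  rw [OTM.verdict, this, hh]
  simp only [Store.reg]
  cases s.res <;> rfl

end Cmd

/-- A function bounded by a polynomial. -/
def PolyBounded (f : ℕ → ℕ) : Prop := ∃ p : Polynomial ℕ, ∀ n, f n ≤ p.eval n

namespace PolyBounded

theorem eval (p : Polynomial ℕ) : PolyBounded fun n => p.eval n := ⟨p, fun _ => le_rfl⟩

theorem const (k : ℕ) : PolyBounded fun _ => k := ⟨Polynomial.C k, fun n => by simp⟩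

theorem id : PolyBounded fun n => n := ⟨Polynomial.X, fun n => by simp⟩

theorem add {f g : ℕ → ℕ} (hf : PolyBounded f) (hg : PolyBounded g) :
    PolyBounded fun n => f n + g n := by
  obtain ⟨p, hp⟩ := hf
  obtain ⟨q, hq⟩ := hg
  exact ⟨p + q, fun n => by simpa using Nat.add_le_add (hp n) (hq n)⟩

theorem mul {f g : ℕ → ℕ} (hf : PolyBounded f) (hg : PolyBounded g) :
    PolyBounded fun n => f n * g n := by
  obtain ⟨p, hp⟩ := hf
  obtain ⟨q, hq⟩ := hg
  exact ⟨p * q, fun n => by simpa using Nat.mul_le_mul (hp n) (hq n)⟩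

theorem pow {f : ℕ → ℕ} (hf : PolyBounded f) (k : ℕ) : PolyBounded fun n => f n ^ k := by
  obtain ⟨p, hp⟩ := hf
  exact ⟨p ^ k, fun n => by simpa using Nat.pow_le_pow_left (hp n) k⟩

theorem le_pow {f : ℕ → ℕ} (hf : PolyBounded f) : ∃ C, ∀ n, f n ≤ (n + C) ^ C := by
  obtain ⟨p, hp⟩ := hf
  suffices ∃ C, ∀ n, p.eval n ≤ (n + C) ^ C from this.imp fun C h n => (hp n).trans (h n)
  clear hp
  induction p using Polynomial.induction_on' with
  | add p q hp hq =>
    obtain ⟨C, hC⟩ := hp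
    obtain ⟨D, hD⟩ := hq
    refine ⟨C + D + 2, fun n => ?_⟩
    rw [Polynomial.eval_add]
    calc _ ≤ (n + C) ^ C + (n + D) ^ D := Nat.add_le_add (hC n) (hD n)
      _ ≤ (n + (C + D + 2)) ^ (C + D + 1) + (n + (C + D + 2)) ^ (C + D + 1) := by
          gcongr
          all_goals omega
      _ ≤ (n + (C + D + 2)) ^ (C + D + 1) * (n + (C + D + 2)) := by
          nlinarith [Nat.zero_le ((n + (C + D + 2)) ^ (C + D + 1) * (n + (C + D)))]
      _ = _ := (pow_succ _ _).symm
  | monomial k a =>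
    refine ⟨k + a + 1, fun n => ?_⟩
    rw [Polynomial.eval_monomial]
    calc a * n ^ k ≤ (n + (k + a + 1)) * (n + (k + a + 1)) ^ (k + a) := by
          gcongr
          all_goals omega
      _ = _ := (pow_succ' _ _).symm

end PolyBounded

/-- `Run O c s s' T`: the program `c` leads from `s` to `s'` in at most `T` steps. -/
def Run (O : Set Word) (c : Cmd) (s s' : Store) (T : ℕ) : Prop := ∃ t ≤ T, Exec O c s s' t

theorem InFP.of_run {O : Set Word} {f : Word → Word} (c : Cmd) (T : ℕ → ℕ) (hT : PolyBounded T)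
    (h : ∀ x : Word, ∃ s, s.output = f x ∧ Run O c { inp := x.reverse } s (T x.length)) :
    InFP O f := by
  obtain ⟨p, hp⟩ := (PolyBounded.id.add hT).add (PolyBounded.const 2)
  refine ⟨c.toOTM, p, fun x => ?_⟩
  obtain ⟨s, hs, t, ht, hx⟩ := h x
  obtain ⟨h1, h2⟩ := Cmd.run_toOTM hx
  have : c.toOTM.OutputsWithin O x (x.length + t + 2) (f x) := ⟨by rw [h1]; rfl, h2.trans hs⟩
  exact this.mono ((by omega : _ ≤ x.length + T x.length + 2).trans (hp _))

theorem DecidableIn.of_run {O L : Set Word} (c : Cmd)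
    (h : ∀ x : Word, ∃ s T, (s.res ≠ [] ↔ x ∈ L) ∧ Run O c { inp := x.reverse } s T) :
    DecidableIn O L := by
  refine ⟨c.toOTM, fun x => ?_⟩
  obtain ⟨s, T, hs, t, -, hx⟩ := h x
  obtain ⟨h1, -⟩ := Cmd.run_toOTM hx
  refine ⟨x.length + t + 2, ?_⟩
  rw [OTM.DecidesWithin, h1, ← hs]
  cases s.res <;> simp

/-! ### Basic stack programs -/

namespace Store

theorem set_set (s : Store) (r : Reg) (w w' : Word) : (s.set r w).set r w' = s.set r w' := by
  cases r <;> rfl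

theorem set_comm (s : Store) {r r' : Reg} (h : r ≠ r') (w w' : Word) :
    (s.set r w).set r' w' = (s.set r' w').set r w := by
  cases r <;> cases r' <;> first | rfl | exact absurd rfl h

theorem reg_set_of_ne (s : Store) {r r' : Reg} (h : r' ≠ r) (w : Word) :
    (s.set r w).reg r' = s.reg r' := by
  rw [reg_set, Function.update_of_ne h]

end Store

/-- The word `0ⁿ`. -/
abbrev zeros (n : ℕ) : Word := List.replicate n false

theorem zeros_append (m n : ℕ) : zeros m ++ zeros n = zeros (m + n) :=
  List.replicate_append_replicate

/-- The tally set of the words `0ⁿ` with `o n`. -/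
def tally (o : ℕ → Prop) : Set Word := {w | ∃ n, w = zeros n ∧ o n}

theorem zeros_mem_tally {o : ℕ → Prop} {n : ℕ} : zeros n ∈ tally o ↔ o n := by
  constructor
  · rintro ⟨m, hm, h⟩
    have : n = m := by simpa using congrArg List.length hm
    rwa [this]
  · exact fun h => ⟨n, rfl, h⟩

theorem reverse_mem_tally {o : ℕ → Prop} {w : Word} : w.reverse ∈ tally o ↔ w ∈ tally o := by
  constructor
  · rintro ⟨m, hm, h⟩
    exact ⟨m, by rw [← List.reverse_reverse w, hm]; simp, h⟩
  · rintro ⟨m, rfl, h⟩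
    exact ⟨m, by simp, h⟩

/-- Sequential composition. -/
infixr:60 " ;; " => Cmd.seq

namespace Run

variable {O : Set Word} {c d e : Cmd} {s s' s'' : Store} {T T' : ℕ} {r : Reg}

theorem mono (h : Run O c s s' T) (hT : T ≤ T') : Run O c s s' T' :=
  let ⟨t, ht, hx⟩ := h
  ⟨t, ht.trans hT, hx⟩

theorem seq (h : Run O c s s' T) (h' : Run O d s' s'' T') : Run O (c ;; d) s s'' (T + T') :=
  let ⟨_, ht, hx⟩ := h
  let ⟨_, ht', hx'⟩ := h'
  ⟨_, Nat.add_le_add ht ht', hx.seq hx'⟩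

theorem skip : Run O .skip s s 1 := ⟨1, le_rfl, .skip s⟩

theorem push (b : Bool) : Run O (.push r b) s (s.set r (b :: s.reg r)) 1 := ⟨1, le_rfl, .push r b s⟩

theorem ask (b : Bool) : Run O (.ask b) s { s with oracleTape := s.oracleTape ++ [b] } 1 :=
  ⟨1, le_rfl, .ask b s⟩

theorem out (b : Bool) : Run O (.out b) s { s with output := s.output ++ [b] } 1 :=
  ⟨1, le_rfl, .out b s⟩

theorem query_yes (hO : s.oracleTape ∈ O) (h : Run O c { s with oracleTape := [] } s' T) :
    Run O (.query c d) s s' (T + 1) :=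
  let ⟨t, ht, hx⟩ := h
  ⟨1 + t, by omega, .query_yes hO hx⟩

theorem query_no (hO : s.oracleTape ∉ O) (h : Run O d { s with oracleTape := [] } s' T) :
    Run O (.query c d) s s' (T + 1) :=
  let ⟨t, ht, hx⟩ := h
  ⟨1 + t, by omega, .query_no hO hx⟩

theorem pop_nil (hs : s.reg r = []) (h : Run O e s s' T) :
    Run O (.pop r e c d) s s' (T + 2) :=
  let ⟨t, ht, hx⟩ := h
  ⟨2 + t, by omega, .pop_nil hs hx⟩

theorem pop_cons {b : Bool} {w : Word} (hs : s.reg r = b :: w)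
    (h : Run O (bif b then d else c) (s.set r w) s' T) : Run O (.pop r e c d) s s' (T + 2) := by
  obtain ⟨t, ht, hx⟩ := h
  cases b
  · exact ⟨2 + t, by omega, .pop_false hs hx⟩
  · exact ⟨2 + t, by omega, .pop_true hs hx⟩

/-- A loop whose successive states are given by a sequence. -/
theorem loop (f : ℕ → Store) (n : ℕ)
    (h : ∀ k < n, ∃ b w, (f k).reg r = b :: w ∧
      Run O (bif b then d else c) ((f k).set r w) (f (k + 1)) T)
    (hn : (f n).reg r = []) : Run O (.loop r c d) (f 0) (f n) (n * (T + 2) + 2) := by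
  induction n generalizing f with
  | zero => exact ⟨2, by omega, .loop_nil hn⟩
  | succ n ih =>
    obtain ⟨b, w, hb, t, ht, hx⟩ := h 0 n.succ_pos
    obtain ⟨t', ht', hx'⟩ := ih (fun k => f (k + 1)) (fun k hk => h (k + 1) (by omega)) hn
    refine ⟨2 + t + t', by rw [Nat.succ_mul]; omega, ?_⟩
    cases b
    · exact .loop_false hb hx hx'
    · exact .loop_true hb hx hx'

end Run

namespace Cmd

/-- Repeat a program a constant number of times. -/
def rep : ℕ → Cmd → Cmd
  | 0, _ => skip
  | k + 1, c => c ;; rep k c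

/-- Empty a register. -/
def clear (r : Reg) : Cmd := loop r skip skip

/-- Move the contents of a register onto another one, in reversed order. -/
def move (r r' : Reg) : Cmd := loop r (push r' false) (push r' true)

/-- Run `c` once for each zero of the register `r`, and keep the register. -/
def each (r : Reg) (c : Cmd) : Cmd :=
  loop r (push .q false ;; c) (push .q false ;; c) ;; move .q r

/-- Write the word onto the output tape. -/
def print : Word → Cmd
  | [] => skip
  | b :: w => out b ;; print w

end Cmd

namespace Run

variable {O : Set Word} {c : Cmd} {s : Store} {T : ℕ} {r r' : Reg}

theorem rep (f : ℕ → Store) (n : ℕ) (h : ∀ k < n, Run O c (f k) (f (k + 1)) T) :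
    Run O (c.rep n) (f 0) (f n) (n * T + 1) := by
  induction n generalizing f with
  | zero => exact skip.mono (by omega)
  | succ n ih =>
    exact ((h 0 n.succ_pos).seq (ih (fun k => f (k + 1)) fun k hk => h (k + 1) (by omega))).mono
      (by rw [Nat.succ_mul]; omega)

theorem clear : Run O (.clear r) s (s.set r []) ((s.reg r).length * 3 + 2) := by
  have := loop (O := O) (r := r) (c := .skip) (d := .skip) (T := 1)
    (fun k => s.set r ((s.reg r).drop k)) (s.reg r).length
    (fun k hk => ⟨(s.reg r)[k], (s.reg r).drop (k + 1), by simp,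
      by rw [Store.set_set, Bool.cond_self]; exact skip⟩) (by simp)
  simpa [Cmd.clear] using this

theorem move (h : r ≠ r') :
    Run O (.move r r') s ((s.set r []).set r' ((s.reg r).reverse ++ s.reg r'))
      ((s.reg r).length * 3 + 2) := by
  have := loop (O := O) (r := r) (c := .push r' false) (d := .push r' true) (T := 1)
    (fun k => (s.set r ((s.reg r).drop k)).set r' (((s.reg r).take k).reverse ++ s.reg r'))
    (s.reg r).length
    (fun k hk => ⟨(s.reg r)[k], (s.reg r).drop (k + 1), by
      rw [Store.reg_set_of_ne _ h]; simp, by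
      have e : ∀ b : Bool, (bif b then Cmd.push r' true else Cmd.push r' false) = .push r' b := by
        rintro (_ | _) <;> rfl
      rw [e, Store.set_comm _ h, Store.set_comm _ h, Store.set_set]
      have := push (O := O) (r := r') (s := (s.set r' (((s.reg r).take k).reverse ++ s.reg r')).set r
        ((s.reg r).drop (k + 1))) (s.reg r)[k]
      rw [Store.reg_set_of_ne _ h.symm, Store.reg_set_self, Store.set_comm _ h, Store.set_set] at this
      rw [Store.set_comm _ h.symm]
      have e' : (s.reg r).take (k + 1) = (s.reg r).take k ++ [(s.reg r)[k]] := by simp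
      rw [e', List.reverse_append]
      simpa [Store.set_comm _ h] using this⟩)
    (by rw [Store.reg_set_of_ne _ h]; simp)
  simpa [Cmd.move] using this

theorem pushes (n : ℕ) :
    Run O ((Cmd.push r false).rep n) s (s.set r (zeros n ++ s.reg r)) (n + 1) := by
  have := rep (O := O) (c := .push r false) (T := 1) (fun k => s.set r (zeros k ++ s.reg r)) n
    (fun k _ => by
      have := push (O := O) (r := r) (s := s.set r (zeros k ++ s.reg r)) false
      rwa [Store.set_set, Store.reg_set_self] at this)
  simpa using this

theorem asks (n : ℕ) :
    Run O ((Cmd.ask false).rep n) s { s with oracleTape := s.oracleTape ++ zeros n } (n + 1) := by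
  have := rep (O := O) (c := .ask false) (T := 1)
    (fun k => { s with oracleTape := s.oracleTape ++ zeros k }) n
    (fun k _ => by
      have := ask (O := O) (s := { s with oracleTape := s.oracleTape ++ zeros k }) false
      simpa [List.replicate_succ'] using this)
  simpa using this

theorem outs (n : ℕ) :
    Run O ((Cmd.out false).rep n) s { s with output := s.output ++ zeros n } (n + 1) := by
  have := rep (O := O) (c := .out false) (T := 1)
    (fun k => { s with output := s.output ++ zeros k }) n
    (fun k _ => by
      have := out (O := O) (s := { s with output := s.output ++ zeros k }) false
      simpa [List.replicate_succ'] using this)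
  simpa using this

theorem print (w : Word) :
    Run O (.print w) s { s with output := s.output ++ w } (w.length + 1) := by
  induction w generalizing s with
  | nil => simpa using! skip
  | cons b w ih =>
    have := (out (O := O) (s := s) b).seq (ih (s := { s with output := s.output ++ [b] }))
    rw [List.append_assoc] at this
    exact this.mono (by simp; omega)

/-- The successive states of `each` are given by a sequence `f` of states that agree on the
counter `r` and have an empty auxiliary register. -/
theorem each (f : ℕ → Store) (n : ℕ) (hr : r ≠ .q) (hf : ∀ k, (f k).reg r = zeros n)
    (hq : ∀ k, (f k).reg .q = [])
    (h : ∀ k < n, ∀ a b, Run O c (((f k).set r a).set .q b) (((f (k + 1)).set r a).set .q b) T) :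
    Run O (c.each r) (f 0) (f n) (n * (T + 6) + 4) := by
  have h1 := loop (O := O) (r := r) (c := .push .q false ;; c) (d := .push .q false ;; c) (T := T + 1)
    (fun k => ((f k).set r (zeros (n - k))).set .q (zeros k)) n
    (fun k hk => ⟨false, zeros (n - (k + 1)), by
      rw [Store.reg_set_of_ne _ hr, Store.reg_set_self, ← List.replicate_succ]
      congr 1; omega, by
      have h2 := push (O := O) (r := .q)
        (s := ((((f k).set r (zeros (n - k))).set .q (zeros k)).set r (zeros (n - (k + 1))))) false
      rw [Store.reg_set_of_ne _ hr.symm, Store.reg_set_self, ← List.replicate_succ,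
        Store.set_comm _ hr.symm, Store.set_set, Store.set_set] at h2
      rw [Store.set_comm _ hr.symm, Store.set_set]
      exact (h2.seq (h k hk _ _)).mono (by omega)⟩)
    (by rw [Store.reg_set_of_ne _ hr]; simp)
  have h3 := move (O := O) (r := .q) (r' := r) hr.symm
    (s := (((f n).set r (zeros (n - n))).set .q (zeros n)))
  rw [Store.reg_set_of_ne _ hr, Store.reg_set_self, Store.reg_set_self, Store.set_set,
    Store.set_comm _ hr.symm, Store.set_set] at h3
  have e0 : ((f 0).set r (zeros (n - 0))).set .q (zeros 0) = f 0 := by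
    rw [Nat.sub_zero, ← hf 0, Store.set_reg_self, show zeros 0 = [] from rfl, ← hq 0,
      Store.set_reg_self]
  have e1 : ((f n).set r ((zeros n).reverse ++ zeros (n - n))).set .q [] = f n := by
    rw [Nat.sub_self, List.reverse_replicate, show zeros 0 = [] from rfl, List.append_nil,
      show List.replicate n false = (f n).reg r from (hf n).symm, Store.set_reg_self, ← hq n, Store.set_reg_self]
  rw [e1] at h3
  rw [e0] at h1
  exact (h1.seq h3).mono (by rw [List.length_replicate]; nlinarith)

end Run

/-! ### Oracle look-up of functions -/

/-- The length of the query with number `i < 16` about the pair `(z, y)`. It determines `i`, `z` and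
`y`, and it is polynomial in them, so that the query can be written in polynomial time. -/
def pos (i z y : ℕ) : ℕ := 16 * ((z + y) * (z + y) + z) + i

theorem pos_inj {i z y i' z' y' : ℕ} (hi : i < 16) (hi' : i' < 16)
    (h : pos i z y = pos i' z' y') : i = i' ∧ z = z' ∧ y = y' := by
  unfold pos at h
  have h1 : i = i' := by omega
  have h2 : (z + y) * (z + y) + z = (z' + y') * (z' + y') + z' := by omega
  have h3 : z + y = z' + y' := by
    by_contra hne
    rcases Nat.lt_or_gt_of_ne hne with hlt | hlt <;> nlinarith
  rw [h3] at h2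
  omega

theorem left_lt_pos {i : ℕ} (hi : 0 < i) (z y : ℕ) : z < pos i z y := by unfold pos; omega

theorem right_le_pos (i z y : ℕ) : y ≤ pos i z y := by unfold pos; nlinarith

namespace Cmd

/-- Append the query `pos i z y` to the oracle tape, for the numbers in the registers `z` and
`y`. -/
def askPos (i : ℕ) : Cmd :=
  each .z ((ask false).rep 16) ;; each .z (push .p false) ;; each .y (push .p false) ;;
  loop .p (each .z ((ask false).rep 16) ;; each .y ((ask false).rep 16)) skip ;; (ask false).rep i

/-- Branch according to the answer to the query `pos i z y`. -/
def test (i : ℕ) (c d : Cmd) : Cmd := askPos i ;; query c d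

/-- Compute the value at the register `z` of a function whose subgraph is given by the queries
with number `i`. -/
def eval (i : ℕ) : Cmd :=
  push .g false ;; loop .g (test i (push .y false ;; push .g false) skip) skip

end Cmd

namespace Run

variable {O : Set Word} {c d : Cmd} {s s' : Store} {T : ℕ}

theorem each_ask (r : Reg) (hr : r ≠ .q) {a : ℕ} (k : ℕ) (hs : s.reg r = zeros a) (hq : s.q = []) :
    Run O (((Cmd.ask false).rep k).each r) s
      { s with oracleTape := s.oracleTape ++ zeros (a * k) } (a * (k + 7) + 4) := by
  have := each (O := O) (r := r) (c := (Cmd.ask false).rep k) (T := k + 1)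
    (fun j => { s with oracleTape := s.oracleTape ++ zeros (j * k) }) a hr
    (fun j => by rw [← hs]; cases r <;> rfl) (fun j => hq) (fun j _ v w => by
      have := asks (O := O) (s := ((({ s with oracleTape := s.oracleTape ++ zeros (j * k) } :
        Store).set r v).set .q w)) k
      rw [Store.oracleTape_set, Store.oracleTape_set, List.append_assoc, zeros_append] at this
      rw [Nat.succ_mul]
      cases r <;> exact this)
  simpa using this

theorem each_push (r : Reg) (hr : r ≠ .q) (hr' : r ≠ .p) {a : ℕ} (hs : s.reg r = zeros a)
    (hq : s.q = []) :
    Run O ((Cmd.push .p false).each r) s { s with p := zeros a ++ s.p } (a * 7 + 4) := by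
  have := each (O := O) (r := r) (c := Cmd.push .p false) (T := 1)
    (fun j => { s with p := zeros j ++ s.p }) a hr
    (fun j => by rw [← hs]; cases r <;> first | rfl | exact absurd rfl hr') (fun j => hq)
    (fun j _ v w => by
      have := push (O := O) (r := .p)
        (s := ((({ s with p := zeros j ++ s.p } : Store).set r v).set .q w)) false
      cases r <;> first | exact this | exact absurd rfl hr')
  simpa using this

theorem askPos (i : ℕ) {a b : ℕ} (hz : s.z = zeros a) (hy : s.y = zeros b) (hp : s.p = [])
    (hq : s.q = []) :
    Run O (.askPos i) s { s with oracleTape := s.oracleTape ++ zeros (pos i a b) }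
      (60 * (a + b + 1) ^ 2 + i) := by
  have h1 := each_ask (O := O) (s := s) .z (by decide) 16 hz hq
  have h2 := each_push (O := O) (s := { s with oracleTape := s.oracleTape ++ zeros (a * 16) }) .z
    (by decide) (by decide) hz hq
  have h3 := each_push (O := O)
    (s := { s with oracleTape := s.oracleTape ++ zeros (a * 16), p := zeros a ++ s.p }) .y
    (by decide) (by decide) hy hq
  have h4 := loop (O := O) (r := .p) (T := (a * 23 + 4) + (b * 23 + 4)) (d := .skip)
    (c := ((Cmd.ask false).rep 16).each .z ;; ((Cmd.ask false).rep 16).each .y)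
    (fun k => { s with
      oracleTape := s.oracleTape ++ zeros (a * 16) ++ zeros (k * ((a + b) * 16))
      p := zeros (a + b - k) }) (a + b) (fun k hk => by
    refine ⟨false, zeros (a + b - (k + 1)), ?_, ?_⟩
    · simp only [Store.reg]
      rw [← List.replicate_succ]; congr 1; omega
    · have h5 := each_ask (O := O) (s := { s with
        oracleTape := s.oracleTape ++ zeros (a * 16) ++ zeros (k * ((a + b) * 16))
        p := zeros (a + b - (k + 1)) }) .z (by decide) 16 hz hq
      have h6 := each_ask (O := O) (s := { s with
        oracleTape := s.oracleTape ++ zeros (a * 16) ++ zeros (k * ((a + b) * 16)) ++ zeros (a * 16)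
        p := zeros (a + b - (k + 1)) }) .y (by decide) 16 hy hq
      have := h5.seq h6
      simp only [List.append_assoc, zeros_append] at this
      simp only [List.append_assoc, zeros_append]
      rw [show (k + 1) * ((a + b) * 16) = k * ((a + b) * 16) + a * 16 + b * 16 by ring]
      simp only [← Nat.add_assoc] at this ⊢
      exact this) (by simp [Store.reg])
  have h7 := asks (O := O) (s := { s with
      oracleTape := s.oracleTape ++ zeros (a * 16) ++ zeros ((a + b) * ((a + b) * 16))
      p := zeros (a + b - (a + b)) }) i
  have e1 : zeros b ++ (zeros a ++ s.p) = zeros (a + b - 0) := by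
    rw [hp, List.append_nil, zeros_append, Nat.add_comm]; rfl
  rw [e1] at h3
  simp only [Nat.zero_mul, List.replicate_zero, List.append_nil] at h4
  have := h1.seq (h2.seq (h3.seq (h4.seq h7)))
  rw [Nat.sub_self, List.append_assoc, List.append_assoc, zeros_append, zeros_append,
    show a * 16 + (a + b) * ((a + b) * 16) + i = pos i a b by unfold pos; ring] at this
  have e2 : ({ s with oracleTape := s.oracleTape ++ zeros (pos i a b), p := zeros 0 } : Store) =
      { s with oracleTape := s.oracleTape ++ zeros (pos i a b) } := by
    rw [show zeros 0 = s.p from hp.symm]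
  rw [e2] at this
  exact this.mono (by nlinarith [Nat.zero_le (a * b)])

variable {o : ℕ → Prop}

theorem test_yes {i : ℕ} {a b : ℕ} (hz : s.z = zeros a) (hy : s.y = zeros b) (hp : s.p = [])
    (hq : s.q = []) (hs : s.oracleTape = []) (ho : o (pos i a b)) (h : Run (tally o) c s s' T) :
    Run (tally o) (.test i c d) s s' (60 * (a + b + 1) ^ 2 + i + 1 + T) := by
  refine ((askPos i hz hy hp hq).seq (query_yes ?_ (T := T) ?_)).mono (by omega)
  · simpa [hs] using zeros_mem_tally.2 ho
  · rw [← hs]; exact h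

theorem test_no {i : ℕ} {a b : ℕ} (hz : s.z = zeros a) (hy : s.y = zeros b) (hp : s.p = [])
    (hq : s.q = []) (hs : s.oracleTape = []) (ho : ¬ o (pos i a b))
    (h : Run (tally o) d s s' T) :
    Run (tally o) (.test i c d) s s' (60 * (a + b + 1) ^ 2 + i + 1 + T) := by
  refine ((askPos i hz hy hp hq).seq (query_no ?_ (T := T) ?_)).mono (by omega)
  · simpa [hs] using fun h => ho (zeros_mem_tally.1 h)
  · rw [← hs]; exact h

theorem eval {i : ℕ} {a F : ℕ} (hz : s.z = zeros a) (hy : s.y = []) (hp : s.p = [])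
    (hq : s.q = []) (hg : s.g = []) (hs : s.oracleTape = [])
    (ho : ∀ y, o (pos i a y) ↔ y < F) :
    Run (tally o) (.eval i) s { s with y := zeros F }
      ((F + 1) * (60 * (a + F + 1) ^ 2 + i + 5) + 3) := by
  rcases s with ⟨inp, z, y, p, q, g, u, v, ask, out, clk, res, ot, output⟩
  dsimp only at hz hy hp hq hg hs ⊢
  subst hz hy hp hq hg hs
  set s : Store := ⟨inp, zeros a, [], [], [], [], u, v, ask, out, clk, res, [], output⟩
  have h2 := loop (O := tally o) (r := .g) (d := .skip) (T := 60 * (a + F + 1) ^ 2 + i + 3)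
    (c := .test i (.push .y false ;; .push .g false) .skip)
    (fun k => if k ≤ F then { s with y := zeros k, g := [false] } else { s with y := zeros F })
    (F + 1) (fun k hk => by
      have hk' : k ≤ F := by omega
      refine ⟨false, [], by rw [if_pos hk']; rfl, ?_⟩
      rw [if_pos hk']
      rcases hk'.lt_or_eq with hlt | rfl
      · rw [if_pos (by omega)]
        refine (test_yes (a := a) (b := k) (s := { s with y := zeros k }) rfl rfl rfl rfl rfl
          ((ho k).2 hlt) ((push false).seq (push false))).mono ?_
        have : 60 * (a + k + 1) ^ 2 ≤ 60 * (a + F + 1) ^ 2 := by gcongr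
        omega
      · rw [if_neg (by omega)]
        exact (test_no (a := a) (b := k) (s := { s with y := zeros k }) rfl rfl rfl rfl rfl
          (fun h => lt_irrefl _ ((ho k).1 h)) skip).mono (by omega))
    (by rw [if_neg (by omega)]; rfl)
  rw [if_pos (Nat.zero_le _), if_neg (by omega)] at h2
  exact ((push (O := tally o) (s := s) (r := .g) false).seq h2).mono (by ring_nf; omega)

end Run

/-! ### Sweeping machines and their interpretation with an oracle -/

/-- A sweeping machine with the numbers as control states. Its memory consists of two stacks `u`
and `v` of positive numbers. An ordinary step pops a number `e` from `u`, where `e = 0` if `u` is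
empty, pushes the number `push (z + e)` on `v` unless it is `0`, and goes from the state `z` to
`next (z + e)`; if `u` was empty, then the two stacks are exchanged. The letters `ask z` and `out z`
are appended to the oracle tape and to the output. In a state `z` with `isQuery z`, the machine asks
the oracle and goes to `nextYes z` or to `next z`. All machines share one table; a particular machine
is given by its initial state. -/
structure Table : Type where
  halt : ℕ → Prop
  isQuery : ℕ → Prop
  ask : ℕ → Option Bool
  out : ℕ → Option Bool
  push : ℕ → ℕ
  next : ℕ → ℕ
  nextYes : ℕ → ℕ

/-- A configuration of a sweeping machine. -/
structure Sweep : Type where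
  z : ℕ
  u : List ℕ
  v : List ℕ
  ask : Word
  out : Word

/-- Push a number on a stack unless it is `0`. -/
def pushPos (n : ℕ) (l : List ℕ) : List ℕ := if n = 0 then l else n :: l

namespace Table

variable (τ : Table) (O : Set Word)

open Classical in
/-- One step of a sweeping machine. -/
noncomputable def step (c : Sweep) : Sweep :=
  if τ.halt c.z then c
  else if τ.isQuery c.z then
    { c with z := if c.ask ∈ O then τ.nextYes c.z else τ.next c.z, ask := [] }
  else match c.u with
    | [] =>
      { z := τ.next c.z
        u := pushPos (τ.push c.z) c.v
        v := []
        ask := c.ask ++ (τ.ask c.z).toList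
        out := c.out ++ (τ.out c.z).toList }
    | e :: u =>
      { z := τ.next (c.z + e)
        u := u
        v := pushPos (τ.push (c.z + e)) c.v
        ask := c.ask ++ (τ.ask c.z).toList
        out := c.out ++ (τ.out c.z).toList }

/-- The initial configuration: the letters of the input are represented by the numbers 1 and 2. -/
def init (i : ℕ) (x : Word) : Sweep := ⟨i, x.map fun b => bif b then 2 else 1, [], [], []⟩

/-- The configuration after `n` steps on input `x`, with the initial state `i`. -/
noncomputable def run (i : ℕ) (x : Word) (n : ℕ) : Sweep := (τ.step O)^[n] (init i x)

/-- The machine with initial state `i` halts on `x` within `n` steps with output `y`. -/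
def Outputs (i : ℕ) (x : Word) (n : ℕ) (y : Word) : Prop :=
  τ.halt (τ.run O i x n).z ∧ (τ.run O i x n).out = y

theorem run_succ (i : ℕ) (x : Word) (n : ℕ) :
    τ.run O i x (n + 1) = τ.step O (τ.run O i x n) :=
  Function.iterate_succ_apply' _ _ _

variable {τ O} {z : ℕ} {u v : List ℕ} {ask out : Word}

theorem step_halt {c : Sweep} (hh : τ.halt c.z) : τ.step O c = c := if_pos hh

open Classical in
theorem step_query {c : Sweep} (hh : ¬ τ.halt c.z) (hq : τ.isQuery c.z) :
    τ.step O c =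
      { c with z := if c.ask ∈ O then τ.nextYes c.z else τ.next c.z, ask := [] } := by
  rw [step, if_neg hh, if_pos hq]

theorem step_nil (hh : ¬ τ.halt z) (hq : ¬ τ.isQuery z) :
    τ.step O ⟨z, [], v, ask, out⟩ = ⟨τ.next z, pushPos (τ.push z) v, [],
      ask ++ (τ.ask z).toList, out ++ (τ.out z).toList⟩ := by
  rw [step, if_neg hh, if_neg hq]

theorem step_cons {e : ℕ} (hh : ¬ τ.halt z) (hq : ¬ τ.isQuery z) :
    τ.step O ⟨z, e :: u, v, ask, out⟩ = ⟨τ.next (z + e), u, pushPos (τ.push (z + e)) v,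
      ask ++ (τ.ask z).toList, out ++ (τ.out z).toList⟩ := by
  rw [step, if_neg hh, if_neg hq]

/-- The oracle `o` knows the table. -/
structure Answers (τ : Table) (o : ℕ → Prop) : Prop where
  halt : ∀ z, o (pos 0 z 0) ↔ τ.halt z
  isQuery : ∀ z, o (pos 1 z 0) ↔ τ.isQuery z
  ask_false : ∀ z, o (pos 2 z 0) ↔ τ.ask z = some false
  ask_true : ∀ z, o (pos 3 z 0) ↔ τ.ask z = some true
  out_false : ∀ z, o (pos 4 z 0) ↔ τ.out z = some false
  out_true : ∀ z, o (pos 5 z 0) ↔ τ.out z = some true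
  push : ∀ z y, o (pos 6 z y) ↔ y < τ.push z
  next : ∀ z y, o (pos 7 z y) ↔ y < τ.next z
  nextYes : ∀ z y, o (pos 8 z y) ↔ y < τ.nextYes z

end Table

/-- A stack of numbers as a stack of bits: the number `e` becomes the block `0ᵉ1`. -/
def blocks (l : List ℕ) : Word := l.flatMap fun e => zeros e ++ [true]

theorem blocks_cons (e : ℕ) (l : List ℕ) : blocks (e :: l) = zeros e ++ true :: blocks l := by
  simp [blocks]

/-- The numbers in a configuration are at most `N`, and those on the stacks are positive. -/
structure Sweep.Bounded (N : ℕ) (c : Sweep) : Prop where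
  z : c.z ≤ N
  u : ∀ e ∈ c.u, 0 < e ∧ e ≤ N
  v : ∀ e ∈ c.v, 0 < e ∧ e ≤ N

theorem length_blocks_le {N : ℕ} {l : List ℕ} (h : ∀ e ∈ l, 0 < e ∧ e ≤ N) :
    (blocks l).length ≤ l.length * (N + 1) := by
  induction l with
  | nil => simp [blocks]
  | cons e l ih =>
    have := ih fun e he => h e (List.mem_cons_of_mem _ he)
    have := (h e List.mem_cons_self).2
    rw [blocks_cons]
    simp only [List.length_append, List.length_replicate, List.length_cons, Nat.succ_mul]
    omega

/-- The store in which a configuration is represented, together with the number `clk` of steps left.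
The words `ask` and `out` grow at the end, which is the top of the stack. -/
def Sweep.toStore (c : Sweep) (clk : ℕ) : Store where
  z := zeros c.z
  u := blocks c.u
  v := blocks c.v
  ask := c.ask.reverse
  out := c.out.reverse
  clk := zeros clk

namespace Cmd

/-- Move the number in `y` to `z`. -/
def assign : Cmd := clear .z ;; move .y .z

/-- Emit the letters of the current state. -/
def emit (i : ℕ) (r : Reg) : Cmd :=
  test i (push r false) skip ;; test (i + 1) (push r true) skip

/-- Add the next number on the stack `u` to the number in `z`; if there is none, mark `res`. -/
def readBlock : Cmd :=
  pop .u (push .res false)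
    (push .z false ;; push .g false ;;
      loop .g (pop .u skip (push .z false ;; push .g false) skip) skip) skip

/-- Push the number in `y` on the stack `v` unless it is `0`. -/
def writeBlock : Cmd := pop .y skip (push .v true ;; push .v false ;; move .y .v) skip

/-- Exchange the stacks if `res` is marked; the stack `u` is empty in this case. -/
def swap : Cmd := pop .res skip (move .v .inp ;; move .inp .u) skip

/-- Interpret a step in which the oracle is asked. -/
def queryStep : Cmd := loop .ask (ask false) (ask true) ;; query (eval 8) (eval 7) ;; assign

/-- Interpret an ordinary step. -/
def sweepStep : Cmd :=
  emit 2 .ask ;; emit 4 .out ;; readBlock ;; eval 6 ;; writeBlock ;; swap ;; eval 7 ;; assign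

/-- Interpret one step. -/
def interpret : Cmd := test 0 skip (test 1 queryStep sweepStep)

end Cmd

namespace Run

variable {O : Set Word} {o : ℕ → Prop} {s : Store}

theorem assign {a b : ℕ} (hz : s.z = zeros a) (hy : s.y = zeros b) :
    Run O .assign s { s with z := zeros b, y := [] } (a * 3 + 2 + (b * 3 + 2)) := by
  have h1 := clear (O := O) (r := .z) (s := s)
  have h2 := move (O := O) (r := .y) (r' := .z) (s := s.set .z []) (by decide)
  have := h1.seq h2
  rcases s with ⟨inp, z, y, p, q, g, u, v, ask, out, clk, res, ot, output⟩
  dsimp only at hz hy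
  subst hz hy
  simpa [Store.set, Store.reg] using! this

theorem emit_ask {τ : Table} (hτ : τ.Answers o) {a : ℕ} (hz : s.z = zeros a) (hy : s.y = [])
    (hp : s.p = []) (hq : s.q = []) (hs : s.oracleTape = []) :
    Run (tally o) (.emit 2 .ask) s { s with ask := (τ.ask a).toList ++ s.ask }
      (120 * (a + 1) ^ 2 + 9) := by
  have hf := hτ.ask_false a
  have ht := hτ.ask_true a
  rcases h : τ.ask a with _ | _ | _
  · exact ((test_no (a := a) (b := 0) hz hy hp hq hs (by simp [hf, h]) skip).seq
      (test_no (a := a) (b := 0) hz hy hp hq hs (by simp [ht, h]) skip)).mono (by ring_nf; omega)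
  · exact ((test_yes (a := a) (b := 0) hz hy hp hq hs (by simp [hf, h]) (push false)).seq
      (test_no (s := { s with ask := false :: s.ask }) (a := a) (b := 0) hz hy hp hq hs
        (by simp [ht, h]) skip)).mono (by ring_nf; omega)
  · exact ((test_no (a := a) (b := 0) hz hy hp hq hs (by simp [hf, h]) skip).seq
      (test_yes (a := a) (b := 0) hz hy hp hq hs (by simp [ht, h]) (push true))).mono
      (by ring_nf; omega)

theorem emit_out {τ : Table} (hτ : τ.Answers o) {a : ℕ} (hz : s.z = zeros a) (hy : s.y = [])
    (hp : s.p = []) (hq : s.q = []) (hs : s.oracleTape = []) :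
    Run (tally o) (.emit 4 .out) s { s with out := (τ.out a).toList ++ s.out }
      (120 * (a + 1) ^ 2 + 13) := by
  have hf := hτ.out_false a
  have ht := hτ.out_true a
  rcases h : τ.out a with _ | _ | _
  · exact ((test_no (a := a) (b := 0) hz hy hp hq hs (by simp [hf, h]) skip).seq
      (test_no (a := a) (b := 0) hz hy hp hq hs (by simp [ht, h]) skip)).mono (by ring_nf; omega)
  · exact ((test_yes (a := a) (b := 0) hz hy hp hq hs (by simp [hf, h]) (push false)).seq
      (test_no (s := { s with out := false :: s.out }) (a := a) (b := 0) hz hy hp hq hs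
        (by simp [ht, h]) skip)).mono (by ring_nf; omega)
  · exact ((test_no (a := a) (b := 0) hz hy hp hq hs (by simp [hf, h]) skip).seq
      (test_yes (a := a) (b := 0) hz hy hp hq hs (by simp [ht, h]) (push true))).mono
      (by ring_nf; omega)

theorem readBlock_nil (hu : s.u = []) :
    Run O .readBlock s { s with res := false :: s.res } 3 :=
  (pop_nil (s := s) (r := .u) hu (push false)).mono le_rfl

theorem readBlock_cons {a e : ℕ} {w : Word} (hz : s.z = zeros a) (hg : s.g = []) (he : 0 < e)
    (hu : s.u = zeros e ++ true :: w) :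
    Run O .readBlock s { s with z := zeros (a + e), u := w } (e * 6 + 6) := by
  rcases s with ⟨inp, z, y, p, q, g, u, v, ask, out, clk, res, ot, output⟩
  dsimp only at hz hg hu ⊢
  subst hz hg hu
  obtain ⟨e, rfl⟩ : ∃ e', e = e' + 1 := ⟨e - 1, by omega⟩
  refine (pop_cons (b := false) (w := zeros e ++ true :: w) rfl
    (T := 2 + (e + 1) * 6 + 2) ?_).mono (by omega)
  set s : Store := ⟨inp, zeros a, y, p, q, [], zeros e ++ true :: w, v, ask, out, clk, res, ot,
    output⟩
  have := loop (O := O) (r := .g) (d := .skip) (T := 4)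
    (c := .pop .u .skip (.push .z false ;; .push .g false) .skip)
    (fun k => if k ≤ e then
      { s with z := zeros (a + (k + 1)), u := zeros (e - k) ++ true :: w, g := [false] }
      else { s with z := zeros (a + (e + 1)), u := w })
    (e + 1) (fun k hk => by
      have hk' : k ≤ e := by omega
      refine ⟨false, [], by rw [if_pos hk']; rfl, ?_⟩
      rw [if_pos hk']
      rcases hk'.lt_or_eq with hlt | rfl
      · rw [if_pos (by omega)]
        refine (pop_cons (b := false) (w := zeros (e - (k + 1)) ++ true :: w) ?_
          ((push false).seq (push false))).mono le_rfl
        simp only [Store.set, Store.reg]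
        rw [← List.cons_append, ← List.replicate_succ, show e - (k + 1) + 1 = e - k by omega]
      · rw [if_neg (by omega), Nat.sub_self]
        exact (pop_cons (b := true) (w := w) rfl skip).mono (by omega))
    (by rw [if_neg (by omega)]; rfl)
  rw [if_pos (Nat.zero_le _), if_neg (by omega)] at this
  exact ((push false).seq ((push false).seq this)).mono (by omega)

theorem writeBlock {k : ℕ} {l : List ℕ} (hy : s.y = zeros k) (hv : s.v = blocks l) :
    Run O .writeBlock s { s with y := [], v := blocks (pushPos k l) } (k * 3 + 6) := by
  rcases s with ⟨inp, z, y, p, q, g, u, v, ask, out, clk, res, ot, output⟩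
  dsimp only at hy hv ⊢
  subst hy hv
  cases k with
  | zero => exact (pop_nil rfl skip).mono (by omega)
  | succ k =>
    have h := pop_cons (O := O) (e := .skip) (d := .skip)
      (c := .push .v true ;; .push .v false ;; .move .y .v) (r := .y) (b := false) (w := zeros k)
      (s := ⟨inp, z, zeros (k + 1), p, q, g, u, blocks l, ask, out, clk, res, ot, output⟩) rfl
      ((push true).seq ((push false).seq (move (by decide))))
    have e : blocks (pushPos (k + 1) l) = (zeros k).reverse ++ false :: true :: blocks l := by
      rw [show pushPos (k + 1) l = (k + 1) :: l from rfl, blocks_cons, List.reverse_replicate,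
        show zeros (k + 1) = zeros k ++ [false] from List.replicate_succ', List.append_assoc]
      rfl
    rw [e]
    refine Run.mono h ?_
    simp [Store.reg, Store.set]; omega

theorem swap_nil (hr : s.res = []) : Run O .swap s s 3 :=
  (pop_nil (s := s) (r := .res) hr skip).mono le_rfl

theorem swap_cons (hr : s.res = [false]) (hi : s.inp = []) (hu : s.u = []) :
    Run O .swap s { s with u := s.v, v := [], res := [] } (s.v.length * 6 + 6) := by
  rcases s with ⟨inp, z, y, p, q, g, u, v, ask, out, clk, res, ot, output⟩
  dsimp only at hr hi hu ⊢
  subst hr hi hu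
  have := pop_cons (O := O) (c := .move .v .inp ;; .move .inp .u) (e := .skip) (d := .skip)
    (s := ⟨[], z, y, p, q, g, [], v, ask, out, clk, [false], ot, output⟩)
    (r := .res) (b := false) (w := []) rfl ((move (by decide)).seq (move (by decide)))
  refine Run.mono (by simpa [Store.set, Store.reg] using! this) ?_
  simp; omega

theorem eval_time_le {a F M i : ℕ} (ha : a ≤ 2 * M) (hF : F ≤ M) (hi : i ≤ 11) :
    (F + 1) * (60 * (a + F + 1) ^ 2 + i + 5) + 3 ≤ 600 * (M + 1) ^ 3 := by
  calc (F + 1) * (60 * (a + F + 1) ^ 2 + i + 5) + 3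
      ≤ (M + 1) * (60 * (3 * (M + 1)) ^ 2 + 11 + 5) + 3 := by gcongr; omega
    _ ≤ _ := by ring_nf; nlinarith [Nat.zero_le M]

variable {τ : Table} {c : Sweep} {N M : ℕ}

open Classical in
theorem queryStep (hτ : τ.Answers o) (clk : ℕ) (hh : ¬ τ.halt c.z) (hq : τ.isQuery c.z)
    (hc : c.Bounded N) (hc' : (τ.step (tally o) c).Bounded N) (hNM : N ≤ M)
    (ha : c.ask.length ≤ M) :
    Run (tally o) .queryStep (c.toStore clk) ((τ.step (tally o) c).toStore clk)
      (4000 * (M + 1) ^ 3) := by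
  have hask : ∀ (w : Word) (s : Store), s.ask = w →
      Run (tally o) (.loop .ask (.ask false) (.ask true)) s
        { s with ask := [], oracleTape := s.oracleTape ++ w } (w.length * 3 + 2) := by
    intro w
    induction w with
    | nil =>
      rintro ⟨inp, z, y, p, q, g, u, v, ask, out, clk, res, ot, output⟩ rfl
      simpa using! loop (O := tally o) (r := .ask) (c := .ask false) (d := .ask true) (T := 1)
        (fun _ => ⟨inp, z, y, p, q, g, u, v, [], out, clk, res, ot, output⟩) 0 (by simp) rfl
    | cons b w ih =>
      rintro ⟨inp, z, y, p, q, g, u, v, ask, out, clk, res, ot, output⟩ rfl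
      obtain ⟨t, ht, hx⟩ := ih ⟨inp, z, y, p, q, g, u, v, w, out, clk, res, ot ++ [b], output⟩ rfl
      dsimp only at hx
      rw [List.append_assoc] at hx
      refine ⟨2 + 1 + t, by simp; omega, ?_⟩
      cases b
      · exact .loop_false rfl (.ask _ _) hx
      · exact .loop_true rfl (.ask _ _) hx
  have h1 := hask c.ask.reverse (c.toStore clk) rfl
  rw [Table.step_query hh hq] at hc' ⊢
  by_cases hO : c.ask ∈ tally o
  · rw [if_pos hO] at hc' ⊢
    have h2 := eval (o := o) (i := 8) (s := { c.toStore clk with ask := [], oracleTape := [] })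
      (a := c.z) rfl rfl rfl rfl rfl rfl (hτ.nextYes c.z)
    have h3 := assign (O := tally o)
      (s := { c.toStore clk with ask := [], oracleTape := [], y := zeros (τ.nextYes c.z) })
      (a := c.z) rfl rfl
    refine (h1.seq ((query_yes (reverse_mem_tally.2 hO) h2).seq h3)).mono ?_
    have := hc.z
    have := hc'.z
    dsimp only at this
    rw [List.length_reverse]
    have := eval_time_le (a := c.z) (F := τ.nextYes c.z) (M := M) (i := 8) (by omega) (by omega)
      (by norm_num)
    have : M + 1 ≤ (M + 1) ^ 3 := Nat.le_self_pow (by norm_num) _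
    omega
  · rw [if_neg hO] at hc' ⊢
    have h2 := eval (o := o) (i := 7) (s := { c.toStore clk with ask := [], oracleTape := [] })
      (a := c.z) rfl rfl rfl rfl rfl rfl (hτ.next c.z)
    have h3 := assign (O := tally o)
      (s := { c.toStore clk with ask := [], oracleTape := [], y := zeros (τ.next c.z) })
      (a := c.z) rfl rfl
    refine (h1.seq ((query_no (fun h => hO (reverse_mem_tally.1 h)) h2).seq h3)).mono ?_
    have := hc.z
    have := hc'.z
    dsimp only at this
    rw [List.length_reverse]
    have := eval_time_le (a := c.z) (F := τ.next c.z) (M := M) (i := 7) (by omega) (by omega)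
      (by norm_num)
    have : M + 1 ≤ (M + 1) ^ 3 := Nat.le_self_pow (by norm_num) _
    omega

theorem sweepStep (hτ : τ.Answers o) (clk : ℕ) (hh : ¬ τ.halt c.z) (hq : ¬ τ.isQuery c.z)
    (hc : c.Bounded N) (hc' : (τ.step (tally o) c).Bounded N) (hNM : N ≤ M)
    (hv : (blocks (τ.step (tally o) c).u).length ≤ M) :
    Run (tally o) .sweepStep (c.toStore clk) ((τ.step (tally o) c).toStore clk)
      (9000 * (M + 1) ^ 3) := by
  have h1 := emit_ask (s := c.toStore clk) hτ (a := c.z) rfl rfl rfl rfl rfl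
  have h2 := emit_out (s := { c.toStore clk with ask := (τ.ask c.z).toList ++ c.ask.reverse })
    hτ (a := c.z) rfl rfl rfl rfl rfl
  have rev : ∀ (b : Option Bool) (w : Word), b.toList ++ w.reverse = (w ++ b.toList).reverse := by
    rintro (_ | b) w <;> simp
  rcases c with ⟨z, u, v, ask, out⟩
  dsimp only at *
  cases u with
  | nil =>
    rw [Table.step_nil hh hq] at hc' hv ⊢
    have h3 := readBlock_nil (O := tally o) (s :=
      ({ z := zeros z, v := blocks v, ask := (ask ++ (τ.ask z).toList).reverse,
         out := (out ++ (τ.out z).toList).reverse, clk := zeros clk } : Store)) rfl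
    have h4 := eval (o := o) (i := 6) (s :=
      ({ z := zeros z, v := blocks v, ask := (ask ++ (τ.ask z).toList).reverse,
         out := (out ++ (τ.out z).toList).reverse, clk := zeros clk, res := [false] } : Store))
      (a := z) rfl rfl rfl rfl rfl rfl (hτ.push z)
    have h5 := writeBlock (O := tally o) (s :=
      ({ z := zeros z, y := zeros (τ.push z), v := blocks v,
         ask := (ask ++ (τ.ask z).toList).reverse, out := (out ++ (τ.out z).toList).reverse,
         clk := zeros clk, res := [false] } : Store)) (k := τ.push z) (l := v) rfl rfl
    have h6 := swap_cons (O := tally o) (s :=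
      ({ z := zeros z, v := blocks (pushPos (τ.push z) v),
         ask := (ask ++ (τ.ask z).toList).reverse, out := (out ++ (τ.out z).toList).reverse,
         clk := zeros clk, res := [false] } : Store)) rfl rfl rfl
    have h7 := eval (o := o) (i := 7) (s :=
      ({ z := zeros z, u := blocks (pushPos (τ.push z) v),
         ask := (ask ++ (τ.ask z).toList).reverse, out := (out ++ (τ.out z).toList).reverse,
         clk := zeros clk } : Store))
      (a := z) rfl rfl rfl rfl rfl rfl (hτ.next z)
    have h8 := assign (O := tally o) (s :=
      ({ z := zeros z, y := zeros (τ.next z), u := blocks (pushPos (τ.push z) v),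
         ask := (ask ++ (τ.ask z).toList).reverse, out := (out ++ (τ.out z).toList).reverse,
         clk := zeros clk } : Store)) (a := z) (b := τ.next z) rfl rfl
    simp only [Sweep.toStore, rev] at h1 h2
    refine (h1.seq (h2.seq (h3.seq (h4.seq (h5.seq (h6.seq (h7.seq h8))))))).mono ?_
    have hpush : τ.push z ≤ N := by
      by_cases h0 : τ.push z = 0
      · omega
      · exact (hc'.u (τ.push z) (by simp [pushPos, h0])).2
    have := hc.z
    have := hc'.z
    dsimp only at *
    have := eval_time_le (a := z) (F := τ.push z) (M := M) (i := 6) (by omega)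
      (by omega) (by norm_num)
    have := eval_time_le (a := z) (F := τ.next z) (M := M) (i := 7) (by omega)
      (by omega) (by norm_num)
    have : M + 1 ≤ (M + 1) ^ 3 := Nat.le_self_pow (by norm_num) _
    have : (z + 1) ^ 2 ≤ (M + 1) ^ 2 := by gcongr; omega
    have : (M + 1) ^ 2 ≤ (M + 1) ^ 3 := Nat.pow_le_pow_right (by omega) (by norm_num)
    omega
  | cons e u =>
    rw [Table.step_cons hh hq] at hc' hv ⊢
    have he := hc.u e List.mem_cons_self
    have h3 := readBlock_cons (O := tally o) (s :=
      ({ z := zeros z, u := blocks (e :: u), v := blocks v,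
         ask := (ask ++ (τ.ask z).toList).reverse,
         out := (out ++ (τ.out z).toList).reverse, clk := zeros clk } : Store))
      (a := z) (e := e) (w := blocks u) rfl rfl he.1 (blocks_cons e u)
    have h4 := eval (o := o) (i := 6) (s :=
      ({ z := zeros (z + e), u := blocks u, v := blocks v,
         ask := (ask ++ (τ.ask z).toList).reverse,
         out := (out ++ (τ.out z).toList).reverse, clk := zeros clk } : Store))
      (a := z + e) rfl rfl rfl rfl rfl rfl (hτ.push (z + e))
    have h5 := writeBlock (O := tally o) (s :=
      ({ z := zeros (z + e), y := zeros (τ.push (z + e)), u := blocks u, v := blocks v,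
         ask := (ask ++ (τ.ask z).toList).reverse, out := (out ++ (τ.out z).toList).reverse,
         clk := zeros clk } : Store)) (k := τ.push (z + e)) (l := v) rfl rfl
    have h6 := swap_nil (O := tally o) (s :=
      ({ z := zeros (z + e), u := blocks u, v := blocks (pushPos (τ.push (z + e)) v),
         ask := (ask ++ (τ.ask z).toList).reverse, out := (out ++ (τ.out z).toList).reverse,
         clk := zeros clk } : Store)) rfl
    have h7 := eval (o := o) (i := 7) (s :=
      ({ z := zeros (z + e), u := blocks u, v := blocks (pushPos (τ.push (z + e)) v),
         ask := (ask ++ (τ.ask z).toList).reverse, out := (out ++ (τ.out z).toList).reverse,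
         clk := zeros clk } : Store))
      (a := z + e) rfl rfl rfl rfl rfl rfl (hτ.next (z + e))
    have h8 := assign (O := tally o) (s :=
      ({ z := zeros (z + e), y := zeros (τ.next (z + e)), u := blocks u,
         v := blocks (pushPos (τ.push (z + e)) v),
         ask := (ask ++ (τ.ask z).toList).reverse, out := (out ++ (τ.out z).toList).reverse,
         clk := zeros clk } : Store)) (a := z + e) (b := τ.next (z + e)) rfl rfl
    simp only [Sweep.toStore, rev] at h1 h2
    refine (h1.seq (h2.seq (h3.seq (h4.seq (h5.seq (h6.seq (h7.seq h8))))))).mono ?_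
    have hpush : τ.push (z + e) ≤ N := by
      by_cases h0 : τ.push (z + e) = 0
      · omega
      · exact (hc'.v (τ.push (z + e)) (by simp [pushPos, h0])).2
    have := hc.z
    have := hc'.z
    dsimp only at *
    have := eval_time_le (a := z + e) (F := τ.push (z + e)) (M := M) (i := 6) (by omega)
      (by omega) (by norm_num)
    have := eval_time_le (a := z + e) (F := τ.next (z + e)) (M := M) (i := 7) (by omega)
      (by omega) (by norm_num)
    have : M + 1 ≤ (M + 1) ^ 3 := Nat.le_self_pow (by norm_num) _
    have : (z + 1) ^ 2 ≤ (M + 1) ^ 2 := by gcongr; omega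
    have : (M + 1) ^ 2 ≤ (M + 1) ^ 3 := Nat.pow_le_pow_right (by omega) (by norm_num)
    omega

end Run

namespace Table

variable {τ : Table} {O : Set Word}

theorem length_pushPos_le (n : ℕ) (l : List ℕ) : (pushPos n l).length ≤ l.length + 1 := by
  unfold pushPos; split_ifs <;> simp

theorem length_toList_le (b : Option Bool) : b.toList.length ≤ 1 := by cases b <;> simp

theorem length_step_le (c : Sweep) :
    (τ.step O c).u.length + (τ.step O c).v.length ≤ c.u.length + c.v.length + 1 ∧
      (τ.step O c).ask.length ≤ c.ask.length + 1 ∧ (τ.step O c).out.length ≤ c.out.length + 1 := by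
  by_cases hh : τ.halt c.z
  · rw [step_halt hh]; omega
  by_cases hq : τ.isQuery c.z
  · rw [step_query hh hq]; simp
  rcases c with ⟨z, _ | ⟨e, u⟩, v, ask, out⟩
  · rw [step_nil hh hq]
    have := length_pushPos_le (τ.push z) v
    have := length_toList_le (τ.ask z)
    have := length_toList_le (τ.out z)
    simp only [List.length_append, List.length_nil]
    omega
  · rw [step_cons hh hq]
    have := length_pushPos_le (τ.push (z + e)) v
    have := length_toList_le (τ.ask z)
    have := length_toList_le (τ.out z)
    simp only [List.length_append, List.length_cons]
    omega

theorem length_run_le (i : ℕ) (x : Word) (n : ℕ) :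
    (τ.run O i x n).u.length + (τ.run O i x n).v.length ≤ x.length + n ∧
      (τ.run O i x n).ask.length ≤ n ∧ (τ.run O i x n).out.length ≤ n := by
  induction n with
  | zero => simp [run, init]
  | succ n ih =>
    have := length_step_le (τ := τ) (O := O) (τ.run O i x n)
    rw [run_succ]
    omega

end Table

namespace Cmd

/-- Split the input `x 1 0ᵃ`: move the zeros to `z` and keep the reversed word `x`. If there is no
letter `1`, mark `res`. -/
def split : Cmd :=
  push .g false ;; loop .g (pop .inp (push .res false) (push .z false ;; push .g false) skip) skip

/-- Represent the input on the stack `u` of a sweeping machine. -/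
def load : Cmd :=
  loop .inp (push .u true ;; push .u false) (push .u true ;; push .u false ;; push .u false)

/-- Write the contents of the register `out` onto the output tape, starting at the bottom. -/
def flush : Cmd := move .out .inp ;; loop .inp (out false) (out true)

/-- The universal program: on input `x 1 0ᵃ`, if the query number 9 about `a` and `κ` has a positive
answer, simulate the sweeping machine and the number of steps given by `a` on `x`; in all other cases
and if the machine does not halt in time, output `d`. -/
def universal (κ : ℕ) (d : Word) : Cmd :=
  split ;; pop .res
    ((push .y false).rep κ ;; test 9
      (clear .y ;; eval 11 ;; move .y .clk ;; eval 10 ;; assign ;; load ;;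
        loop .clk interpret interpret ;; test 0 flush (print d))
      (print d))
    (print d) (print d)

end Cmd

namespace Run

variable {O : Set Word} {o : ℕ → Prop} {s : Store}

theorem split_cons {a : ℕ} {w : Word} :
    Run O .split { inp := zeros a ++ true :: w } { inp := w, z := zeros a } (a * 6 + 9) := by
  have := loop (O := O) (r := .g) (d := .skip) (T := 4)
    (c := .pop .inp (.push .res false) (.push .z false ;; .push .g false) .skip)
    (fun k => if k ≤ a then { inp := zeros (a - k) ++ true :: w, z := zeros k, g := [false] }
      else { inp := w, z := zeros a })
    (a + 1) (fun k hk => by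
      have hk' : k ≤ a := by omega
      refine ⟨false, [], by rw [if_pos hk']; rfl, ?_⟩
      rw [if_pos hk']
      rcases hk'.lt_or_eq with hlt | rfl
      · rw [if_pos (by omega)]
        refine (pop_cons (b := false) (w := zeros (a - (k + 1)) ++ true :: w) ?_
          ((push false).seq (push false))).mono le_rfl
        simp only [Store.set, Store.reg]
        rw [← List.cons_append, ← List.replicate_succ, show a - (k + 1) + 1 = a - k by omega]
      · rw [if_neg (by omega), Nat.sub_self]
        exact (pop_cons (b := true) (w := w) rfl skip).mono (by omega))
    (by rw [if_neg (by omega)]; rfl)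
  rw [if_pos (Nat.zero_le _), if_neg (by omega)] at this
  exact ((push false).seq this).mono (by omega)

theorem split_zeros {a : ℕ} :
    Run O .split { inp := zeros a } { z := zeros a, res := [false] } (a * 6 + 9) := by
  have := loop (O := O) (r := .g) (d := .skip) (T := 4)
    (c := .pop .inp (.push .res false) (.push .z false ;; .push .g false) .skip)
    (fun k => if k ≤ a then { inp := zeros (a - k), z := zeros k, g := [false] }
      else { z := zeros a, res := [false] })
    (a + 1) (fun k hk => by
      have hk' : k ≤ a := by omega
      refine ⟨false, [], by rw [if_pos hk']; rfl, ?_⟩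
      rw [if_pos hk']
      rcases hk'.lt_or_eq with hlt | rfl
      · rw [if_pos (by omega)]
        refine (pop_cons (b := false) (w := zeros (a - (k + 1))) ?_
          ((push false).seq (push false))).mono le_rfl
        simp only [Store.set, Store.reg]
        rw [← List.replicate_succ, show a - (k + 1) + 1 = a - k by omega]
      · rw [if_neg (by omega), Nat.sub_self]
        exact (pop_nil rfl (push false)).mono (by omega))
    (by rw [if_neg (by omega)]; rfl)
  rw [if_pos (Nat.zero_le _), if_neg (by omega)] at this
  exact ((push false).seq this).mono (by omega)

/-- The input is held in `inp` in reversed order, so its first letter comes to the top of `u`. -/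
theorem load {w : Word} (hi : s.inp = w) {l : List ℕ} (hu : s.u = blocks l) :
    Run O .load s { s with
      inp := [], u := blocks ((w.reverse.map fun b => bif b then 2 else 1) ++ l) }
      (w.length * 5 + 2) := by
  induction w generalizing s l with
  | nil =>
    rcases s with ⟨inp, z, y, p, q, g, u, v, ask, out, clk, res, ot, output⟩
    dsimp only at hi hu ⊢
    subst hi hu
    exact ⟨2, by omega, .loop_nil rfl⟩
  | cons b w ih =>
    rcases s with ⟨inp, z, y, p, q, g, u, v, ask, out, clk, res, ot, output⟩
    dsimp only at hi hu ⊢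
    subst hi hu
    obtain ⟨t, ht, hx⟩ := ih (s := ⟨w, z, y, p, q, g, blocks ((bif b then 2 else 1) :: l), v, ask,
      out, clk, res, ot, output⟩) rfl rfl
    have e : ((b :: w).reverse.map fun b => bif b then 2 else 1) ++ l =
        (w.reverse.map fun b => bif b then 2 else 1) ++ ((bif b then 2 else 1) :: l) := by simp
    rw [e]
    cases b
    · exact ⟨2 + (1 + 1) + t, by simp; omega,
        .loop_false rfl ((Exec.push _ _ _).seq (.push _ _ _)) hx⟩
    · exact ⟨2 + (1 + (1 + 1)) + t, by simp; omega,
        .loop_true rfl ((Exec.push _ _ _).seq ((Exec.push _ _ _).seq (.push _ _ _))) hx⟩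

theorem outputs (r : Reg) (w : Word) : ∀ s : Store, s.reg r = w →
    Run O (.loop r (.out false) (.out true)) s
      { s.set r [] with output := s.output ++ w } (w.length * 3 + 2) := by
  induction w with
  | nil =>
    intro s hs
    have e : ({ s.set r [] with output := s.output ++ [] } : Store) = s := by
      rw [← hs, Store.set_reg_self, hs, List.append_nil]
    rw [e]
    exact ⟨2, by simp, .loop_nil hs⟩
  | cons b w ih =>
    intro s hs
    obtain ⟨t, ht, hx⟩ := ih { s.set r w with output := s.output ++ [b] } (by cases r <;> rfl)
    have e : ({ ({ s.set r w with output := s.output ++ [b] } : Store).set r [] with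
          output := s.output ++ [b] ++ w } : Store) =
        { s.set r [] with output := s.output ++ b :: w } := by
      rw [List.append_assoc]; cases r <;> rfl
    dsimp only at hx e
    rw [e] at hx
    have hout : Exec O (.out b) (s.set r w) { s.set r w with output := s.output ++ [b] } 1 := by
      have := Exec.out (O := O) b (s.set r w)
      rwa [Store.output_set] at this
    refine ⟨2 + 1 + t, by simp; omega, ?_⟩
    cases b
    · exact .loop_false hs hout hx
    · exact .loop_true hs hout hx

theorem flush {w : Word} (hi : s.inp = []) (ho : s.out = w.reverse) :
    Run O .flush s { s with out := [], output := s.output ++ w } (w.length * 6 + 4) := by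
  rcases s with ⟨inp, z, y, p, q, g, u, v, ask, out, clk, res, ot, output⟩
  dsimp only at hi ho ⊢
  subst hi ho
  have h1 := move (O := O) (r := .out) (r' := .inp)
    (s := ⟨[], z, y, p, q, g, u, v, ask, w.reverse, clk, res, ot, output⟩) (by decide)
  have h2 := outputs (O := O) .inp w ⟨w, z, y, p, q, g, u, v, ask, [], clk, res, ot, output⟩ rfl
  have e : w.reverse.reverse ++ [] = w := by simp
  refine (h1.seq (?_ : Run O _ _ _ (w.length * 3 + 2))).mono ?_
  · simp only [Store.reg, Store.set, e]
    exact h2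
  · simp [Store.reg]; omega

variable {τ : Table} {c : Sweep} {N M : ℕ}

theorem interpret (hτ : τ.Answers o) (clk : ℕ)
    (hc : c.Bounded N) (hc' : (τ.step (tally o) c).Bounded N) (hNM : N ≤ M)
    (ha : c.ask.length ≤ M) (hv : (blocks (τ.step (tally o) c).u).length ≤ M) :
    Run (tally o) .interpret (c.toStore clk) ((τ.step (tally o) c).toStore clk)
      (10000 * (M + 1) ^ 3) := by
  have hz := hc.z
  have : (c.z + 0 + 1) ^ 2 ≤ (M + 1) ^ 2 := by gcongr; omega
  have : (M + 1) ^ 2 ≤ (M + 1) ^ 3 := Nat.pow_le_pow_right (by omega) (by norm_num)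
  have : 1 ≤ (M + 1) ^ 3 := Nat.one_le_pow _ _ (by omega)
  by_cases hh : τ.halt c.z
  · rw [Table.step_halt hh]
    refine (test_yes (a := c.z) (b := 0) rfl rfl rfl rfl rfl ((hτ.halt _).2 hh) skip).mono ?_
    omega
  refine (test_no (a := c.z) (b := 0) rfl rfl rfl rfl rfl (fun h => hh ((hτ.halt _).1 h))
    (T := 9500 * (M + 1) ^ 3) ?_).mono (by omega)
  by_cases hq : τ.isQuery c.z
  · refine (test_yes (a := c.z) (b := 0) rfl rfl rfl rfl rfl ((hτ.isQuery _).2 hq)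
      (queryStep hτ clk hh hq hc hc' hNM ha)).mono ?_
    omega
  · refine (test_no (a := c.z) (b := 0) rfl rfl rfl rfl rfl (fun h => hq ((hτ.isQuery _).1 h))
      (sweepStep hτ clk hh hq hc hc' hNM hv)).mono ?_
    omega

/-- The stacks hold at most `x.length + n` blocks of length at most `N + 1`, so that `M` bounds all
lengths that matter for the time of a step. -/
theorem interpret_loop (hτ : τ.Answers o) {i : ℕ} {x : Word} {n : ℕ}
    (hb : ∀ k, (τ.run (tally o) i x k).Bounded N) (hM : (x.length + n + 1) * (N + 1) ≤ M) :
    Run (tally o) (.loop .clk .interpret .interpret) ((Table.init i x).toStore n)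
      ((τ.run (tally o) i x n).toStore 0) (n * (10000 * (M + 1) ^ 3 + 2) + 2) := by
  have := loop (O := tally o) (r := .clk) (c := .interpret) (d := .interpret)
    (T := 10000 * (M + 1) ^ 3) (fun k => (τ.run (tally o) i x k).toStore (n - k)) n
    (fun k hk => by
      refine ⟨false, zeros (n - (k + 1)), ?_, ?_⟩
      · change zeros (n - k) = _
        rw [← List.replicate_succ, show n - (k + 1) + 1 = n - k by omega]
      · have hl := τ.length_run_le (O := tally o) i x k
        have hl' := τ.length_run_le (O := tally o) i x (k + 1)
        have hb' := hb (k + 1)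
        have hx := length_blocks_le hb'.u
        rw [τ.run_succ] at hb' hl' hx
        change Run _ _ ((τ.run (tally o) i x k).toStore (n - (k + 1))) _ _
        rw [τ.run_succ]
        refine interpret hτ _ (hb k) hb' ?_ ?_ ?_
        · nlinarith [Nat.zero_le ((x.length + n) * (N + 1))]
        · nlinarith [Nat.zero_le ((x.length + n + 1) * N)]
        · refine hx.trans (le_trans ?_ hM)
          gcongr
          omega)
    (by simp [Sweep.toStore, Store.reg])
  simpa using! this

end Run

theorem eq_zeros_or (w : Word) : (∃ a, w = zeros a) ∨ ∃ x a, w = x ++ true :: zeros a := by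
  induction w using List.reverseRecOn with
  | nil => exact .inl ⟨0, rfl⟩
  | append_singleton w b ih =>
    cases b
    · rcases ih with ⟨a, rfl⟩ | ⟨x, a, rfl⟩
      · exact .inl ⟨a + 1, List.replicate_succ'.symm⟩
      · exact .inr ⟨x, a + 1, by
          rw [List.append_assoc, List.cons_append, ← List.replicate_succ']⟩
    · exact .inr ⟨w, 0, rfl⟩

namespace Run

variable {τ : Table} {o : ℕ → Prop} {a κ : ℕ} {x d : Word} {s : Store} {T : ℕ}

/-- The first part of the universal program on well-formed input. -/
theorem universal_test (h : Run (tally o) (.test 9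
      (.clear .y ;; .eval 11 ;; .move .y .clk ;; .eval 10 ;; .assign ;; .load ;;
        .loop .clk .interpret .interpret ;; .test 0 .flush (.print d)) (.print d))
      { inp := x.reverse, z := zeros a, y := zeros κ } s T) :
    Run (tally o) (.universal κ d) { inp := (x ++ true :: zeros a).reverse } s
      (a * 6 + κ + 12 + T) := by
  have e : (x ++ true :: zeros a).reverse = zeros a ++ true :: x.reverse := by simp
  have h1 := pushes (O := tally o) (r := .y) (s := { inp := x.reverse, z := zeros a }) κ
  have e' : zeros κ ++ [] = zeros κ := List.append_nil _
  simp only [Store.set, Store.reg, e'] at h1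
  rw [e]
  exact (split_cons.seq (pop_nil rfl (h1.seq h))).mono (by omega)

/-- The main part of the universal program. -/
theorem universal_simulate (hτ : τ.Answers o) {i n : ℕ} (hi : ∀ y, o (pos 10 a y) ↔ y < i)
    (hn : ∀ y, o (pos 11 a y) ↔ y < n) (hna : n ≤ a)
    (hb : ∀ k, (τ.run (tally o) i x k).Bounded a)
    (h : Run (tally o) (.test 0 .flush (.print d)) ((τ.run (tally o) i x n).toStore 0) s T) :
    Run (tally o) (.clear .y ;; .eval 11 ;; .move .y .clk ;; .eval 10 ;; .assign ;; .load ;;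
        .loop .clk .interpret .interpret ;; .test 0 .flush (.print d))
      { inp := x.reverse, z := zeros a, y := zeros κ } s
      (κ * 3 + 1200 * (a + 1) ^ 3 + 9 * a + 5 * x.length + 12 +
        n * (10000 * ((x.length + n + 1) * (a + 1) + 1) ^ 3 + 2) + T) := by
  have hia : i ≤ a := (hb 0).z
  have h1 := clear (O := tally o) (r := .y) (s :=
    { inp := x.reverse, z := zeros a, y := zeros κ })
  have h2 := eval (o := o) (i := 11) (a := a) (F := n) (s :=
    { inp := x.reverse, z := zeros a }) rfl rfl rfl rfl rfl rfl hn
  have h3 := move (O := tally o) (r := .y) (r' := .clk) (s :=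
    { inp := x.reverse, z := zeros a, y := zeros n }) (by decide)
  have h4 := eval (o := o) (i := 10) (a := a) (F := i) (s :=
    { inp := x.reverse, z := zeros a, clk := zeros n }) rfl rfl rfl rfl rfl rfl hi
  have h5 := assign (O := tally o) (a := a) (b := i) (s :=
    { inp := x.reverse, z := zeros a, y := zeros i, clk := zeros n }) rfl rfl
  have h6 := load (O := tally o) (w := x.reverse) (l := []) (s :=
    { inp := x.reverse, z := zeros i, clk := zeros n }) rfl rfl
  have h7 := interpret_loop hτ hb (n := n) le_rfl
  simp only [Store.set, Store.reg, List.reverse_replicate, List.append_nil] at h1 h3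
  simp only [List.reverse_reverse, List.append_nil] at h6
  refine (h1.seq (h2.seq (h3.seq (h4.seq (h5.seq (h6.seq (h7.seq h))))))).mono ?_
  have := eval_time_le (a := a) (F := n) (M := a) (i := 11) (by omega) hna (by norm_num)
  have := eval_time_le (a := a) (F := i) (M := a) (i := 10) (by omega) hia (by norm_num)
  simp only [List.length_replicate, List.length_reverse]
  omega

end Run

theorem append_zeros_inj {x x' : Word} {a a' : ℕ}
    (h : x ++ true :: zeros a = x' ++ true :: zeros a') : x' = x ∧ a' = a := by
  have h' : zeros a ++ true :: x.reverse = zeros a' ++ true :: x'.reverse := by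
    simpa using congrArg List.reverse h
  clear h
  induction a generalizing a' with
  | zero =>
    cases a' with
    | zero => simpa [eq_comm] using h'
    | succ a' => simp [List.replicate_succ] at h'
  | succ a ih =>
    cases a' with
    | zero => simp [List.replicate_succ] at h'
    | succ a' =>
      have := ih (a' := a') (by simpa [List.replicate_succ] using h')
      simpa using this

/-- Universal simulation, with a fallback to the fixed output `d`. Query number 9 about `a` and `κ` releases the simulation of the sweeping
machine `start a` for `clock a` steps, and it may do so only if this takes few resources. -/
theorem exists_universal {τ : Table} {o : ℕ → Prop} (hτ : τ.Answers o) (start clock : ℕ → ℕ)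
    (hstart : ∀ a y, o (pos 10 a y) ↔ y < start a) (hclock : ∀ a y, o (pos 11 a y) ↔ y < clock a)
    (κ : ℕ) (hb : ∀ a, o (pos 9 a κ) → clock a ≤ a ∧
      ∀ x k, (τ.run (tally o) (start a) x k).Bounded a) (d : Word) :
    ∃ f : Word → Word, InFP (tally o) f ∧
      (∀ x a y, o (pos 9 a κ) → τ.Outputs (tally o) (start a) x (clock a) y →
        f (x ++ true :: zeros a) = y) ∧
      ∀ w, f w = d ∨ ∃ x a, o (pos 9 a κ) ∧ τ.Outputs (tally o) (start a) x (clock a) (f w) := by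
  set T : ℕ → ℕ := fun n => 1000000 * (n + κ + d.length + 10) ^ 7 with hT
  have key : ∀ w : Word, ∃ s : Store,
      (∀ x a y, w = x ++ true :: zeros a → o (pos 9 a κ) →
        τ.Outputs (tally o) (start a) x (clock a) y → s.output = y) ∧
      (s.output = d ∨
        ∃ x a, o (pos 9 a κ) ∧ τ.Outputs (tally o) (start a) x (clock a) s.output) ∧
      Run (tally o) (.universal κ d) { inp := w.reverse } s (T w.length) := by
    intro w
    rcases eq_zeros_or w with ⟨a, rfl⟩ | ⟨x, a, rfl⟩
    · refine ⟨{ z := zeros a, output := d }, ?_, .inl rfl, ?_⟩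
      · intro x a' y h
        have : true ∈ zeros a := by rw [h]; simp
        simp at this
      · have h := (Run.split_zeros (O := tally o) (a := a)).seq
          (Run.pop_cons (r := .res) (b := false) (w := []) (e := (Cmd.push .y false).rep κ ;; Cmd.test 9
            (.clear .y ;; .eval 11 ;; .move .y .clk ;; .eval 10 ;; .assign ;; .load ;;
              .loop .clk .interpret .interpret ;; .test 0 .flush (.print d)) (.print d))
            (c := .print d) (d := .print d) rfl (Run.print d))
        rw [List.reverse_replicate]
        refine h.mono ?_
        simp only [hT, List.length_replicate]
        have := Nat.le_self_pow (n := 7) (by norm_num) (a + κ + d.length + 10)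
        omega
    · set X := x.length + a + 1 + κ + d.length + 10 with hX
      have hT' : T (x ++ true :: zeros a).length = 1000000 * X ^ 7 := by
        simp only [hT, hX, List.length_append, List.length_cons, List.length_replicate]
        congr 2
      have hX1 : X ≤ X ^ 7 := Nat.le_self_pow (by norm_num) _
      have hX2 : (a + κ + 1) ^ 2 ≤ X ^ 7 :=
        (Nat.pow_le_pow_left (by omega) 2).trans (Nat.pow_le_pow_right (by omega) (by norm_num))
      rw [hT']
      by_cases ho : o (pos 9 a κ)
      · obtain ⟨hca, hba⟩ := hb a ho
        have hbx := hba x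
        have hX3 : (a + 1) ^ 3 ≤ X ^ 7 :=
          (Nat.pow_le_pow_left (by omega) 3).trans (Nat.pow_le_pow_right (by omega) (by norm_num))
        have hX4 : clock a * (10000 * ((x.length + clock a + 1) * (a + 1) + 1) ^ 3 + 2) ≤
            100000 * X ^ 7 := by
          have h1 : (x.length + clock a + 1) * (a + 1) + 1 ≤ 2 * X ^ 2 := by
            have : (x.length + clock a + 1) * (a + 1) ≤ (2 * X - 1) * X := by
              gcongr <;> omega
            have h2 : (2 * X - 1) * X = 2 * X ^ 2 - X := by
              rw [Nat.sub_mul]; ring_nf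
            have : X ≤ X ^ 2 := Nat.le_self_pow (by norm_num) _
            omega
          calc _ ≤ X * (10000 * (2 * X ^ 2) ^ 3 + 2) := by gcongr; omega
            _ = 80000 * X ^ 7 + 2 * X := by ring
            _ ≤ _ := by omega
        set c := τ.run (tally o) (start a) x (clock a) with hc
        have hz := (hbx (clock a)).z
        rw [← hc] at hz
        have hX5 : (c.z + 0 + 1) ^ 2 ≤ X ^ 7 :=
          (Nat.pow_le_pow_left (by omega) 2).trans (Nat.pow_le_pow_right (by omega) (by norm_num))
        have hout := (τ.length_run_le (O := tally o) (start a) x (clock a)).2.2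
        rw [← hc] at hout
        by_cases hh : τ.halt c.z
        · refine ⟨{ z := zeros c.z, u := blocks c.u, v := blocks c.v, ask := c.ask.reverse
                    output := c.out }, ?_, .inr ⟨x, a, ho, hh, rfl⟩, ?_⟩
          · intro x' a' y h _ hy
            obtain ⟨rfl, rfl⟩ := append_zeros_inj h
            exact hy.2
          · refine (Run.universal_test (Run.test_yes (a := a) (b := κ) rfl rfl rfl rfl rfl ho
              (Run.universal_simulate hτ (hstart a) (hclock a) hca hbx
                (Run.test_yes (a := c.z) (b := 0) rfl rfl rfl rfl rfl ((hτ.halt _).2 hh)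
                  (Run.flush (w := c.out) rfl rfl))))).mono ?_
            omega
        · refine ⟨{ c.toStore 0 with output := d }, ?_, .inl rfl, ?_⟩
          · intro x' a' y h _ hy
            obtain ⟨rfl, rfl⟩ := append_zeros_inj h
            exact absurd hy.1 hh
          · refine (Run.universal_test (Run.test_yes (a := a) (b := κ) rfl rfl rfl rfl rfl ho
              (Run.universal_simulate hτ (hstart a) (hclock a) hca hbx
                (Run.test_no (a := c.z) (b := 0) rfl rfl rfl rfl rfl (fun h => hh ((hτ.halt _).1 h))
                  (Run.print d))))).mono ?_
            omega
      · refine ⟨{ inp := x.reverse, z := zeros a, y := zeros κ, output := d }, ?_, .inl rfl, ?_⟩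
        · intro x' a' y h ho'
          obtain ⟨rfl, rfl⟩ := append_zeros_inj h
          exact absurd ho' ho
        · refine (Run.universal_test (Run.test_no (a := a) (b := κ) rfl rfl rfl rfl rfl ho
            (Run.print d))).mono ?_
          omega
  choose s h1 h2 h3 using key
  refine ⟨fun w => (s w).output, InFP.of_run (.universal κ d) T ?_ fun w => ⟨s w, rfl, h3 w⟩,
    fun x a y ho hy => h1 _ x a y rfl ho hy, h2⟩
  exact (PolyBounded.const _).mul
    (((PolyBounded.id.add (.const _)).add (.const _)).add (.const _) |>.pow 7)

/-! ### Padding, constant functions and a search program -/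

namespace Cmd

/-- Multiply the number in `y` by the number in `z`. -/
def mul : Cmd := loop .y (each .z (push .p false)) skip ;; move .p .y

/-- On input `x`, write `x 1 0ᵃ` with `a = A + (|x| + C) ^ C * B`. -/
def pad (A B C : ℕ) : Cmd :=
  loop .inp (push .u false ;; push .z false) (push .u true ;; push .z false) ;;
  loop .u (out false) (out true) ;; out true ;;
  (out false).rep A ;; (push .z false).rep C ;; push .y false ;; mul.rep C ;;
  loop .y ((out false).rep B) skip

/-- On input `0ⁿ`, search the least `m` such that the query number 12 about `n` and `A + m * B` has a
positive answer, and mark `res` if the query number 13 about these numbers has a positive answer,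
too. -/
def search (A B : ℕ) : Cmd :=
  loop .inp (push .z false) (push .ask false) ;; pop .ask
    ((push .y false).rep A ;; push .g false ;;
      loop .g (test 12 (test 13 (push .res false) skip)
        ((push .y false).rep B ;; push .g false)) skip)
    skip skip

end Cmd

namespace Run

variable {O : Set Word} {o : ℕ → Prop} {s : Store}

theorem mul {k m : ℕ} (hz : s.z = zeros m) (hy : s.y = zeros k) (hp : s.p = []) (hq : s.q = []) :
    Run O .mul s { s with y := zeros (k * m) } (k * (m * 10 + 6) + 4) := by
  rcases s with ⟨inp, z, y, p, q, g, u, v, ask, out, clk, res, ot, output⟩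
  dsimp only at hz hy hp hq ⊢
  subst hz hy hp hq
  have h1 := loop (O := O) (r := .y) (c := .each .z (.push .p false)) (d := .skip) (T := m * 7 + 4)
    (fun j => ⟨inp, zeros m, zeros (k - j), zeros (j * m), [], g, u, v, ask, out, clk, res, ot,
      output⟩) k
    (fun j hj => by
      refine ⟨false, zeros (k - (j + 1)), ?_, ?_⟩
      · change zeros (k - j) = _
        rw [← List.replicate_succ, show k - (j + 1) + 1 = k - j by omega]
      · have := each_push (O := O) .z (by decide) (by decide) (a := m)
          (s := ⟨inp, zeros m, zeros (k - (j + 1)), zeros (j * m), [], g, u, v, ask, out, clk, res,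
            ot, output⟩) rfl rfl
        rw [zeros_append, show m + j * m = (j + 1) * m by ring] at this
        exact this)
    (by simp [Store.reg])
  have h2 := move (O := O) (r := .p) (r' := .y) (by decide)
    (s := ⟨inp, zeros m, [], zeros (k * m), [], g, u, v, ask, out, clk, res, ot, output⟩)
  simp only [Store.set, Store.reg, List.reverse_replicate, List.append_nil,
    List.length_replicate] at h2
  simp only [Nat.sub_zero, Nat.zero_mul, Nat.sub_self, List.replicate_zero] at h1
  exact (h1.seq h2).mono (by ring_nf; omega)

/-- The first loop of `Cmd.pad` copies the input to `u` and its length to `z`. -/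
theorem copyInput (w : Word) : ∀ s : Store, s.inp = w →
    Run O (.loop .inp (.push .u false ;; .push .z false) (.push .u true ;; .push .z false)) s
      { s with inp := [], u := w.reverse ++ s.u, z := zeros w.length ++ s.z }
      (w.length * 4 + 2) := by
  induction w with
  | nil =>
    rintro ⟨inp, z, y, p, q, g, u, v, ask, out, clk, res, ot, output⟩ rfl
    exact ⟨2, by simp, .loop_nil rfl⟩
  | cons b w ih =>
    rintro ⟨inp, z, y, p, q, g, u, v, ask, out, clk, res, ot, output⟩ rfl
    obtain ⟨t, ht, hx⟩ := ih ⟨w, false :: z, y, p, q, g, b :: u, v, ask, out, clk, res, ot, output⟩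
      rfl
    dsimp only at hx
    have e1 : (b :: w).reverse ++ u = w.reverse ++ b :: u := by simp
    have e2 : zeros (b :: w).length ++ z = zeros w.length ++ false :: z := by
      rw [List.length_cons, show zeros (w.length + 1) = zeros w.length ++ [false] from
        List.replicate_succ', List.append_assoc]
      rfl
    rw [e1, e2]
    refine ⟨2 + (1 + 1) + t, by simp; omega, ?_⟩
    cases b
    · exact .loop_false rfl ((Exec.push _ _ _).seq (.push _ _ _)) hx
    · exact .loop_true rfl ((Exec.push _ _ _).seq (.push _ _ _)) hx

theorem pad_time_le {A B C n m P W X : ℕ} (hW : 1 ≤ W) (hn : n ≤ X) (hm : m ≤ X) (hX : 1 ≤ X)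
    (hP : P ≤ W) :
    n * 4 + 2 + (n * 3 + 2 + (1 + (A + 1 + (C + 1 + (1 + (C * (W * (m * 10 + 6) + 4) + 1 +
      (P * (B + 1 + 2) + 2))))))) ≤ 100 * (A + B + C + 1) * (W * X * X) := by
  have h1 : W ≤ W * X := Nat.le_mul_of_pos_right _ hX
  have h2 : W * X ≤ W * X * X := Nat.le_mul_of_pos_right _ hX
  have h3 : X ≤ W * X := Nat.le_mul_of_pos_left _ hW
  have h4 : W * (m * 10 + 6) + 4 ≤ 20 * (W * X * X) := by
    have : W * m ≤ W * X := Nat.mul_le_mul_left _ hm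
    nlinarith
  set Z := W * X * X with hZ
  have h5 : C * (W * (m * 10 + 6) + 4) ≤ C * (20 * Z) := Nat.mul_le_mul_left _ h4
  have h6 : P * (B + 1 + 2) ≤ Z * (B + 1 + 2) := Nat.mul_le_mul_right _ (by omega)
  have h7 : A ≤ A * Z := Nat.le_mul_of_pos_right _ (by omega)
  have h8 : C ≤ C * Z := Nat.le_mul_of_pos_right _ (by omega)
  have h9 : 1 ≤ Z := by omega
  have h10 : 100 * (A + B + C + 1) * Z = 100 * (A * Z) + 100 * (B * Z) + 100 * (C * Z) + 100 * Z := by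
    ring
  have h11 : C * (20 * Z) = 20 * (C * Z) := by ring
  have h12 : Z * (B + 1 + 2) = B * Z + 3 * Z := by ring
  omega

theorem pad (A B C : ℕ) (x : Word) :
    Run O (.pad A B C) { inp := x.reverse }
      { z := zeros (x.length + C), output := x ++ true :: zeros (A + (x.length + C) ^ C * B) }
      (100 * (A + B + C + 1) * (x.length + C + 1) ^ (C + 2)) := by
  set n := x.length
  have h1 := copyInput (O := O) x.reverse { inp := x.reverse } rfl
  have h2 := outputs (O := O) .u x { u := x, z := zeros n } rfl
  have h3 := out (O := O) (s := { z := zeros n, output := x }) true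
  have h4 := outs (O := O) (s := { z := zeros n, output := x ++ [true] }) A
  have h5 := pushes (O := O) (r := .z)
    (s := { z := zeros n, output := x ++ [true] ++ zeros A }) C
  have h6 := push (O := O) (r := .y)
    (s := { z := zeros (n + C), output := x ++ [true] ++ zeros A }) false
  have hpow : ∀ k ≤ C, (n + C) ^ k ≤ (n + C + 1) ^ C := fun k hk =>
    (Nat.pow_le_pow_left (by omega) k).trans (Nat.pow_le_pow_right (by omega) hk)
  have h7 := rep (O := O) (c := .mul) (T := (n + C + 1) ^ C * ((n + C) * 10 + 6) + 4) (fun k =>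
    { z := zeros (n + C), y := zeros ((n + C) ^ k), output := x ++ [true] ++ zeros A }) C
    (fun k hk => by
      refine (mul (m := n + C) (k := (n + C) ^ k) rfl rfl rfl rfl).mono ?_
      have := hpow k hk.le
      gcongr)
  have h8 := loop (O := O) (r := .y) (c := (Cmd.out false).rep B) (d := .skip) (T := B + 1)
    (fun k => { z := zeros (n + C), y := zeros ((n + C) ^ C - k)
                output := x ++ [true] ++ zeros A ++ zeros (k * B) }) ((n + C) ^ C)
    (fun k hk => by
      refine ⟨false, zeros ((n + C) ^ C - (k + 1)), ?_, ?_⟩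
      · change zeros ((n + C) ^ C - k) = _
        rw [← List.replicate_succ, show (n + C) ^ C - (k + 1) + 1 = (n + C) ^ C - k by omega]
      · have := outs (O := O) (s := { z := zeros (n + C), y := zeros ((n + C) ^ C - (k + 1))
                                      output := x ++ [true] ++ zeros A ++ zeros (k * B) }) B
        rw [List.append_assoc _ (zeros (k * B)), zeros_append, ← Nat.succ_mul] at this
        exact this)
    (by simp [Store.reg])
  simp only [List.reverse_reverse, List.append_nil] at h1
  rw [List.length_reverse] at h1
  simp only [Store.set, Store.reg, zeros_append, Nat.add_comm C n] at h5
  simp only [Nat.sub_zero, Nat.zero_mul, Nat.sub_self,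
    List.replicate_zero, List.append_nil, pow_zero] at h7 h8
  have e : x ++ true :: zeros (A + (n + C) ^ C * B) =
      x ++ [true] ++ zeros A ++ zeros ((n + C) ^ C * B) := by
    rw [← zeros_append]; simp
  rw [e]
  refine (h1.seq (h2.seq (h3.seq (h4.seq (h5.seq (h6.seq (h7.seq h8))))))).mono ?_
  rw [show (n + C + 1) ^ (C + 2) = (n + C + 1) ^ C * (n + C + 1) * (n + C + 1) by ring]
  exact pad_time_le (Nat.one_le_pow _ _ (by omega)) (by omega) (by omega) (by omega)
    (hpow C le_rfl)

/-- The first loop of `Cmd.search` counts the zeros of the input in `z`, and `ask` remains empty if and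
only if there are no other letters. -/
theorem searchInput (w : Word) : ∀ s : Store, s.inp = w →
    ∃ k b, Run O (.loop .inp (.push .z false) (.push .ask false)) s
      { s with inp := [], z := zeros k ++ s.z, ask := zeros b ++ s.ask } (w.length * 3 + 2) ∧
      (w = zeros k ∧ b = 0 ∨ b ≠ 0 ∧ ∀ k, w ≠ zeros k) := by
  induction w with
  | nil =>
    rintro ⟨inp, z, y, p, q, g, u, v, ask, out, clk, res, ot, output⟩ rfl
    exact ⟨0, 0, ⟨2, by simp, .loop_nil rfl⟩, .inl ⟨rfl, rfl⟩⟩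
  | cons a w ih =>
    rintro ⟨inp, z, y, p, q, g, u, v, ask, out, clk, res, ot, output⟩ rfl
    have shift : ∀ k (l : Word), zeros k ++ false :: l = zeros (k + 1) ++ l := fun k l => by
      rw [show zeros (k + 1) = zeros k ++ [false] from List.replicate_succ', List.append_assoc]
      rfl
    cases a
    · obtain ⟨k, b, ⟨t, ht, hx⟩, h⟩ :=
        ih ⟨w, false :: z, y, p, q, g, u, v, ask, out, clk, res, ot, output⟩ rfl
      dsimp only at hx
      rw [shift] at hx
      refine ⟨k + 1, b, ⟨2 + 1 + t, by simp; omega, .loop_false rfl (.push _ _ _) hx⟩, ?_⟩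
      rcases h with ⟨rfl, rfl⟩ | ⟨hb, h⟩
      · exact .inl ⟨rfl, rfl⟩
      · refine .inr ⟨hb, fun j hj => ?_⟩
        cases j with
        | zero => cases hj
        | succ j => exact h j (List.cons.inj hj).2
    · obtain ⟨k, b, ⟨t, ht, hx⟩, h⟩ :=
        ih ⟨w, z, y, p, q, g, u, v, false :: ask, out, clk, res, ot, output⟩ rfl
      dsimp only at hx
      rw [shift] at hx
      refine ⟨k, b + 1, ⟨2 + 1 + t, by simp; omega, .loop_true rfl (.push _ _ _) hx⟩, ?_⟩
      refine .inr ⟨by omega, fun j hj => ?_⟩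
      cases j with
      | zero => cases hj
      | succ j => cases (List.cons.inj hj).1

/-- The loop of `Cmd.search` stops at `m = V + 1`, with `res` marked according to the answer there. -/
theorem search_loop {A B n V : ℕ} (h12 : ∀ m, o (pos 12 n (A + m * B)) ↔ V < m) :
    ∃ r T, (r ≠ [] ↔ o (pos 13 n (A + (V + 1) * B))) ∧
      Run (tally o) (.loop .g (.test 12 (.test 13 (.push .res false) .skip)
          ((Cmd.push .y false).rep B ;; .push .g false)) .skip)
        { z := zeros n, y := zeros A, g := [false] }
        { z := zeros n, y := zeros (A + (V + 1) * B), res := r } T := by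
  obtain ⟨r, hr, hrun⟩ : ∃ r : Word, (r ≠ [] ↔ o (pos 13 n (A + (V + 1) * B))) ∧
      Run (tally o) (.test 13 (.push .res false) .skip)
        { z := zeros n, y := zeros (A + (V + 1) * B) }
        { z := zeros n, y := zeros (A + (V + 1) * B), res := r }
        (60 * (n + (A + (V + 1) * B) + 1) ^ 2 + 13 + 1 + 1) := by
    by_cases ho : o (pos 13 n (A + (V + 1) * B))
    · exact ⟨[false], by simp [ho], test_yes rfl rfl rfl rfl rfl ho (push false)⟩
    · exact ⟨[], by simp [ho], test_no rfl rfl rfl rfl rfl ho skip⟩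
  have := loop (O := tally o) (r := .g) (d := .skip)
    (T := 120 * (n + (A + (V + 1) * B) + 1) ^ 2 + B + 40)
    (c := .test 12 (.test 13 (.push .res false) .skip)
      ((Cmd.push .y false).rep B ;; .push .g false))
    (fun m => if m ≤ V + 1 then { z := zeros n, y := zeros (A + m * B), g := [false] }
      else { z := zeros n, y := zeros (A + (V + 1) * B), res := r })
    (V + 2) (fun m hm => by
      have hm' : m ≤ V + 1 := by omega
      refine ⟨false, [], by rw [if_pos hm']; rfl, ?_⟩
      rw [if_pos hm']
      rcases hm'.lt_or_eq with hlt | rfl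
      · rw [if_pos (by omega)]
        have hp := pushes (O := tally o) (r := .y) (s := { z := zeros n, y := zeros (A + m * B) }) B
        simp only [Store.reg, Store.set, zeros_append] at hp
        rw [show B + (A + m * B) = A + (m + 1) * B by ring] at hp
        refine (test_no (a := n) (b := A + m * B) rfl rfl rfl rfl rfl
          (fun h => by have := (h12 m).1 h; omega) (hp.seq (push false))).mono ?_
        have : (n + (A + m * B) + 1) ^ 2 ≤ (n + (A + (V + 1) * B) + 1) ^ 2 := by gcongr
        omega
      · rw [if_neg (by omega)]
        refine (test_yes (a := n) (b := A + (V + 1) * B) rfl rfl rfl rfl rfl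
          ((h12 _).2 (Nat.lt_succ_self V)) hrun).mono ?_
        omega)
    (by rw [if_neg (by omega)]; rfl)
  rw [if_pos (Nat.zero_le _), if_neg (by omega)] at this
  exact ⟨r, _, hr, by simpa using this⟩

end Run

theorem InFP.const (O : Set Word) (d : Word) : InFP O fun _ => d :=
  .of_run (.print d) (fun _ => d.length + 1) (.const _) fun _ => ⟨_, rfl, Run.print d⟩

theorem InFP.pad (O : Set Word) (A B C : ℕ) :
    InFP O fun x => x ++ true :: zeros (A + (x.length + C) ^ C * B) :=
  .of_run (.pad A B C) (fun n => 100 * (A + B + C + 1) * (n + C + 1) ^ (C + 2))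
    ((PolyBounded.const _).mul (((PolyBounded.id.add (.const C)).add (.const 1)).pow _))
    fun x => ⟨_, rfl, Run.pad A B C x⟩

/-- A tally set is decidable relative to an oracle that lists it sufficiently far out: the membership
of `0ⁿ` may be asked about with every parameter `m > V n`, and the oracle knows whether `m > V n`. -/
theorem DecidableIn.of_listed {o : ℕ → Prop} {A B : ℕ} {V : ℕ → ℕ} {P : ℕ → Prop}
    (h12 : ∀ n m, o (pos 12 n (A + m * B)) ↔ V n < m)
    (h13 : ∀ n m, V n < m → (o (pos 13 n (A + m * B)) ↔ P n)) :
    DecidableIn (tally o) (tally P) := by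
  refine .of_run (.search A B) fun x => ?_
  obtain ⟨k, b, hrun, h⟩ := Run.searchInput (O := tally o) x.reverse { inp := x.reverse } rfl
  rcases h with ⟨hx, rfl⟩ | ⟨hb, hx⟩
  · have hx' : x = zeros k := by simpa using congrArg List.reverse hx
    obtain ⟨r, T, hr, hloop⟩ := Run.search_loop (h12 k)
    refine ⟨_, _, ?_, hrun.seq (Run.pop_nil rfl ((Run.pushes A).seq ((Run.push false).seq
      (?_ : Run _ _ _ { z := zeros k, y := zeros (A + (V k + 1) * B), res := r } T))))⟩
    · rw [hx', zeros_mem_tally, ← h13 k _ (Nat.lt_succ_self _)]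
      exact hr
    · simpa [Store.set, Store.reg] using! hloop
  · obtain ⟨b, rfl⟩ : ∃ b', b = b' + 1 := ⟨b - 1, by omega⟩
    refine ⟨{ z := zeros k, ask := zeros b }, _, ?_, hrun.seq (Run.pop_cons (b := false)
      (w := zeros b) ?_ ?_ (T := 1))⟩
    · simp only [ne_eq, not_true_eq_false, false_iff]
      rintro ⟨j, rfl, -⟩
      exact hx j (by simp)
    · simp [Store.reg, List.replicate_succ]
    · simpa [Store.set] using! Run.skip

/-! ### An enumeration of the oracle machines -/

instance : Finite Move :=
  Finite.of_injective (fun | .left => (0 : Fin 3) | .stay => 1 | .right => 2)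
    (by rintro (_ | _ | _) (_ | _ | _) h <;> first | rfl | (simp at h))

instance {Q ι : Type} [Finite Q] [Finite ι] : Finite (Instr Q ι) := by
  let f : Instr Q ι →
      (Q × (ι → Option Bool) × (ι → Move) × Option Bool × Option Bool) ⊕ ((Q × Q) ⊕ Bool) := fun
    | .act q w m a b => .inl (q, w, m, a, b)
    | .query y n => .inr (.inl (y, n))
    | .halt a => .inr (.inr a)
  refine Finite.of_injective f ?_
  rintro (_ | _ | _) (_ | _ | _) h <;> simp_all [f]

/-- Machines whose states and tapes are numbered. -/
abbrev StdOTM : Type :=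
  Σ n k : ℕ, Fin n × Fin k × (Fin n → (Fin k → Option Bool) → Instr (Fin n) (Fin k))

/-- The machine given by its numbered states and tapes. -/
abbrev StdOTM.toOTM (N : StdOTM) : OTM where
  State := Fin N.1
  TapeIdx := Fin N.2.1
  start := N.2.2.1
  inputTape := N.2.2.2.1
  program := N.2.2.2.2

instance : Nonempty StdOTM := ⟨⟨1, 1, 0, 0, fun _ _ => .halt true⟩⟩

/-- An enumeration of the machines, up to the names of states and tapes. -/
noncomputable def mach (i : ℕ) : OTM := ((exists_surjective_nat StdOTM).choose i).toOTM

/-- Two machines have the same computations, as far as verdicts, outputs and oracle tapes are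
concerned. -/
structure OTM.Similar (M N : OTM) : Prop where
  verdict : ∀ O x n, M.verdict (M.run O x n) = N.verdict (N.run O x n)
  output : ∀ O x n, (M.run O x n).output = (N.run O x n).output
  oracleTape : ∀ O x n, (M.run O x n).oracleTape = (N.run O x n).oracleTape

/-- Rename the states and tapes in an instruction. -/
def Instr.rename {Q Q' ι ι' : Type} (e : Q → Q') (e' : ι' → ι) : Instr Q ι → Instr Q' ι'
  | .act q w m a b => .act (e q) (w ∘ e') (m ∘ e') a b
  | .query y n => .query (e y) (e n)
  | .halt a => .halt a

theorem OTM.exists_similar (M : OTM) : ∃ i, M.Similar (mach i) := by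
  let e := Fintype.equivFin M.State
  let e' := Fintype.equivFin M.TapeIdx
  let N : StdOTM := ⟨_, _, e M.start, e' M.inputTape, fun q h =>
    (M.program (e.symm q) (h ∘ e')).rename e e'.symm⟩
  obtain ⟨i, hi⟩ := (exists_surjective_nat StdOTM).choose_spec N
  refine ⟨i, ?_⟩
  have hN : mach i = N.toOTM := by rw [mach, hi]
  rw [hN]
  let φ : M.Config → N.toOTM.Config := fun c =>
    ⟨e c.state, c.tapes ∘ e'.symm, c.oracleTape, c.output⟩
  have hinstr : ∀ c, N.toOTM.instr (φ c) = (M.instr c).rename e e'.symm := by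
    intro c
    change (M.program (e.symm (e c.state)) _).rename e e'.symm = _
    rw [Equiv.symm_apply_apply, OTM.instr]
    congr 2
    funext i
    simp [φ]
  have hstep : ∀ O c, N.toOTM.step O (φ c) = φ (M.step O c) := by
    intro O c
    unfold OTM.step
    rw [hinstr]
    rcases M.instr c with ⟨q, w, m, a, b⟩ | ⟨y, n⟩ | a
    · rfl
    · simp only [Instr.rename, φ]
      congr 1
      split_ifs <;> rfl
    · rfl
  have hrun : ∀ O x n, N.toOTM.run O x n = φ (M.run O x n) := by
    intro O x n
    induction n with
    | zero =>
      change N.toOTM.init x = φ (M.init x)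
      simp only [OTM.init, φ]
      congr 1
      funext i
      simp [N, Equiv.symm_apply_eq]
    | succ n ih => rw [OTM.run_succ, ih, hstep, OTM.run_succ]
  refine ⟨fun O x n => ?_, fun O x n => ?_, fun O x n => ?_⟩
  · rw [hrun, OTM.verdict, OTM.verdict, hinstr]
    rcases M.instr (M.run O x n) with ⟨q, w, m, a, b⟩ | ⟨y, n⟩ | a <;> rfl
  · rw [hrun]
  · rw [hrun]

namespace OTM.Similar

variable {M N : OTM} {O L : Set Word} {x y : Word} {n : ℕ}

theorem outputsWithin (h : M.Similar N) : M.OutputsWithin O x n y ↔ N.OutputsWithin O x n y := by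
  rw [OTM.OutputsWithin, OTM.OutputsWithin, h.verdict, h.output]

theorem decidesWithin (h : M.Similar N) : M.DecidesWithin O L x n ↔ N.DecidesWithin O L x n := by
  rw [OTM.DecidesWithin, OTM.DecidesWithin, h.verdict]

end OTM.Similar

/-! ### Simulation of oracle machines by sweeping machines -/

namespace Fold

/-- The opposite direction. -/
def flip : Move → Move
  | .left => .right
  | .stay => .stay
  | .right => .left

/-- A tape is folded at its head: a cell holds the symbols at the same distance to the left and to
the right of the head. In a sweep along the cells with a symbol `h` in hand, the left or the right
halves are shifted by one cell; this is the new contents of the cell visited. -/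
def cell : Move → Option Bool → Option Bool × Option Bool → Option Bool × Option Bool
  | .right, h, c => (h, c.2)
  | .left, h, c => (c.1, h)
  | .stay, _, c => c

/-- The symbol in hand after visiting a cell. -/
def held : Move → Option Bool → Option Bool × Option Bool → Option Bool
  | .right, _, c => c.1
  | .left, _, c => c.2
  | .stay, h, _ => h

/-- The new contents of all cells visited in a sweep, and the symbol in hand at its end. -/
def pass (m : Move) : Option Bool → List (Option Bool × Option Bool) →
    List (Option Bool × Option Bool) × Option Bool
  | h, [] => ([], h)
  | h, c :: A => (cell m h c :: (pass m (held m h c) A).1, (pass m (held m h c) A).2)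

theorem pass_append (m : Move) (h : Option Bool) (A B : List (Option Bool × Option Bool)) :
    pass m h (A ++ B) = ((pass m h A).1 ++ (pass m (pass m h A).2 B).1,
      (pass m (pass m h A).2 B).2) := by
  induction A generalizing h with
  | nil => rfl
  | cons c A ih => simp [pass, ih]

/-- A move of the head: the symbols on the side that the head leaves are shifted in a sweep away from
the head, and then those on the other side are shifted in a sweep back. -/
def shift (m : Move) (w : Option Bool) (A : List (Option Bool × Option Bool)) :
    List (Option Bool × Option Bool) × Option Bool :=
  let B := pass m w (A ++ [(none, none)])
  let C := pass (flip m) B.2 B.1.reverse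
  (C.1.reverse, C.2)

/-- Away from the head, the left halves move by one cell, and the right halves stay, up to a blank. -/
theorem pass_right (h : Option Bool) (A : List (Option Bool × Option Bool)) :
    (pass .right h (A ++ [(none, none)])).1.map Prod.fst = h :: A.map Prod.fst ∧
    (pass .right h (A ++ [(none, none)])).1.map Prod.snd = A.map Prod.snd ++ [none] ∧
    (pass .right h (A ++ [(none, none)])).2 = none := by
  induction A generalizing h with
  | nil => simp [pass, cell, held]
  | cons c A ih => simpa [pass, cell, held] using ih c.1

theorem pass_left (h : Option Bool) (A : List (Option Bool × Option Bool)) :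
    (pass .left h (A ++ [(none, none)])).1.map Prod.snd = h :: A.map Prod.snd ∧
    (pass .left h (A ++ [(none, none)])).1.map Prod.fst = A.map Prod.fst ++ [none] ∧
    (pass .left h (A ++ [(none, none)])).2 = none := by
  induction A generalizing h with
  | nil => simp [pass, cell, held]
  | cons c A ih => simpa [pass, cell, held] using ih c.2

theorem pass_stay (h : Option Bool) (A : List (Option Bool × Option Bool)) :
    pass .stay h A = (A, h) := by
  induction A with
  | nil => rfl
  | cons c A ih => simp [pass, cell, held, ih]

/-- On the way back, the right halves move by one cell towards the head. -/
theorem pass_left_reverse (h : Option Bool) (A : List (Option Bool × Option Bool)) :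
    (pass .left h A.reverse).1.reverse.map Prod.fst = A.map Prod.fst ∧
    (pass .left h A.reverse).2 :: (pass .left h A.reverse).1.reverse.map Prod.snd =
      A.map Prod.snd ++ [h] := by
  induction A with
  | nil => simp [pass]
  | cons c A ih =>
    rw [List.reverse_cons, pass_append]
    refine ⟨by simpa [pass, cell, held] using ih.1, ?_⟩
    simpa [pass, cell, held] using ih.2

theorem pass_right_reverse (h : Option Bool) (A : List (Option Bool × Option Bool)) :
    (pass .right h A.reverse).1.reverse.map Prod.snd = A.map Prod.snd ∧
    (pass .right h A.reverse).2 :: (pass .right h A.reverse).1.reverse.map Prod.fst =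
      A.map Prod.fst ++ [h] := by
  induction A with
  | nil => simp [pass]
  | cons c A ih =>
    rw [List.reverse_cons, pass_append]
    refine ⟨by simpa [pass, cell, held] using ih.1, ?_⟩
    simpa [pass, cell, held] using ih.2

/-- A tape is represented by the scanned symbol and the list of its folded cells, up to blanks. -/
structure Represents (T : Tape) (h : Option Bool) (A : List (Option Bool × Option Bool)) :
    Prop where
  head : T.head = h
  left : ∀ p, T.left.getD p none = (A.map Prod.fst).getD p none
  right : ∀ p, T.right.getD p none = (A.map Prod.snd).getD p none

theorem getD_append_none (l : List (Option Bool)) (p : ℕ) :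
    (l ++ [none]).getD p none = l.getD p none := by
  simp only [List.getD_eq_getElem?_getD, List.getElem?_append]
  split_ifs with h
  · rfl
  · rw [List.getElem?_eq_none (by omega : l.length ≤ p)]
    cases (p - l.length) <;> simp

theorem Represents.shift {T : Tape} {h : Option Bool} {A : List (Option Bool × Option Bool)}
    (hT : Represents T h A) (w : Option Bool) (m : Move) :
    Represents ((T.write w).move m) (shift m w A).2 (shift m w A).1 := by
  rcases T with ⟨l, a, r⟩
  obtain ⟨-, hl, hr⟩ := hT
  dsimp only at hl hr
  cases m with
  | stay =>
    simp only [Fold.shift, pass_stay, flip, List.reverse_reverse, Tape.move_stay, Tape.write]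
    refine ⟨rfl, fun p => ?_, fun p => ?_⟩
    · rw [List.map_append]; simpa using (hl p).trans (getD_append_none _ p).symm
    · rw [List.map_append]; simpa using (hr p).trans (getD_append_none _ p).symm
  | right =>
    obtain ⟨h1, h2, h3⟩ := pass_right w A
    obtain ⟨h4, h5⟩ := pass_left_reverse (pass .right w (A ++ [(none, none)])).2
      (pass .right w (A ++ [(none, none)])).1
    rw [h1] at h4
    rw [h2, h3] at h5
    have h6 : ∀ p, ((Fold.shift .right w A).2 :: (Fold.shift .right w A).1.map Prod.snd).getD p none =
        r.getD p none := by
      intro p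
      simp only [Fold.shift, flip]
      rw [h3, h5, getD_append_none, getD_append_none, hr]
    have h7 : ∀ p, (w :: l).getD p none = ((Fold.shift .right w A).1.map Prod.fst).getD p none := by
      intro p
      simp only [Fold.shift, flip]
      rw [h4]
      cases p with
      | zero => rfl
      | succ p => simpa using hl p
    cases r <;> cases l <;> exact ⟨(h6 0).symm, h7, fun p => (h6 (p + 1)).symm⟩
  | left =>
    obtain ⟨h1, h2, h3⟩ := pass_left w A
    obtain ⟨h4, h5⟩ := pass_right_reverse (pass .left w (A ++ [(none, none)])).2
      (pass .left w (A ++ [(none, none)])).1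
    rw [h1] at h4
    rw [h2, h3] at h5
    have h6 : ∀ p, ((Fold.shift .left w A).2 :: (Fold.shift .left w A).1.map Prod.fst).getD p none =
        l.getD p none := by
      intro p
      simp only [Fold.shift, flip]
      rw [h3, h5, getD_append_none, getD_append_none, hl]
    have h7 : ∀ p, (w :: r).getD p none = ((Fold.shift .left w A).1.map Prod.snd).getD p none := by
      intro p
      simp only [Fold.shift, flip]
      rw [h4]
      cases p with
      | zero => rfl
      | succ p => simpa using hr p
    cases l <;> exact ⟨(h6 0).symm, fun p => (h6 (p + 1)).symm, h7⟩

end Fold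

/-- A column: for each tape, the symbols at a certain distance to the left and to the right of the
head. -/
abbrev Col (M : OTM) : Type := M.TapeIdx → Option Bool × Option Bool

/-- The control states of the sweeping machine that simulates `M`. In the state `.inl (q, h)`, the
machine `M` is in state `q` and scans the symbols `h`. In the state `.inr (b, q, m, h)`, the tapes
are being shifted according to `m` with the symbols `h` in hand, `b` tells if the sweep goes back
towards the heads, and `q` is the next state of `M`. -/
abbrev Ctl (M : OTM) : Type :=
  (M.State × (M.TapeIdx → Option Bool)) ⊕
    (Bool × M.State × (M.TapeIdx → Move) × (M.TapeIdx → Option Bool))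

namespace Ctl

variable {M : OTM}

/-- The instruction of `M` that is due. -/
def instr : Ctl M → Option (Instr M.State M.TapeIdx)
  | .inl (q, h) => some (M.program q h)
  | .inr _ => none

/-- The computation is finished. -/
def IsHalt (s : Ctl M) : Prop := ∃ a, s.instr = some (.halt a)

/-- The oracle is to be asked. -/
def IsQuery (s : Ctl M) : Prop := ∃ y n, s.instr = some (.query y n)

/-- The letter for the oracle tape. -/
def ask (s : Ctl M) : Option Bool :=
  match s.instr with
  | some (.act _ _ _ a _) => a
  | _ => none

/-- The letter for the output tape. -/
def out (s : Ctl M) : Option Bool :=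
  match s.instr with
  | some (.act _ _ _ _ b) => b
  | _ => none

/-- The next state in a sweep. -/
def sweepNext (b : Bool) (q : M.State) (m : M.TapeIdx → Move) (h : M.TapeIdx → Option Bool) :
    Option (Col M) → Ctl M
  | some c => .inr (b, q, m, fun t => Fold.held (m t) (h t) (c t))
  | none => bif b then .inl (q, h)
      else .inr (true, q, fun t => Fold.flip (m t), fun t => Fold.held (m t) (h t) (none, none))

/-- The column written in a sweep. -/
def sweepPush (b : Bool) (m : M.TapeIdx → Move) (h : M.TapeIdx → Option Bool) :
    Option (Col M) → Option (Col M)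
  | some c => some fun t => Fold.cell (m t) (h t) (c t)
  | none => bif b then none else some fun t => Fold.cell (m t) (h t) (none, none)

/-- The next state, given the column read. -/
def next : Ctl M → Option (Col M) → Ctl M
  | .inl (q, h), c =>
    match M.program q h with
    | .act n w m _ _ => sweepNext false n m w c
    | .query _ n => .inl (n, h)
    | .halt _ => .inl (q, h)
  | .inr (b, q, m, h), c => sweepNext b q m h c

/-- The next state after a positive answer of the oracle. -/
def nextYes : Ctl M → Ctl M
  | .inl (q, h) =>
    match M.program q h with
    | .query y _ => .inl (y, h)
    | _ => .inl (q, h)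
  | s => s

/-- The column written, given the column read. -/
def push : Ctl M → Option (Col M) → Option (Col M)
  | .inl (q, h), c =>
    match M.program q h with
    | .act _ w m _ _ => sweepPush false m w c
    | _ => none
  | .inr (b, _, m, h), c => sweepPush b m h c

/-- The initial state: the input is to the right of the head, which has yet to move to its first
letter. -/
def start (M : OTM) : Ctl M :=
  .inr (false, M.start, fun t => if t = M.inputTape then .right else .stay, fun _ => none)

end Ctl

/-! ### Numbering the control states and columns -/

noncomputable instance instFintypeMachState (i : ℕ) : Fintype (mach i).State := (mach i).finState

/-- A control state of one of the simulating machines. -/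
abbrev SigmaCtl : Type := Σ i, Ctl (mach i)

noncomputable instance : Encodable SigmaCtl := Encodable.ofCountable _

/-- The number of columns of a machine. -/
noncomputable def colCard (i : ℕ) : ℕ := Nat.card (Col (mach i))

/-- The number of a column. The numbers 0, 1 and 2 are reserved. -/
noncomputable def colCode (i : ℕ) (c : Col (mach i)) : ℕ := Finite.equivFin (Col (mach i)) c + 3

/-- The column with a letter of the input. -/
def inputCol (M : OTM) (b : Bool) : Col M :=
  fun t => if t = M.inputTape then (none, some b) else (none, none)

/-- The column with a given number; 1 and 2 stand for the letters of the input, and 0 means that there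
is no column. -/
noncomputable def colDecode (i : ℕ) : ℕ → Option (Col (mach i))
  | 0 => none
  | 1 => some (inputCol (mach i) false)
  | 2 => some (inputCol (mach i) true)
  | n + 3 => if h : n < colCard i then some ((Finite.equivFin (Col (mach i))).symm ⟨n, h⟩) else none

theorem colDecode_colCode (i : ℕ) (c : Col (mach i)) : colDecode i (colCode i c) = some c := by
  have h : (Finite.equivFin (Col (mach i)) c : ℕ) < colCard i := Fin.is_lt _
  exact (dif_pos h).trans (congrArg some (Equiv.symm_apply_apply _ c))

theorem colCode_pos (i : ℕ) (c : Col (mach i)) : 0 < colCode i c := Nat.succ_pos _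

theorem colCode_le (i : ℕ) (c : Col (mach i)) : colCode i c ≤ colCard i + 3 :=
  Nat.add_le_add_right (Fin.is_lt _).le 3

/-- The number of a control state. There is a gap after it, so that the number of a column can be
added without loss of information. -/
noncomputable def ctlCode (s : SigmaCtl) : ℕ :=
  Nat.pair (Nat.pair (Encodable.encode s) (colCard s.1 + 3)) 0

/-- This is due to `Nat.pair g e = g * g + g + e` for `e ≤ g`. -/
theorem ctlCode_add {s : SigmaCtl} {e : ℕ} (he : e ≤ colCard s.1 + 3) :
    ctlCode s + e = Nat.pair (Nat.pair (Encodable.encode s) (colCard s.1 + 3)) e := by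
  have h : e ≤ Nat.pair (Encodable.encode s) (colCard s.1 + 3) := he.trans (Nat.right_le_pair _ _)
  rw [ctlCode]
  generalize Nat.pair (Encodable.encode s) (colCard s.1 + 3) = g at h ⊢
  rw [Nat.pair, Nat.pair, if_neg (by omega), if_neg (by omega), Nat.add_zero]

/-- The control state with a given number; the number of a column may have been added. -/
noncomputable def ctlDecode (z : ℕ) : Option SigmaCtl :=
  Encodable.decode (Nat.unpair (Nat.unpair z).1).1

theorem ctlDecode_add {s : SigmaCtl} {e : ℕ} (he : e ≤ colCard s.1 + 3) :
    ctlDecode (ctlCode s + e) = some s ∧ (Nat.unpair (ctlCode s + e)).2 = e := by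
  rw [ctlCode_add he, ctlDecode]
  simp

theorem ctlDecode_ctlCode (s : SigmaCtl) :
    ctlDecode (ctlCode s) = some s ∧ (Nat.unpair (ctlCode s)).2 = 0 :=
  ctlDecode_add (Nat.zero_le _)

/-- The common table of all simulating machines. -/
noncomputable def table : Table where
  halt z := ∃ s, ctlDecode z = some s ∧ s.2.IsHalt
  isQuery z := ∃ s, ctlDecode z = some s ∧ s.2.IsQuery
  ask z := (ctlDecode z).elim none fun s => s.2.ask
  out z := (ctlDecode z).elim none fun s => s.2.out
  push z := (ctlDecode z).elim 0 fun s =>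
    (s.2.push (colDecode s.1 (Nat.unpair z).2)).elim 0 (colCode s.1)
  next z := (ctlDecode z).elim 0 fun s =>
    ctlCode ⟨s.1, s.2.next (colDecode s.1 (Nat.unpair z).2)⟩
  nextYes z := (ctlDecode z).elim 0 fun s => ctlCode ⟨s.1, s.2.nextYes⟩

/-- The number of the initial state of the sweeping machine that simulates the machine number `i`. -/
noncomputable def startCode (i : ℕ) : ℕ := ctlCode ⟨i, Ctl.start (mach i)⟩

section

variable {i : ℕ} (s : Ctl (mach i)) {O : Set Word} {u v : List ℕ} {ask out : Word}

theorem table_halt : table.halt (ctlCode ⟨i, s⟩) ↔ s.IsHalt := by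
  simp only [table, ctlDecode_ctlCode, Option.some.injEq, exists_eq_left']

theorem table_isQuery : table.isQuery (ctlCode ⟨i, s⟩) ↔ s.IsQuery := by
  simp only [table, ctlDecode_ctlCode, Option.some.injEq, exists_eq_left']

theorem table_step_nil (h : ¬ s.IsHalt) (h' : ¬ s.IsQuery) :
    table.step O ⟨ctlCode ⟨i, s⟩, [], v, ask, out⟩ =
      ⟨ctlCode ⟨i, s.next none⟩, pushPos ((s.push none).elim 0 (colCode i)) v, [],
        ask ++ s.ask.toList, out ++ s.out.toList⟩ := by
  rw [Table.step_nil (by rwa [table_halt]) (by rwa [table_isQuery])]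
  simp [table, ctlDecode_ctlCode, colDecode]

theorem table_step_cons (h : ¬ s.IsHalt) (h' : ¬ s.IsQuery) {e : ℕ} (he : e ≤ colCard i + 3) :
    table.step O ⟨ctlCode ⟨i, s⟩, e :: u, v, ask, out⟩ =
      ⟨ctlCode ⟨i, s.next (colDecode i e)⟩, u,
        pushPos ((s.push (colDecode i e)).elim 0 (colCode i)) v,
        ask ++ s.ask.toList, out ++ s.out.toList⟩ := by
  rw [Table.step_cons (by rwa [table_halt]) (by rwa [table_isQuery])]
  have := ctlDecode_add (s := ⟨i, s⟩) he
  simp [table, ctlDecode_ctlCode, this]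

open Classical in
theorem table_step_query (h : ¬ s.IsHalt) (h' : s.IsQuery) :
    table.step O ⟨ctlCode ⟨i, s⟩, u, v, ask, out⟩ =
      ⟨if ask ∈ O then ctlCode ⟨i, s.nextYes⟩ else ctlCode ⟨i, s.next none⟩, u, v, [], out⟩ := by
  rw [Table.step_query (by rwa [table_halt]) (by rwa [table_isQuery])]
  simp [table, ctlDecode_ctlCode, colDecode]

theorem not_isHalt_inr {p} : ¬ Ctl.IsHalt (M := mach i) (.inr p) := by rintro ⟨a, h⟩; cases h

theorem not_isQuery_inr {p} : ¬ Ctl.IsQuery (M := mach i) (.inr p) := by rintro ⟨a, b, h⟩; cases h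

end

/-- The list of numbers represents the list of columns. -/
def IsCode (i : ℕ) (u : List ℕ) (A : List (Col (mach i))) : Prop :=
  List.Forall₂ (fun e c => e ≤ colCard i + 3 ∧ colDecode i e = some c) u A

theorem isCode_map (i : ℕ) (A : List (Col (mach i))) : IsCode i (A.map (colCode i)) A := by
  unfold IsCode
  rw [List.forall₂_map_left_iff, List.forall₂_same]
  exact fun c _ => ⟨colCode_le i c, colDecode_colCode i c⟩

/-- The columns written in a sweep and the symbols in hand at its end. -/
def passCols {M : OTM} (m : M.TapeIdx → Move) :
    (M.TapeIdx → Option Bool) → List (Col M) → List (Col M) × (M.TapeIdx → Option Bool)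
  | h, [] => ([], h)
  | h, c :: A =>
      let r := passCols m (fun t => Fold.held (m t) (h t) (c t)) A
      ((fun t => Fold.cell (m t) (h t) (c t)) :: r.1, r.2)

theorem passCols_tape {M : OTM} (m : M.TapeIdx → Move) (h : M.TapeIdx → Option Bool)
    (A : List (Col M)) (t : M.TapeIdx) :
    Fold.pass (m t) (h t) (A.map (· t)) =
      ((passCols m h A).1.map (· t), (passCols m h A).2 t) := by
  induction A generalizing h with
  | nil => rfl
  | cons c A ih => 
    simp only [List.map_cons, Fold.pass, passCols]
    rw [ih fun t => Fold.held (m t) (h t) (c t)]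

theorem length_passCols {M : OTM} (m : M.TapeIdx → Move) (h : M.TapeIdx → Option Bool)
    (A : List (Col M)) : (passCols m h A).1.length = A.length := by
  induction A generalizing h with
  | nil => rfl
  | cons c A ih => simp [passCols, ih]

theorem passCols_append {M : OTM} (m : M.TapeIdx → Move) (h : M.TapeIdx → Option Bool)
    (A B : List (Col M)) : passCols m h (A ++ B) = ((passCols m h A).1 ++
      (passCols m (passCols m h A).2 B).1, (passCols m (passCols m h A).2 B).2) := by
  induction A generalizing h with
  | nil => rfl
  | cons c A ih => simp [passCols, ih]

section

variable {i : ℕ} {O : Set Word} {u v : List ℕ} {A : List (Col (mach i))} {b : Bool}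
  {q : (mach i).State} {m : (mach i).TapeIdx → Move} {h : (mach i).TapeIdx → Option Bool}
  {ask out : Word}

/-- A sweep, up to its end. -/
theorem table_pass (hu : IsCode i u A) :
    (table.step O)^[A.length] ⟨ctlCode ⟨i, .inr (b, q, m, h)⟩, u, v, ask, out⟩ =
      ⟨ctlCode ⟨i, .inr (b, q, m, (passCols m h A).2)⟩, [],
        ((passCols m h A).1.map (colCode i)).reverse ++ v, ask, out⟩ := by
  induction hu generalizing h v with
  | nil => rfl
  | @cons e c u A he _ ih =>
    rw [List.length_cons, Function.iterate_succ_apply,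
      table_step_cons _ not_isHalt_inr not_isQuery_inr he.1, he.2]
    simp only [Ctl.next, Ctl.sweepNext, Ctl.push, Ctl.sweepPush, Option.elim_some, Ctl.ask, Ctl.out,
      Ctl.instr, Option.toList_none, List.append_nil, pushPos, (colCode_pos i _).ne', if_false]
    rw [ih]
    simp [passCols]

/-- The new columns and scanned symbols after a move on each tape. -/
def shiftCols {M : OTM} (m : M.TapeIdx → Move) (h : M.TapeIdx → Option Bool) (A : List (Col M)) :
    List (Col M) × (M.TapeIdx → Option Bool) :=
  let B := passCols m h (A ++ [fun _ => (none, none)])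
  let C := passCols (fun t => Fold.flip (m t)) B.2 B.1.reverse
  (C.1.reverse, C.2)

theorem shiftCols_tape {M : OTM} (m : M.TapeIdx → Move) (h : M.TapeIdx → Option Bool)
    (A : List (Col M)) (t : M.TapeIdx) :
    Fold.shift (m t) (h t) (A.map (· t)) =
      ((shiftCols m h A).1.map (· t), (shiftCols m h A).2 t) := by
  have h1 := passCols_tape m h (A ++ [fun _ => (none, none)]) t
  rw [List.map_append] at h1
  have h2 := passCols_tape (fun t => Fold.flip (m t)) (passCols m h (A ++ [fun _ => (none, none)])).2
    (passCols m h (A ++ [fun _ => (none, none)])).1.reverse t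
  simp only [Fold.shift, shiftCols]
  simp only [List.map_cons, List.map_nil] at h1
  rw [h1, ← List.map_reverse, h2, List.map_reverse]

theorem length_shiftCols {M : OTM} (m : M.TapeIdx → Move) (h : M.TapeIdx → Option Bool)
    (A : List (Col M)) : (shiftCols m h A).1.length = A.length + 1 := by
  simp [shiftCols, length_passCols]

/-- A sweep forth and back. -/
theorem table_shift (hu : IsCode i u A) :
    (table.step O)^[2 * A.length + 3]
        ⟨ctlCode ⟨i, .inr (false, q, m, h)⟩, u, [], ask, out⟩ =
      ⟨ctlCode ⟨i, .inl (q, (shiftCols m h A).2)⟩, (shiftCols m h A).1.map (colCode i), [],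
        ask, out⟩ := by
  have e : 2 * A.length + 3 = 1 + ((A.length + 1) + (1 + A.length)) := by ring
  rw [e, Function.iterate_add_apply, Function.iterate_add_apply _ (A.length + 1),
    Function.iterate_add_apply _ 1 A.length, table_pass hu, Function.iterate_one,
    table_step_nil _ not_isHalt_inr not_isQuery_inr]
  simp only [Ctl.next, Ctl.sweepNext, Ctl.push, Ctl.sweepPush, Option.elim_some, Ctl.ask, Ctl.out,
    Ctl.instr, Option.toList_none, List.append_nil, pushPos, (colCode_pos i _).ne', if_false,
    cond_false]
  have hB : passCols m h (A ++ [fun _ => (none, none)]) =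
      ((passCols m h A).1 ++ [fun t => Fold.cell (m t) ((passCols m h A).2 t) (none, none)],
        fun t => Fold.held (m t) ((passCols m h A).2 t) (none, none)) := by
    rw [passCols_append]; rfl
  have hcode := isCode_map i (passCols m h (A ++ [fun _ => (none, none)])).1.reverse
  have hlen : (passCols m h (A ++ [fun _ => (none, none)])).1.reverse.length = A.length + 1 := by
    simp [length_passCols]
  have := table_pass (O := O) (b := true) (q := q) (m := fun t => Fold.flip (m t))
    (h := fun t => Fold.held (m t) ((passCols m h A).2 t) (none, none)) (v := [])
    (ask := ask) (out := out) hcode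
  rw [hlen] at this
  rw [hB] at this
  simp only [List.reverse_append, List.reverse_cons, List.reverse_nil, List.nil_append,
    List.singleton_append, List.map_cons, List.map_reverse, List.append_nil] at this ⊢
  rw [this, table_step_nil _ not_isHalt_inr not_isQuery_inr]
  simp only [Ctl.next, Ctl.sweepNext, Ctl.push, Ctl.sweepPush, Option.elim_none, Ctl.ask, Ctl.out,
    Ctl.instr, Option.toList_none, List.append_nil, pushPos, if_true, cond_true, shiftCols, hB]
  simp

end

/-- The sweeping machine is about to simulate the instruction that applies to the configuration `cf`
of the machine number `i`, with a memory of `l` columns. -/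
structure Simulates (i : ℕ) (cf : (mach i).Config) (c : Sweep) (l : ℕ) : Prop where
  z : c.z = ctlCode ⟨i, .inl (cf.state, fun t => (cf.tapes t).head)⟩
  u : ∃ A, A.length = l ∧ IsCode i c.u A ∧
    ∀ t, Fold.Represents (cf.tapes t) ((cf.tapes t).head) (A.map (· t))
  v : c.v = []
  ask : c.ask = cf.oracleTape
  out : c.out = cf.output

theorem Simulates.halt {i : ℕ} {cf : (mach i).Config} {c : Sweep} {l : ℕ}
    (h : Simulates i cf c l) (hv : ((mach i).verdict cf).isSome) : table.halt c.z := by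
  rw [h.z, table_halt]
  unfold OTM.verdict at hv
  split at hv
  · rename_i a ha
    exact ⟨a, congrArg some ha⟩
  · simp at hv

theorem Simulates.step {i : ℕ} {O : Set Word} {cf : (mach i).Config} {c : Sweep} {l : ℕ}
    (h : Simulates i cf c l) :
    ∃ k ≤ 2 * l + 3, ∃ l' ≤ l + 1, Simulates i ((mach i).step O cf) ((table.step O)^[k] c) l' := by
  obtain ⟨A, rfl, hA, hT⟩ := h.u
  rcases c with ⟨z, u, v, ask, out⟩
  obtain ⟨hz, -, hv, hask, hout⟩ := h
  dsimp only at hz hv hask hout hA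
  subst hz hv hask hout
  set s : Ctl (mach i) := .inl (cf.state, fun t => (cf.tapes t).head) with hs
  have hins : s.instr = some ((mach i).instr cf) := rfl
  rcases hi : (mach i).instr cf with ⟨q, w, m, a, b⟩ | ⟨y, n⟩ | a
  · have hh : ¬ s.IsHalt := by rintro ⟨a, h⟩; rw [hins, hi] at h; cases h
    have hq : ¬ s.IsQuery := by rintro ⟨a, b, h⟩; rw [hins, hi] at h; cases h
    have hp : (mach i).program cf.state (fun t => (cf.tapes t).head) = .act q w m a b := hi
    -- The first step is that of a sweep, apart from the letters emitted.
    have h1 : table.step O ⟨ctlCode ⟨i, s⟩, u, [], cf.oracleTape, cf.output⟩ =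
        table.step O ⟨ctlCode ⟨i, .inr (false, q, m, w)⟩, u, [],
          cf.oracleTape ++ a.toList, cf.output ++ b.toList⟩ := by
      have e1 : s.ask = a := by simp [Ctl.ask, hins, hi]
      have e2 : s.out = b := by simp [Ctl.out, hins, hi]
      have e3 : ∀ c, s.next c = Ctl.next (.inr (false, q, m, w)) c := fun c => by
        simp [hs, Ctl.next, hp]
      have e4 : ∀ c, s.push c = Ctl.push (.inr (false, q, m, w)) c := fun c => by
        simp [hs, Ctl.push, hp]
      cases u with
      | nil =>
        rw [table_step_nil _ hh hq, table_step_nil _ not_isHalt_inr not_isQuery_inr, e1, e2, e3, e4]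
        simp [Ctl.ask, Ctl.out, Ctl.instr]
      | cons e u =>
        have he : e ≤ colCard i + 3 := by cases hA with | cons h _ => exact h.1
        rw [table_step_cons _ hh hq he, table_step_cons _ not_isHalt_inr not_isQuery_inr he,
          e1, e2, e3, e4]
        simp [Ctl.ask, Ctl.out, Ctl.instr]
    have h2 : ∀ n, (table.step O)^[n + 1] ⟨ctlCode ⟨i, s⟩, u, [], cf.oracleTape, cf.output⟩ =
        (table.step O)^[n + 1] ⟨ctlCode ⟨i, .inr (false, q, m, w)⟩, u, [],
          cf.oracleTape ++ a.toList, cf.output ++ b.toList⟩ := fun n => by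
      rw [Function.iterate_succ_apply, h1, Function.iterate_succ_apply]
    have hT' : ∀ t, Fold.Represents (((cf.tapes t).write (w t)).move (m t))
        ((shiftCols m w A).2 t) ((shiftCols m w A).1.map (· t)) := fun t => by
      have := (hT t).shift (w t) (m t)
      rwa [shiftCols_tape] at this
    refine ⟨2 * A.length + 3, le_rfl, A.length + 1, le_rfl, ?_⟩
    rw [h2, table_shift hA, OTM.step, hi]
    have e5 : (fun t => (((cf.tapes t).write (w t)).move (m t)).head) = (shiftCols m w A).2 :=
      funext fun t => (hT' t).head
    refine ⟨by rw [e5], ⟨_, length_shiftCols m w A, isCode_map _ _, fun t => ?_⟩, rfl, rfl, rfl⟩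
    have := hT' t
    rwa [← this.head] at this
  · have hh : ¬ s.IsHalt := by rintro ⟨a, h⟩; rw [hins, hi] at h; cases h
    have hq : s.IsQuery := ⟨y, n, by rw [hins, hi]⟩
    have hp : (mach i).program cf.state (fun t => (cf.tapes t).head) = .query y n := hi
    refine ⟨1, by omega, A.length, by omega, ?_⟩
    rw [Function.iterate_one, table_step_query _ hh hq, OTM.step, hi]
    refine ⟨?_, ⟨A, rfl, hA, hT⟩, rfl, rfl, rfl⟩
    simp only [hs, Ctl.next, Ctl.nextYes, hp]
    split_ifs <;> rfl
  · have : (mach i).step O cf = cf := by rw [OTM.step, hi]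
    rw [this]
    exact ⟨0, by omega, A.length, by omega, rfl, ⟨A, rfl, hA, hT⟩, rfl, rfl, rfl⟩

theorem inputCol_tape {M : OTM} (x : Word) (t : M.TapeIdx) :
    (x.map (inputCol M)).map (· t) =
      if t = M.inputTape then x.map fun b => (none, some b) else x.map fun _ => (none, none) := by
  rw [List.map_map]
  split_ifs with h
  all_goals
    refine List.map_congr_left fun b _ => ?_
    simp [inputCol, h]

theorem isCode_input (i : ℕ) (x : Word) :
    IsCode i (x.map fun b => bif b then 2 else 1) (x.map (inputCol (mach i))) := by
  unfold IsCode
  rw [List.forall₂_map_left_iff, List.forall₂_map_right_iff, List.forall₂_same]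
  rintro (_ | _) _ <;> exact ⟨by simp only [cond_true, cond_false]; omega, rfl⟩

namespace Fold

/-- Loading the input means to move the head from the blank cell in front of it to its first letter. -/
theorem represents_ofWord (x : Word) :
    Represents (Tape.ofWord x) (Fold.shift .right none (x.map fun b => (none, some b))).2
      (Fold.shift .right none (x.map fun b => (none, some b))).1 := by
  have h : Represents ⟨[], none, x.map some⟩ none (x.map fun b => (none, some b)) := by
    refine ⟨rfl, fun p => ?_, fun p => ?_⟩
    · rw [List.map_map]
      simp only [List.getD_eq_getElem?_getD, List.getElem?_map, List.getElem?_nil]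
      cases x[p]? <;> rfl
    · rw [List.map_map]
      rfl
  have h' := h.shift none .right
  have hn : ∀ p, ([] : List (Option Bool)).getD p none = [none].getD p none := by
    rintro (_ | _) <;> rfl
  cases x with
  | nil => exact ⟨h'.head, fun p => (hn p).trans (h'.left p), h'.right⟩
  | cons b x => exact ⟨h'.head, fun p => (hn p).trans (h'.left p), h'.right⟩

theorem represents_blank (x : Word) :
    Represents (Tape.ofWord []) (Fold.shift .stay none (x.map fun _ => (none, none))).2
      (Fold.shift .stay none (x.map fun _ => (none, none))).1 := by
  have h : Represents ⟨[], none, []⟩ none (x.map fun _ => (none, none)) := by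
    refine ⟨rfl, fun p => ?_, fun p => ?_⟩ <;>
    · rw [List.map_map]
      simp only [List.getD_eq_getElem?_getD, List.getElem?_map, List.getElem?_nil]
      cases x[p]? <;> rfl
  exact h.shift none .stay

end Fold

theorem simulates_init (i : ℕ) (O : Set Word) (x : Word) :
    Simulates i ((mach i).init x) (table.run O (startCode i) x (2 * x.length + 3))
      (x.length + 1) := by
  have h := table_shift (O := O) (q := (mach i).start) (ask := []) (out := [])
    (m := fun t => if t = (mach i).inputTape then .right else .stay) (h := fun _ => none)
    (isCode_input i x)
  rw [List.length_map] at h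
  have hT : ∀ t, Fold.Represents (((mach i).init x).tapes t)
      ((shiftCols (fun t => if t = (mach i).inputTape then .right else .stay) (fun _ => none)
        (x.map (inputCol (mach i)))).2 t)
      ((shiftCols (fun t => if t = (mach i).inputTape then .right else .stay) (fun _ => none)
        (x.map (inputCol (mach i)))).1.map (· t)) := by
    intro t
    have h := shiftCols_tape (fun t => if t = (mach i).inputTape then .right else .stay)
      (fun _ => none) (x.map (inputCol (mach i))) t
    rw [inputCol_tape] at h
    have e : ((mach i).init x).tapes t =
        if t = (mach i).inputTape then Tape.ofWord x else Tape.ofWord [] := rfl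
    rw [e]
    split_ifs at h ⊢
    · have h' := Fold.represents_ofWord x
      rwa [h] at h'
    · have h' := Fold.represents_blank x
      rwa [h] at h'
  have hh : (fun t => (((mach i).init x).tapes t).head) = _ := funext fun t => (hT t).head
  refine ⟨?_, ⟨(shiftCols (fun t => if t = (mach i).inputTape then .right else .stay) (fun _ => none)
    (x.map (inputCol (mach i)))).1, ?_, ?_, fun t => ?_⟩, ?_, ?_, ?_⟩
  · rw [hh]; exact congrArg Sweep.z h
  · rw [length_shiftCols, List.length_map]
  · have hu : (table.run O (startCode i) x (2 * x.length + 3)).u = _ := congrArg Sweep.u h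
    rw [hu]
    exact isCode_map _ _
  · have := hT t
    rwa [← this.head] at this
  · exact congrArg Sweep.v h
  · exact congrArg Sweep.ask h
  · exact congrArg Sweep.out h

/-- The simulation takes quadratic time. -/
theorem simulates_run (i : ℕ) (O : Set Word) (x : Word) (n : ℕ) :
    ∃ k ≤ (n + 1) * (2 * (x.length + n) + 5), ∃ l ≤ x.length + 1 + n,
      Simulates i ((mach i).run O x n) (table.run O (startCode i) x k) l := by
  induction n with
  | zero => exact ⟨2 * x.length + 3, by omega, x.length + 1, by omega, simulates_init i O x⟩
  | succ n ih =>
    obtain ⟨k, hk, l, hl, h⟩ := ih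
    obtain ⟨k', hk', l', hl', h'⟩ := h.step (O := O)
    refine ⟨k' + k, ?_, l', by omega, ?_⟩
    · nlinarith
    · rw [OTM.run_succ, Table.run, Function.iterate_add_apply]
      exact h'

theorem table_outputs {i : ℕ} {O : Set Word} {x y : Word} {n : ℕ}
    (h : (mach i).OutputsWithin O x n y) :
    ∃ k ≤ (n + 1) * (2 * (x.length + n) + 5), table.Outputs O (startCode i) x k y := by
  obtain ⟨k, hk, l, -, hs⟩ := simulates_run i O x n
  exact ⟨k, hk, hs.halt h.1, hs.out.trans h.2⟩

namespace Table

variable {τ : Table} {O : Set Word} {i : ℕ} {x y y' : Word} {n m : ℕ}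

theorem run_of_halt (h : τ.halt (τ.run O i x n).z) (hm : n ≤ m) :
    τ.run O i x m = τ.run O i x n := by
  induction m, hm using Nat.le_induction with
  | base => rfl
  | succ m _ ih => rw [run_succ, ih, step_halt h]

theorem Outputs.mono (h : τ.Outputs O i x n y) (hm : n ≤ m) : τ.Outputs O i x m y := by
  rw [Outputs, run_of_halt h.1 hm]
  exact h

theorem Outputs.unique (h : τ.Outputs O i x n y) (h' : τ.Outputs O i x m y') : y = y' := by
  rw [← (h.mono (le_max_left n m)).2, ← (h'.mono (le_max_right n m)).2]

end Table

/-! ### Boundedness -/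

/-- The invariant that bounds the numbers in a configuration: the machine number `i` has finitely many
control states and columns. -/
structure Valid (i : ℕ) (c : Sweep) : Prop where
  z : ∃ s : Ctl (mach i), c.z = ctlCode ⟨i, s⟩
  u : ∀ e ∈ c.u, 0 < e ∧ e ≤ colCard i + 3
  v : ∀ e ∈ c.v, 0 < e ∧ e ≤ colCard i + 3

theorem Valid.step {i : ℕ} {O : Set Word} {c : Sweep} (h : Valid i c) :
    Valid i (table.step O c) := by
  rcases c with ⟨z, u, v, ask, out⟩
  obtain ⟨⟨s, hs⟩, hu, hv⟩ := h
  dsimp only at hs hu hv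
  subst hs
  have hpush : ∀ (o : Option (Col (mach i))), ∀ e ∈ pushPos (o.elim 0 (colCode i)) v,
      0 < e ∧ e ≤ colCard i + 3 := by
    intro o e he
    unfold pushPos at he
    split_ifs at he with h0
    · exact hv e he
    · rcases List.mem_cons.1 he with rfl | he
      · refine ⟨Nat.pos_of_ne_zero h0, ?_⟩
        cases o with
        | none => simp
        | some c => exact colCode_le i c
      · exact hv e he
  by_cases hh : s.IsHalt
  · rw [Table.step_halt ((table_halt s).2 hh)]
    exact ⟨⟨s, rfl⟩, hu, hv⟩
  by_cases hq : s.IsQuery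
  · rw [table_step_query s hh hq]
    refine ⟨?_, hu, hv⟩
    dsimp only
    split_ifs
    exacts [⟨_, rfl⟩, ⟨_, rfl⟩]
  cases u with
  | nil =>
    rw [table_step_nil s hh hq]
    exact ⟨⟨_, rfl⟩, hpush _, by simp⟩
  | cons e u =>
    rw [table_step_cons s hh hq (hu e List.mem_cons_self).2]
    exact ⟨⟨_, rfl⟩, fun e he => hu e (List.mem_cons_of_mem _ he), hpush _⟩

theorem exists_bounded (i : ℕ) :
    ∃ B, ∀ N ≥ B, ∀ O x k, (table.run O (startCode i) x k).Bounded N := by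
  obtain ⟨B, hB⟩ := (Set.finite_range fun s : Ctl (mach i) => ctlCode ⟨i, s⟩).bddAbove
  refine ⟨B + (colCard i + 3), fun N hN O x k => ?_⟩
  have h : Valid i (table.run O (startCode i) x k) := by
    induction k with
    | zero =>
      refine ⟨⟨_, rfl⟩, ?_, by simp [Table.run, Table.init]⟩
      simp only [Table.run, Table.init, Function.iterate_zero, id, List.mem_map]
      rintro e ⟨b, -, rfl⟩
      cases b <;> simp
    | succ k ih => rw [Table.run_succ]; exact ih.step
  obtain ⟨⟨s, hs⟩, hu, hv⟩ := h
  have hz : ctlCode ⟨i, s⟩ ≤ B := hB (Set.mem_range_self s)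
  refine ⟨?_, fun e he => ?_, fun e he => ?_⟩
  · rw [hs]; omega
  · have := hu e he; omega
  · have := hv e he; omega

/-! ### Dependence of computations on the oracle -/

/-- Two oracles agree on the words of length at most `N`. -/
def AgreeUpTo (N : ℕ) (O P : Set Word) : Prop := ∀ w : Word, w.length ≤ N → (w ∈ O ↔ w ∈ P)

theorem AgreeUpTo.mono {N N' : ℕ} {O P : Set Word} (h : AgreeUpTo N O P) (hN : N' ≤ N) :
    AgreeUpTo N' O P :=
  fun w hw => h w (hw.trans hN)

theorem OTM.run_congr {M : OTM} {O P : Set Word} {x : Word} {N n : ℕ} (h : AgreeUpTo N O P)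
    (hN : ∀ k < n, (M.run O x k).oracleTape.length ≤ N) : M.run P x n = M.run O x n := by
  induction n with
  | zero => rfl
  | succ n ih =>
    rw [OTM.run_succ, OTM.run_succ, ih fun k hk => hN k (hk.trans n.lt_succ_self), OTM.step,
      OTM.step, propext (h _ (hN n n.lt_succ_self))]

theorem OTM.length_oracleTape_le (M : OTM) (O : Set Word) (x : Word) (n : ℕ) :
    (M.run O x n).oracleTape.length ≤ n := by
  induction n with
  | zero => exact le_rfl
  | succ n ih =>
    rw [OTM.run_succ, OTM.step]
    rcases M.instr (M.run O x n) with ⟨q, w, m, a, b⟩ | ⟨y, n⟩ | a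
    · have := Table.length_toList_le a
      simp only [List.length_append]
      omega
    · exact Nat.zero_le _
    · exact ih.trans n.le_succ

theorem Table.run_congr {τ : Table} {O P : Set Word} {N : ℕ} (h : AgreeUpTo N O P) (i : ℕ)
    (x : Word) {n : ℕ} (hn : n ≤ N) : τ.run P i x n = τ.run O i x n := by
  induction n with
  | zero => rfl
  | succ n ih =>
    have hl := (τ.length_run_le (O := O) i x n).2.1
    rw [Table.run_succ, Table.run_succ, ih (by omega), Table.step, Table.step,
      propext (h _ (hl.trans (by omega)))]

theorem Table.outputs_congr {τ : Table} {O P : Set Word} {N : ℕ} (h : AgreeUpTo N O P) {i : ℕ}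
    {x y : Word} {n : ℕ} (hn : n ≤ N) : τ.Outputs P i x n y ↔ τ.Outputs O i x n y := by
  rw [Table.Outputs, Table.run_congr h i x hn, Table.Outputs]

/-! ### Complex tally sets -/

theorem binary_injective : Function.Injective binary := by
  intro m n h
  have h' : m.bits = n.bits := List.reverse_injective h
  have h2 : Nat.digits 2 m = Nat.digits 2 n := by
    rw [Nat.digits_two_eq_bits, Nat.digits_two_eq_bits, h']
  exact Nat.digits_inj_iff.1 h2

/-- The function of which the machine number `e` computes the values in binary, without an oracle; the
value is arbitrary where there is no such output. -/
noncomputable def timeFun (e n : ℕ) : ℕ :=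
  Classical.epsilon fun v => ∃ s, (mach e).OutputsWithin ∅ (zeros n) s (binary v)

theorem exists_timeFun_eq {t : ℕ → ℕ} (ht : TimeConstructible t) : ∃ e, timeFun e = t := by
  obtain ⟨-, M, c, hM⟩ := ht
  obtain ⟨e, he⟩ := M.exists_similar
  refine ⟨e, funext fun n => ?_⟩
  have h := he.outputsWithin.1 (hM (zeros n))
  rw [List.length_replicate] at h
  obtain ⟨s, hs⟩ := Classical.epsilon_spec
    (p := fun v => ∃ s, (mach e).OutputsWithin ∅ (zeros n) s (binary v)) ⟨t n, _, h⟩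
  refine binary_injective (hs.2.symm.trans ?_)
  rw [OTM.run_eq_of_verdict h.1 hs.1, h.2]

/-- A monotone bound for the time that the diagonalization takes. -/
noncomputable def diagTime (e n : ℕ) : ℕ :=
  ∑ k ∈ Finset.range (n + 1), (Nat.unpair (Nat.sqrt k)).2 * (timeFun e k + 1)

theorem diagTime_mono (e : ℕ) : Monotone (diagTime e) := fun _ _ h =>
  Finset.sum_le_sum_of_subset (Finset.range_mono (Nat.succ_le_succ h))

theorem le_diagTime {e n j c : ℕ} (h : Nat.unpair (Nat.sqrt n) = (j, c)) :
    c * timeFun e n + c ≤ diagTime e n := by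
  have := Finset.single_le_sum (f := fun k => (Nat.unpair (Nat.sqrt k)).2 * (timeFun e k + 1))
    (fun _ _ => Nat.zero_le _) (Finset.self_mem_range_succ n)
  simp only [h] at this
  exact this

/-- The machine number `j` does not accept `0ⁿ` in time `c * timeFun e n + c`, where `(j, c)` is the
pair with number `Nat.sqrt n`. -/
def Diag (O : Set Word) (e n : ℕ) : Prop :=
  (mach (Nat.unpair (Nat.sqrt n)).1).verdict ((mach (Nat.unpair (Nat.sqrt n)).1).run O (zeros n)
    ((Nat.unpair (Nat.sqrt n)).2 * timeFun e n + (Nat.unpair (Nat.sqrt n)).2)) ≠ some true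

/-- The sweeping machine that simulates the machine number `i` has the output `0ⁿ` on some input within `r` steps. -/
def Hits (O : Set Word) (i r n : ℕ) : Prop := ∃ x, table.Outputs O (startCode i) x r (zeros n)

/-- Membership of `0ⁿ` in the complex tally set number `e`. The word is left out if one of the first
`Nat.sqrt n` sweeping machines has it as an output, provided that this machine is not yet known to
have an output outside the set; otherwise, the word is used to diagonalize. -/
noncomputable def Complex (O : Set Word) (e n : ℕ) : Prop :=
  n = 0 ∨ (¬ (∃ i < Nat.sqrt n, Hits O i (diagTime e n) n ∧
    ¬ ∃ k, ∃ _ : k < n, ¬ Complex O e k ∧ Hits O i (diagTime e n) k) ∧ Diag O e n)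
termination_by n

theorem complex_zero (O : Set Word) (e : ℕ) : Complex O e 0 := by
  rw [Complex]; exact .inl rfl

/-- The sweeping machine number `i` causes `0ⁿ` to be left out of the complex tally set. -/
def Kills (O : Set Word) (e i n : ℕ) : Prop :=
  i < Nat.sqrt n ∧ Hits O i (diagTime e n) n ∧
    ∀ k < n, Hits O i (diagTime e n) k → Complex O e k

theorem complex_iff {O : Set Word} {e n : ℕ} (hn : n ≠ 0) :
    Complex O e n ↔ (¬ ∃ i, Kills O e i n) ∧ Diag O e n := by
  rw [Complex]
  simp only [hn, false_or, Kills]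
  refine and_congr_left fun _ => not_congr (exists_congr fun i => and_congr_right fun _ =>
    and_congr_right fun _ => ?_)
  push Not
  exact ⟨fun h k hk hk' => by_contra fun h' => h k hk h' hk', fun h k hk h' hk' => h' (h k hk hk')⟩

theorem Kills.not_complex {O : Set Word} {e i n : ℕ} (h : Kills O e i n) : ¬ Complex O e n := by
  have hn : n ≠ 0 := by
    rintro rfl
    exact absurd h.1 (by simp)
  rw [complex_iff hn]
  exact fun h' => h'.1 ⟨i, h⟩

theorem Hits.mono {O : Set Word} {i r r' n : ℕ} (h : Hits O i r n) (hr : r ≤ r') : Hits O i r' n :=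
  h.imp fun _ h => h.mono hr

/-- A machine kills at most one word, as this word is an output outside the set. -/
theorem Kills.unique {O : Set Word} {e i n n' : ℕ} (h : Kills O e i n) (h' : Kills O e i n') :
    n = n' := by
  wlog hlt : n < n' generalizing n n'
  · rcases Nat.lt_or_ge n' n with hgt | hge
    · exact (this h' h hgt).symm
    · omega
  · exact absurd (h'.2.2 n hlt (h.2.1.mono (diagTime_mono e hlt.le))) h.not_complex

theorem diag_congr {O P : Set Word} {e n : ℕ} (h : AgreeUpTo (diagTime e n) O P) :
    Diag P e n ↔ Diag O e n := by
  rw [Diag, Diag, OTM.run_congr h fun k hk => ?_]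
  exact (OTM.length_oracleTape_le _ _ _ k).trans
    (hk.le.trans (le_diagTime (Prod.mk.eta (p := Nat.unpair (Nat.sqrt n)))))

theorem hits_congr {O P : Set Word} {N i r n : ℕ} (h : AgreeUpTo N O P) (hr : r ≤ N) :
    Hits P i r n ↔ Hits O i r n :=
  exists_congr fun _ => Table.outputs_congr h hr

theorem complex_congr {O P : Set Word} {e n : ℕ} (h : AgreeUpTo (diagTime e n) O P) :
    Complex P e n ↔ Complex O e n := by
  induction n using Nat.strong_induction_on with
  | _ n ih =>
    rcases eq_or_ne n 0 with rfl | hn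
    · exact iff_of_true (complex_zero P e) (complex_zero O e)
    · rw [complex_iff hn, complex_iff hn, diag_congr h]
      refine and_congr_left fun _ => not_congr (exists_congr fun i => and_congr_right fun _ => ?_)
      refine and_congr (hits_congr h le_rfl) (forall₂_congr fun k hk => ?_)
      rw [hits_congr h le_rfl, ih k hk (h.mono (diagTime_mono e hk.le))]

/-- Among the `2 * k + 1` numbers `n` with `Nat.sqrt n = k`, at most `k` are killed, so there remains
one for the diagonalization against the machine and the time constant that `k` encodes. -/
theorem exists_not_kills (O : Set Word) (e k : ℕ) :
    ∃ n, Nat.sqrt n = k ∧ ¬ ∃ i, Kills O e i n := by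
  by_contra! h
  have h' : ∀ m : Fin (k + 1), ∃ i, Kills O e i (k * k + m) := fun m =>
    h _ (Nat.sqrt_add_eq k (by have := m.2; omega))
  choose f hf using h'
  have hlt : ∀ m, f m < k := fun m => by
    have := (hf m).1
    rwa [Nat.sqrt_add_eq k (by have := m.2; omega)] at this
  obtain ⟨m, m', hne, heq⟩ := Fintype.exists_ne_map_eq_of_card_lt
    (fun m => (⟨f m, hlt m⟩ : Fin k)) (by simp)
  have h1 := hf m
  have h2 : f m = f m' := congrArg Fin.val heq
  rw [h2] at h1
  have := h1.unique (hf m')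
  exact hne (Fin.ext (by omega))

theorem not_inDTIME_complex (O : Set Word) {e : ℕ} {t : ℕ → ℕ} (ht : timeFun e = t) :
    ¬ InDTIME O t (tally (Complex O e)) := by
  rintro ⟨M, c, hM⟩
  obtain ⟨j, hj⟩ := M.exists_similar
  obtain ⟨n, hn, hk⟩ := exists_not_kills O e (Nat.pair j (c + 1))
  have hn0 : n ≠ 0 := by
    rintro rfl
    have := Nat.right_le_pair j (c + 1)
    simp at hn
    omega
  have h := (hj.decidesWithin.1 (hM (zeros n))).mono
    (m := (c + 1) * timeFun e n + (c + 1)) (by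
      rw [List.length_replicate, ht]
      nlinarith [Nat.zero_le (t n)])
  have hd : Diag O e n ↔ (mach j).verdict ((mach j).run O (zeros n)
      ((c + 1) * timeFun e n + (c + 1))) ≠ some true := by
    rw [Diag, hn, Nat.unpair_pair]
  have hm : zeros n ∈ tally (Complex O e) ↔ Diag O e n := by
    rw [zeros_mem_tally, complex_iff hn0, and_iff_right hk]
  rcases h with ⟨h1, h2⟩ | ⟨h1, h2⟩
  · exact hd.1 (hm.1 h1) h2
  · exact h1 (hm.2 (hd.2 (by rw [h2]; simp)))

/-- If all outputs of a sweeping machine are in the complex tally set, then for all but finitely many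
`n` it takes at least `diagTime e n` steps to output `0ⁿ`. -/
theorem diagTime_le_of_hits {O : Set Word} {e i : ℕ}
    (hi : ∀ x k w, table.Outputs O (startCode i) x k w → w ∈ tally (Complex O e)) {r n : ℕ}
    (h : Hits O i r n) : diagTime e n ≤ r + diagTime e ((i + 1) * (i + 1)) := by
  have hL : ∀ {r n}, Hits O i r n → Complex O e n := fun ⟨x, hx⟩ => zeros_mem_tally.1 (hi _ _ _ hx)
  rcases le_or_gt (diagTime e n) r with hr | hr
  · omega
  rcases Nat.lt_or_ge i (Nat.sqrt n) with hs | hs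
  · exact absurd (hL h) (Kills.not_complex (i := i) ⟨hs, h.mono hr.le, fun k _ => hL⟩)
  · have : n ≤ (i + 1) * (i + 1) := (Nat.sqrt_lt.1 (Nat.lt_succ_of_le hs)).le
    exact (diagTime_mono e this).trans (Nat.le_add_left _ _)

/-! ### The oracle -/

/-- The exponent `q` in `a = 2 ^ q * (2 * m + 1)`. -/
def exponent (a : ℕ) : ℕ := padicValNat 2 a

/-- The number `m` in `a = 2 ^ q * (2 * m + 1)`. -/
def oddPart (a : ℕ) : ℕ := a / 2 ^ (exponent a + 1)

theorem exponent_eq (q m : ℕ) : exponent (2 ^ q + m * 2 ^ (q + 1)) = q := by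
  have h : 2 ^ q + m * 2 ^ (q + 1) = 2 ^ q * (2 * m + 1) := by ring
  rw [exponent, h, padicValNat.mul (by positivity) (by omega), padicValNat.prime_pow,
    padicValNat.eq_zero_of_not_dvd (by omega), Nat.add_zero]

theorem oddPart_eq (q m : ℕ) : oddPart (2 ^ q + m * 2 ^ (q + 1)) = m := by
  rw [oddPart, exponent_eq, Nat.add_mul_div_right _ _ (by positivity),
    Nat.div_eq_of_lt (Nat.pow_lt_pow_right (by omega) q.lt_succ_self), Nat.zero_add]

theorem oddPart_le (a : ℕ) : oddPart a ≤ a := Nat.div_le_self _ _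

/-- The sweeping machine to which the padding of length `a` refers. -/
noncomputable def startOf (a : ℕ) : ℕ := startCode (Nat.unpair (exponent a)).1

/-- The degree of the polynomial time bound to which the padding of length `a` refers. -/
def degreeOf (a : ℕ) : ℕ := (Nat.unpair (exponent a)).2

/-- The number `r` of steps for which the padding of length `a` pays: the greatest one with
`(r + degreeOf a) ^ degreeOf a ≤ oddPart a`, or 0 if there is none. Thus there remains room for queries
of a length polynomial in `r` as long as the degree is at most `degreeOf a`. -/
def clockOf (a : ℕ) : ℕ :=
  Nat.findGreatest (fun r => (r + degreeOf a) ^ degreeOf a ≤ oddPart a) (oddPart a)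

theorem clockOf_le (a : ℕ) : clockOf a ≤ a := (Nat.findGreatest_le _).trans (oddPart_le a)

/-- On all inputs, within the number of steps for which the padding of length `a` pays, the machine
with the initial state `startOf a` outputs only elements of the set with description `κ`, and this
is confirmed by computations with the oracle `O` and, in the case of complex sets, in time `a`. An even description `2 * Nat.pair j c`
stands for the set that the machine number `j` accepts, with an oracle tape of length at most
`(n + c) ^ c`. An odd description `2 * e + 1` stands for the complex tally set number `e`. -/
def Sound (O : Set Word) (κ a : ℕ) : Prop :=
  (∃ j c, κ = 2 * Nat.pair j c ∧ (clockOf a + c) ^ c ≤ a ∧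
    ∀ x w, table.Outputs O (startOf a) x (clockOf a) w →
      ∃ n, (mach j).verdict ((mach j).run O w n) = some true) ∨
  ∃ e, κ = 2 * e + 1 ∧
    ∀ x w, table.Outputs O (startOf a) x (clockOf a) w →
      ∃ n, w = zeros n ∧ diagTime e n ≤ a ∧ Complex O e n

/-- The answers of the oracle to the queries with parameters `z` and `y`, by the kind of query; here
`O` is the part of the oracle for shorter words. -/
def Fact (O : Set Word) (z y : ℕ) : ℕ → Prop
  | 0 => y = 0 ∧ table.halt z
  | 1 => y = 0 ∧ table.isQuery z
  | 2 => y = 0 ∧ table.ask z = some false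
  | 3 => y = 0 ∧ table.ask z = some true
  | 4 => y = 0 ∧ table.out z = some false
  | 5 => y = 0 ∧ table.out z = some true
  | 6 => y < table.push z
  | 7 => y < table.next z
  | 8 => y < table.nextYes z
  | 9 => (∀ O' x k, (table.run O' (startOf z) x k).Bounded z) ∧ Sound O y z
  | 10 => y < startOf z
  | 11 => y < clockOf z
  | 12 => diagTime (exponent y) z < oddPart y
  | 13 => diagTime (exponent y) z < oddPart y ∧ Complex O (exponent y) z
  | _ => False

/-- The oracle contains `0ᵖ` if `p` is the position of a query with a positive answer. -/
noncomputable def oracle (p : ℕ) : Prop :=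
  ∃ i z y, i < 16 ∧ p = pos i z y ∧ Fact (tally fun q => ∃ _ : q < p, oracle q) z y i
termination_by p

/-- The part of the oracle for the words of length less than `p`. -/
def oracleBelow (p : ℕ) : Set Word := tally fun q => q < p ∧ oracle q

theorem oracle_pos {i : ℕ} (hi : i < 16) (z y : ℕ) :
    oracle (pos i z y) ↔ Fact (oracleBelow (pos i z y)) z y i := by
  rw [oracle]
  simp only [exists_prop]
  constructor
  · rintro ⟨i', z', y', hi', he, h⟩
    obtain ⟨rfl, rfl, rfl⟩ := pos_inj hi hi' he
    exact h
  · exact fun h => ⟨i, z, y, hi, rfl, h⟩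

theorem agreeUpTo_oracleBelow {N p : ℕ} (h : N < p) :
    AgreeUpTo N (tally oracle) (oracleBelow p) := by
  intro w hw
  constructor
  · rintro ⟨n, rfl, hn⟩
    rw [List.length_replicate] at hw
    exact ⟨n, rfl, hw.trans_lt h, hn⟩
  · rintro ⟨n, rfl, -, hn⟩
    exact ⟨n, rfl, hn⟩

/-- The queries in the first `clockOf a` steps are so short that cutting off the oracle is harmless. -/
theorem outputs_oracleBelow {a κ : ℕ} {x w : Word} :
    table.Outputs (oracleBelow (pos 9 a κ)) (startOf a) x (clockOf a) w ↔
      table.Outputs (tally oracle) (startOf a) x (clockOf a) w :=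
  Table.outputs_congr (agreeUpTo_oracleBelow (left_lt_pos (by omega) a κ)) (clockOf_le a)

theorem answers_oracle : table.Answers oracle where
  halt z := (oracle_pos (by omega) z 0).trans (and_iff_right rfl)
  isQuery z := (oracle_pos (by omega) z 0).trans (and_iff_right rfl)
  ask_false z := (oracle_pos (by omega) z 0).trans (and_iff_right rfl)
  ask_true z := (oracle_pos (by omega) z 0).trans (and_iff_right rfl)
  out_false z := (oracle_pos (by omega) z 0).trans (and_iff_right rfl)
  out_true z := (oracle_pos (by omega) z 0).trans (and_iff_right rfl)
  push z y := oracle_pos (by omega) z y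
  next z y := oracle_pos (by omega) z y
  nextYes z y := oracle_pos (by omega) z y

/-! ### P-optimal proof systems -/

/-- A set has a p-optimal proof system if there is a description `κ` of it such that the oracle
vouches for `κ` only where this is correct, and it does so for all machines that output only elements
of the set if the degree of the time bound is sufficiently large. -/
theorem hasPOptimalProofSystem_of_sound {L : Set Word} (hL : L.Nonempty) (κ : ℕ)
    (hsound : ∀ a, Sound (oracleBelow (pos 9 a κ)) κ a →
      ∀ x w, table.Outputs (tally oracle) (startOf a) x (clockOf a) w → w ∈ L)
    (hcomplete : ∀ i, (∀ x k w, table.Outputs (tally oracle) (startCode i) x k w → w ∈ L) →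
      ∃ C, ∀ a, (Nat.unpair (exponent a)).1 = i → C ≤ degreeOf a →
        oddPart a + degreeOf a < a → Sound (oracleBelow (pos 9 a κ)) κ a) :
    HasPOptimalProofSystem (tally oracle) L := by
  obtain ⟨d, hd⟩ := hL
  have h9 : ∀ a, oracle (pos 9 a κ) ↔ _ := fun a => oracle_pos (by omega) a κ
  obtain ⟨f, hf, hf1, hf2⟩ := exists_universal answers_oracle startOf clockOf
    (fun a y => oracle_pos (by omega) a y) (fun a y => oracle_pos (by omega) a y) κ
    (fun a ha => ⟨clockOf_le a, ((h9 a).1 ha).1 _⟩) d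
  -- Every polynomial-time function with values in `L` is simulated by `f`, even if it is not onto;
  -- applied to constant functions, this also shows that `f` is onto.
  have key : ∀ g, InFP (tally oracle) g → (∀ x, g x ∈ L) → PSimulated (tally oracle) g f := by
    rintro g ⟨M, p, hM⟩ hg
    obtain ⟨i, hi⟩ := M.exists_similar
    have hsim : ∀ x, ∃ k ≤ (p.eval x.length + 1) * (2 * (x.length + p.eval x.length) + 5),
        table.Outputs (tally oracle) (startCode i) x k (g x) := fun x =>
      table_outputs (hi.outputsWithin.1 (hM x))
    obtain ⟨C, hC⟩ := hcomplete i fun x k w hw => by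
      obtain ⟨k', -, h'⟩ := hsim x
      rw [hw.unique h']
      exact hg x
    obtain ⟨B, hB⟩ := exists_bounded i
    set T : ℕ → ℕ := fun n => (p.eval n + 1) * (2 * (n + p.eval n) + 5) with hT
    set c := C + B + 1 with hc
    have hTp : PolyBounded T := ((PolyBounded.eval p).add (.const 1)).mul
      (((PolyBounded.const 2).mul (PolyBounded.id.add (.eval p))).add (.const 5))
    obtain ⟨D, hD⟩ := ((hTp.add (.const c)).pow c).le_pow
    set q := Nat.pair i c with hq
    have hu : Nat.unpair q = (i, c) := Nat.unpair_pair i c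
    have hpad : PolyBounded fun n => n + (1 + (2 ^ q + (n + D) ^ D * 2 ^ (q + 1))) :=
      PolyBounded.id.add ((PolyBounded.const 1).add ((PolyBounded.const _).add
        (((PolyBounded.id.add (.const D)).pow D).mul (.const _))))
    obtain ⟨P, hP⟩ := hpad
    refine ⟨_, P, .pad _ (2 ^ q) (2 ^ (q + 1)) D, fun x => ⟨?_, ?_⟩⟩
    · refine le_trans (le_of_eq ?_) (hP x.length)
      simp only [List.length_append, List.length_cons, List.length_replicate]
      omega
    · set m := (x.length + D) ^ D with hm
      set a := 2 ^ q + m * 2 ^ (q + 1) with ha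
      have he : exponent a = q := exponent_eq q m
      have ho : oddPart a = m := oddPart_eq q m
      have hdeg : degreeOf a = c := by rw [degreeOf, he, hu]
      have hst : startOf a = startCode i := by rw [startOf, he, hu]
      -- The exponent is at least `c`, so `a` exceeds its odd part by every constant that `c` exceeds.
      have hqc : c < 2 ^ q := (Nat.right_le_pair i c).trans_lt Nat.lt_two_pow_self
      have ham : m + c < a := by
        have : m * 1 ≤ m * 2 ^ (q + 1) := Nat.mul_le_mul_left m Nat.one_le_two_pow
        omega
      have hclock : T x.length ≤ clockOf a := by
        have h1 : (T x.length + c) ^ c ≤ m := hD x.length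
        have h2 : T x.length + c ≤ (T x.length + c) ^ c := Nat.le_self_pow (by omega) _
        refine Nat.le_findGreatest ?_ ?_
        · rw [ho]; omega
        · rw [ho, hdeg]; exact h1
      obtain ⟨k, hk, hout⟩ := hsim x
      refine hf1 x a (g x) ((h9 a).2 ⟨?_, ?_⟩) ?_
      · intro O' x k
        rw [hst]
        exact hB a (by omega) O' x k
      · exact hC a (by rw [he, hu]) (by rw [hdeg]; omega) (by rw [ho, hdeg]; exact ham)
      · rw [hst]
        exact hout.mono (hk.trans hclock)
  refine ⟨f, ⟨hf, Set.eq_of_subset_of_subset ?_ fun y hy => ?_⟩, fun g hg => key g hg.1 fun x =>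
    hg.2 ▸ Set.mem_range_self x⟩
  · rintro _ ⟨w, rfl⟩
    rcases hf2 w with h | ⟨x, a, ha, hw⟩
    · rwa [h]
    · exact hsound a ((h9 a).1 ha).2 x _ hw
  · obtain ⟨π, _, _, h⟩ := key _ (InFP.const _ y) fun _ => hy
    exact ⟨π [], (h []).2⟩

/-- The assumption `c ^ c ≤ degreeOf a` is for the case that `clockOf a` is 0 by default. -/
theorem clockOf_pow_le {a c : ℕ} (hc : c ^ c + c ≤ degreeOf a) (ha : oddPart a + degreeOf a < a) :
    (clockOf a + c) ^ c ≤ a := by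
  rcases eq_or_ne (clockOf a) 0 with h | h
  · rw [h, Nat.zero_add]; omega
  · have := Nat.findGreatest_of_ne_zero rfl h
    rw [← clockOf] at this
    have h1 : (clockOf a + c) ^ c ≤ (clockOf a + degreeOf a) ^ degreeOf a :=
      (Nat.pow_le_pow_left (by omega) c).trans (Nat.pow_le_pow_right (by omega) (by omega))
    omega

theorem hasPOptimalProofSystem_of_inPSPACE {L : Set Word} (hL : L.Nonempty)
    (h : InPSPACE (tally oracle) L) : HasPOptimalProofSystem (tally oracle) L := by
  obtain ⟨M, p, hM⟩ := h
  obtain ⟨j, hj⟩ := M.exists_similar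
  obtain ⟨c, hc⟩ := (PolyBounded.eval p).le_pow
  have hspace : ∀ w k, ((mach j).run (tally oracle) w k).oracleTape.length ≤ (w.length + c) ^ c :=
    fun w k => by
      rw [← hj.oracleTape]
      exact (Nat.le_add_left _ _).trans (((hM w).2 k).trans (hc _))
  have hacc : ∀ w, (∃ n, (mach j).verdict ((mach j).run (tally oracle) w n) = some true) ↔
      w ∈ L := by
    intro w
    obtain ⟨n, hn⟩ := (hM w).1
    rw [hj.decidesWithin] at hn
    constructor
    · rintro ⟨k, hk⟩
      rcases hn with ⟨h, -⟩ | ⟨-, h⟩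
      · exact h
      · rw [OTM.run_eq_of_verdict (m := k) (by rw [h]; rfl) (by rw [hk]; rfl), h] at hk
        simp at hk
    · rcases hn with ⟨-, h⟩ | ⟨h, -⟩
      · exact fun _ => ⟨n, h⟩
      · exact fun h' => absurd h' h
  -- On the outputs in question, the machine does not notice that the oracle is cut off.
  have hrun : ∀ {a p}, (clockOf a + c) ^ c ≤ a → a < p → ∀ {x w},
      table.Outputs (tally oracle) (startOf a) x (clockOf a) w → ∀ n,
      (mach j).run (oracleBelow p) w n = (mach j).run (tally oracle) w n := by
    intro a p ha hp x w hw n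
    refine OTM.run_congr (agreeUpTo_oracleBelow hp) fun k _ => ?_
    have hl := (table.length_run_le (O := tally oracle) (startOf a) x (clockOf a)).2.2
    rw [hw.2] at hl
    exact (hspace w k).trans ((Nat.pow_le_pow_left (by omega) c).trans ha)
  refine hasPOptimalProofSystem_of_sound hL (2 * Nat.pair j c) ?_ ?_
  · rintro a (⟨j', c', he, ha, hs⟩ | ⟨e, he, -⟩) x w hw
    · obtain ⟨rfl, rfl⟩ := Nat.pair_eq_pair.1 (by omega : Nat.pair j c = Nat.pair j' c')
      obtain ⟨n, hn⟩ := hs x w (outputs_oracleBelow.2 hw)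
      rw [hrun ha (left_lt_pos (by omega) a _) hw] at hn
      exact (hacc w).1 ⟨n, hn⟩
    · omega
  · intro i hi
    refine ⟨c ^ c + c, fun a hai hC ha => .inl ⟨j, c, rfl, clockOf_pow_le hC ha, fun x w hw => ?_⟩⟩
    have hw' := outputs_oracleBelow.1 hw
    have hw'' := hw'
    rw [startOf, hai] at hw''
    obtain ⟨n, hn⟩ := (hacc w).2 (hi x _ w hw'')
    exact ⟨n, by rwa [hrun (clockOf_pow_le hC ha) (left_lt_pos (by omega) a _) hw']⟩

theorem hasPOptimalProofSystem_complex (e : ℕ) :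
    HasPOptimalProofSystem (tally oracle) (tally (Complex (tally oracle) e)) := by
  have hcom : ∀ {a κ n}, diagTime e n ≤ a →
      (Complex (oracleBelow (pos 9 a κ)) e n ↔ Complex (tally oracle) e n) := fun {a κ _} h =>
    complex_congr (agreeUpTo_oracleBelow (h.trans_lt (left_lt_pos (by omega) a κ)))
  refine hasPOptimalProofSystem_of_sound ⟨zeros 0, 0, rfl, complex_zero _ e⟩ (2 * e + 1) ?_ ?_
  · rintro a (⟨j, c, he, -⟩ | ⟨e', he, hs⟩) x w hw
    · omega
    · obtain rfl : e = e' := by omega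
      obtain ⟨n, rfl, hn, hL⟩ := hs x w (outputs_oracleBelow.2 hw)
      exact zeros_mem_tally.2 ((hcom hn).1 hL)
  · intro i hi
    refine ⟨diagTime e ((i + 1) * (i + 1)), fun a hai hC ha => .inr ⟨e, rfl, fun x w hw => ?_⟩⟩
    have hw' := outputs_oracleBelow.1 hw
    rw [startOf, hai] at hw'
    obtain ⟨n, rfl, hL⟩ := hi x _ w hw'
    have h1 := diagTime_le_of_hits hi ⟨x, hw'⟩
    have h2 : clockOf a ≤ oddPart a := Nat.findGreatest_le _
    have h3 : diagTime e n ≤ a := by omega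
    exact ⟨n, rfl, h3, (hcom h3).2 hL⟩

theorem decidableIn_complex (e : ℕ) :
    DecidableIn (tally oracle) (tally (Complex (tally oracle) e)) := by
  refine .of_listed (A := 2 ^ e) (B := 2 ^ (e + 1)) (V := diagTime e) (fun n m => ?_)
    fun n m h => ?_
  · rw [oracle_pos (by omega)]
    simp only [Fact, exponent_eq, oddPart_eq]
  · rw [oracle_pos (by omega)]
    simp only [Fact, exponent_eq, oddPart_eq, h, true_and]
    refine complex_congr (agreeUpTo_oracleBelow ?_)
    have h1 : oddPart (2 ^ e + m * 2 ^ (e + 1)) ≤ 2 ^ e + m * 2 ^ (e + 1) := oddPart_le _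
    rw [oddPart_eq] at h1
    exact h.trans_le (h1.trans (right_le_pos _ _ _))

end OracleTuring

theorem mainTheorem4 :
    ∃ O : Set OracleTuring.Word, OracleTuring.IsTally O ∧
      (∀ L : Set OracleTuring.Word, L.Nonempty → OracleTuring.InPSPACE O L →
        OracleTuring.HasPOptimalProofSystem O L) ∧
      (∀ t : ℕ → ℕ, OracleTuring.TimeConstructible t →
        ∃ L : Set OracleTuring.Word, OracleTuring.DecidableIn O L ∧
          ¬ OracleTuring.InDTIME O t L ∧ OracleTuring.HasPOptimalProofSystem O L) := by
  refine ⟨OracleTuring.tally OracleTuring.oracle, fun w ⟨n, hw, _⟩ => ⟨n, hw⟩,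
    fun L => OracleTuring.hasPOptimalProofSystem_of_inPSPACE, fun t ht => ?_⟩
  obtain ⟨e, he⟩ := OracleTuring.exists_timeFun_eq ht
  exact ⟨_, OracleTuring.decidableIn_complex e, OracleTuring.not_inDTIME_complex _ he,
    OracleTuring.hasPOptimalProofSystem_complex e⟩
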